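/- Let $\Phi$ be Gaussian white noise on a probability space: an almost surely linear, centred, jointly Gaussian family of complex random variables $\Phi(\varphi)$, indexed by the complex Schwartz functions $\varphi$ on $\mathbb R$, with $\mathbb E[\Phi(\varphi)\overline{\Phi(\psi)}]=\int\varphi\overline\psi$ and $\mathbb E[\Phi(\varphi)\Phi(\psi)]=\int\varphi\psi$. Let $f(s)=Ae^{2\pi i\xi_0 s}$ with $A\ge 0$, $\xi_0>0$ (null case: $A=0$; non-null case: $A>0$), $h(x)=(2\pi)^{-1/2}e^{-x^2/2}$ and $h_{t,\eta}(s)=h(s-t)e^{-2\pi i\eta(s-t)}$. Put $V_\eta=\int f h_{t,\eta}+\Phi(h_{t,\eta})$, $\partial_tV_\eta=\partial_t\!\int f h_{t,\eta}+\Phi(\partial_t h_{t,\eta})$, $\Omega_\eta=\frac1{2\pi i}\frac{\partial_tV_\eta}{V_\eta}$, $g_\alpha(z)=\frac1{\pi\alpha}e^{-|z|^2/\alpha}$, and $$Y_{\alpha,\eta}=V_\eta\,g_\alpha(\xi-\Omega_\eta),\qquad \xi,\eta,\alpha>0,\ t\in\mathbb R .$$ (1) Fix $A\ge0$, $\xi_0>0$,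 $t$, $\xi>0$ and an integer $k\ge1$. All $Y_{\alpha,\eta}$ have a finite $k$-th absolute moment. There are $\alpha_0>0$ and functions $c,C,K$ of $\eta>0$, with $c>0$ everywhere, such that for all $\eta>0$ and $0<\alpha<\alpha_0$ $$c(\eta)\,\alpha^{-k+1}\le\mathbb E|Y_{\alpha,\eta}|^k\le C(\eta)\,\alpha^{-k+1},\qquad |\mathbb E Y_{\alpha,\eta}^k|\le K(\eta)\,\alpha^{-k+1},$$ where $C(\eta)$ and $K(\eta)$ are $O(\eta^{-1/2})$ as $\eta\to0^+$ and, as $\eta\to\infty$, $K(\eta)=O(e^{-4\pi\eta^2})$ in the null case and $K(\eta)=O(e^{-(\eta-\xi_0)^2})$ in the non-null case. If $A=0$ and $k$ is odd, then $\mathbb E Y_{\alpha,\eta}^k=0$ for all $\alpha,\eta>0$. (2) Fix $A\ge0$, $\xi_0>0$, $t$ and $\xi>0$. There are functions $c,C$ of $\eta>0$, with $c>0$ everywhere and $C(\eta)=O(\eta^{-1/2})$ as $\eta\to0^+$, such that for every $\eta>0$ one has $c(\eta)\alpha^{-1}\le\operatorname{Var}(Y_{\alpha,\eta})\le C(\eta)\alpha^{-1}$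 for all sufficiently small $\alpha>0$, where $\operatorname{Var}(X)=\mathbb E|X-\mathbb EX|^2$. Moreover, there are $\alpha_0>0$ and a function $K$ such that $|\operatorname{Cov}(Y_{\alpha,\eta},\overline{Y_{\alpha,\eta}})|\le K(\eta)\alpha^{-1}$ for all $\eta>0$ and $0<\alpha<\alpha_0$, where $\operatorname{Cov}(X,Z)=\mathbb E[(X-\mathbb EX)\overline{(Z-\mathbb EZ)}]$. (3) Let $\eta=\xi=\xi_0$. There are $m,M,\Xi>0$ and a positive strictly increasing function $\phi$ on $(0,\infty)$ such that for every $A>0$ there is $\alpha_0>0$ with $m\,\phi(A)\le|\mathbb E Y_{\alpha,\xi_0}|\le M\,\phi(A)$ for all $\xi_0\ge\Xi$, $t\in\mathbb R$ and $0<\alpha<\alpha_0$. (Thus $|\mathbb E Y_{\alpha,\xi_0}|\asymp1$ for large $\xi_0$, with constants increasing in $A$.) (4) Let $\eta=\xi_0$. For all $A,\xi_0>0$ there are $C$ and $R,\alpha_0>0$ such that $|\mathbb E Y_{\alpha,\xi_0}|\le C\,|\xi-\xi_0|^{-5}$ for all $t\in\mathbb R$, $\xi>0$ with $|\xi-\xi_0|\ge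 R$, and $0<\alpha<\alpha_0$. Moreover, there are $\Xi,R,\alpha_0>0$ and a strictly increasing function $C$ on $(0,\infty)$ such that $|\mathbb E Y_{\alpha,\xi_0}|\le C(A\xi_0)\,|\xi-\xi_0|^{-5}$ for all $A>0$, $\xi_0\ge\Xi$, $t\in\mathbb R$, $\xi>0$ with $|\xi-\xi_0|\ge R$, and $0<\alpha<\alpha_0$. -/

import Mathlib

open MeasureTheory ProbabilityTheory Filter Topology Asymptotics Set
open scoped SchwartzMap

noncomputable section

namespace SST

/-- The Gaussian `x ↦ exp (-x² / 2)` as a real Schwartz function. -/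
def gaussianSchwartz : 𝓢(ℝ, ℝ) where
  toFun x := Real.exp (-(x ^ 2 / 2))
  smooth' := by fun_prop
  decay' := by
    intro k n
    let p : Polynomial ℝ :=
      Polynomial.X ^ k * (Polynomial.hermite n).map (algebraMap ℤ ℝ)
    let q : ℝ → ℝ := fun x => p.eval x * Real.exp (-(x ^ 2 / 2))
    have hlim : ∀ m : ℕ, Tendsto (fun x : ℝ => |x| ^ m * Real.exp (-(x ^ 2 / 2)))
        (cocompact ℝ) (𝓝 0) := by
      intro m
      have h := tendsto_rpow_abs_mul_exp_neg_mul_sq_cocompact (a := 1 / 2) (by norm_num) (m : ℝ)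
      refine h.congr fun x => ?_
      rw [Real.rpow_natCast]
      congr 2
      ring
    have hq : Tendsto q (cocompact ℝ) (𝓝 0) := by
      have hsum : Tendsto (fun x : ℝ => ∑ i ∈ Finset.range (p.natDegree + 1),
          |p.coeff i| * (|x| ^ i * Real.exp (-(x ^ 2 / 2)))) (cocompact ℝ) (𝓝 0) := by
        have := tendsto_finsetSum (Finset.range (p.natDegree + 1))
          (fun i _ => (hlim i).const_mul |p.coeff i|)
        simpa using this
      refine squeeze_zero_norm (fun x => ?_) hsum
      simp only [q, Polynomial.eval_eq_sum_range]
      rw [Finset.sum_mul]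
      refine (norm_sum_le _ _).trans (Finset.sum_le_sum fun i _ => ?_)
      rw [Real.norm_eq_abs, abs_mul, abs_mul, abs_pow, Real.abs_exp, mul_assoc]
    have hc : Continuous q := by
      have := p.continuous
      fun_prop
    obtain ⟨C, hC⟩ := (ZeroAtInftyContinuousMap.mk ⟨q, hc⟩ hq :
      ZeroAtInftyContinuousMap ℝ ℝ).toBCF.bddAbove_range_norm_comp
    refine ⟨C, fun x => ?_⟩
    have h1 : ‖iteratedFDeriv ℝ n (fun x : ℝ => Real.exp (-(x ^ 2 / 2))) x‖
        = ‖(Polynomial.aeval x (Polynomial.hermite n)) * Real.exp (-(x ^ 2 / 2))‖ := by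
      rw [norm_iteratedFDeriv_eq_norm_iteratedDeriv, iteratedDeriv_eq_iterate,
        Polynomial.deriv_gaussian_eq_hermite_mul_gaussian, mul_assoc, norm_mul]
      simp
    have h2 : ‖q x‖ ≤ C := hC ⟨x, rfl⟩
    rw [h1, ← norm_pow, ← norm_mul]
    refine le_trans (le_of_eq ?_) h2
    simp only [q, p, Polynomial.eval_mul, Polynomial.eval_pow, Polynomial.eval_X,
      Polynomial.eval_map_algebraMap]
    rw [mul_assoc]

/-- The window `h(x) = (2π)^{-1/2} exp (-x² / 2)`. -/
def gaussWindow : 𝓢(ℝ, ℂ) :=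
  ((Real.sqrt (2 * Real.pi))⁻¹ : ℂ) •
    SchwartzMap.postcompCLM (𝕜 := ℝ) Complex.ofRealCLM gaussianSchwartz

theorem gaussWindow_apply (x : ℝ) :
    gaussWindow x = (((Real.sqrt (2 * Real.pi))⁻¹ * Real.exp (-(x ^ 2 / 2)) : ℝ) : ℂ) := by
  have h : gaussWindow x = ((Real.sqrt (2 * Real.pi))⁻¹ : ℂ) *
      ((Real.exp (-(x ^ 2 / 2)) : ℝ) : ℂ) := rfl
  rw [h]
  push_cast
  rfl

theorem hasTemperateGrowth_modulation (η : ℝ) :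
    (fun s : ℝ => Complex.exp (-(2 * Real.pi * Complex.I * η * s))).HasTemperateGrowth := by
  have hd : ∀ n : ℕ, iteratedDeriv n
      (fun s : ℝ => Complex.exp (-(2 * Real.pi * Complex.I * η * s))) =
      fun s : ℝ => (-(2 * Real.pi * Complex.I * η)) ^ n *
        Complex.exp (-(2 * Real.pi * Complex.I * η * s)) := by
    intro n
    induction n with
    | zero => simp
    | succ n ih =>
      rw [iteratedDeriv_succ, ih]
      funext s
      have h0 : HasDerivAt (fun s : ℝ => -(2 * Real.pi * Complex.I * η * (s : ℂ)))
          (-(2 * Real.pi * Complex.I * η)) s := by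
        have h := (((hasDerivAt_id s).ofReal_comp).const_mul (2 * Real.pi * Complex.I * η)).neg
        simp only [id, Complex.ofReal_one, mul_one] at h
        exact h
      have h1 := (h0.cexp).const_mul ((-(2 * Real.pi * Complex.I * η)) ^ n)
      rw [h1.deriv]
      ring
  have hsm : ContDiff ℝ (⊤ : ℕ∞)
      (fun s : ℝ => Complex.exp (-(2 * Real.pi * Complex.I * η * s))) :=
    ((contDiff_const.mul Complex.ofRealCLM.contDiff).neg).cexp
  refine ⟨hsm, fun n => ⟨0, ‖(-(2 * Real.pi * Complex.I * η)) ^ n‖, fun s => ?_⟩⟩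
  rw [norm_iteratedFDeriv_eq_norm_iteratedDeriv, hd n, norm_mul, Complex.norm_exp]
  simp

/-- The time-frequency shift `h_{t,η}(s) = h(s - t) exp (-2πiη(s - t))`. -/
def tfShift (h : 𝓢(ℝ, ℂ)) (t η : ℝ) : 𝓢(ℝ, ℂ) :=
  SchwartzMap.compSubConstCLM ℂ t
    (SchwartzMap.smulLeftCLM ℂ
      (fun s : ℝ => Complex.exp (-(2 * Real.pi * Complex.I * η * s))) h)

theorem tfShift_apply (h : 𝓢(ℝ, ℂ)) (t η s : ℝ) :
    tfShift h t η s =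
      h (s - t) * Complex.exp (-(2 * Real.pi * Complex.I * η * ((s - t : ℝ) : ℂ))) := by
  rw [tfShift, SchwartzMap.compSubConstCLM_apply,
    SchwartzMap.smulLeftCLM_apply_apply (hasTemperateGrowth_modulation η), smul_eq_mul, mul_comm]

/-- The time derivative `∂_t h_{t,η} = -(h')_{t,η} + 2πiη h_{t,η}`;
see `hasDerivAt_tfShift`. -/
def tfShiftDt (h : 𝓢(ℝ, ℂ)) (t η : ℝ) : 𝓢(ℝ, ℂ) :=
  -(tfShift (SchwartzMap.derivCLM ℂ ℂ h) t η) +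
    (2 * Real.pi * Complex.I * η : ℂ) • tfShift h t η

theorem hasDerivAt_tfShift (h : 𝓢(ℝ, ℂ)) (t η s : ℝ) :
    HasDerivAt (fun τ => tfShift h τ η s) (tfShiftDt h t η s) t := by
  have hs : HasDerivAt (fun τ : ℝ => s - τ) (-1) t := by
    simpa using (hasDerivAt_id t).const_sub s
  have h0 : HasDerivAt (fun u : ℝ => h u) (deriv h (s - t)) (s - t) :=
    (h.differentiable (s - t)).hasDerivAt
  have h1 : HasDerivAt (fun τ : ℝ => h (s - τ)) (-(deriv h (s - t))) t := by
    have h := HasDerivAt.scomp t h0 hs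
    simp only [neg_smul, one_smul] at h
    exact h
  have h2 : HasDerivAt
      (fun τ : ℝ => -(2 * Real.pi * Complex.I * η * ((s - τ : ℝ) : ℂ)))
      (2 * Real.pi * Complex.I * η) t := by
    have h := ((hs.ofReal_comp).const_mul (2 * Real.pi * Complex.I * η)).neg
    simp only [Complex.ofReal_neg, Complex.ofReal_one, mul_neg, mul_one, neg_neg] at h
    exact h
  have h3 := h1.mul h2.cexp
  have e1 : (fun τ => tfShift h τ η s) = fun τ : ℝ => h (s - τ) *
      Complex.exp (-(2 * Real.pi * Complex.I * η * ((s - τ : ℝ) : ℂ))) := by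
    funext τ; rw [tfShift_apply]
  rw [e1]
  refine h3.congr_deriv (Eq.symm ?_)
  have e2 : tfShiftDt h t η s = -(tfShift (SchwartzMap.derivCLM ℂ ℂ h) t η s) +
      (2 * Real.pi * Complex.I * η : ℂ) * tfShift h t η s := rfl
  rw [e2, tfShift_apply, tfShift_apply, SchwartzMap.derivCLM_apply]
  ring

variable {Ω : Type*} [MeasurableSpace Ω]

/-- `Φ` is the Gaussian white noise with flat power spectrum on the probability space `(Ω, P)`:
an (almost surely) linear, centred, jointly Gaussian family of complex random variables
indexed by the complex Schwartz functions, with covariance functional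
`E[Φ(φ) conj Φ(ψ)] = ∫ φ conj ψ` and pseudocovariance functional `E[Φ(φ) Φ(ψ)] = ∫ φ ψ`. -/
structure IsWhiteNoise (P : Measure Ω) (Φ : 𝓢(ℝ, ℂ) → Ω → ℂ) : Prop where
  linear : ∀ (a b : ℂ) (φ ψ : 𝓢(ℝ, ℂ)),
    Φ (a • φ + b • ψ) =ᵐ[P] fun ω => a * Φ φ ω + b * Φ ψ ω
  gaussian : IsGaussianProcess Φ P
  mean : ∀ φ : 𝓢(ℝ, ℂ), ∫ ω, Φ φ ω ∂P = 0
  covariance : ∀ φ ψ : 𝓢(ℝ, ℂ),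
    ∫ ω, Φ φ ω * (starRingEnd ℂ) (Φ ψ ω) ∂P = ∫ s, φ s * (starRingEnd ℂ) (ψ s)
  pseudocovariance : ∀ φ ψ : 𝓢(ℝ, ℂ),
    ∫ ω, Φ φ ω * Φ ψ ω ∂P = ∫ s, φ s * ψ s

/-- The harmonic signal `f(s) = A exp (2πiξ₀s)`. -/
def signal (A ξ₀ : ℝ) (s : ℝ) : ℂ := A * Complex.exp (2 * Real.pi * Complex.I * ξ₀ * s)

/-- The short-time Fourier transform `V_f(t,η) = f(h_{t,η})` of a function `f`. -/
def signalSTFT (f : ℝ → ℂ) (h : 𝓢(ℝ, ℂ)) (t η : ℝ) : ℂ := ∫ s, f s * tfShift h t η s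

/-- `V_{f+Φ}(t,η) = f(h_{t,η}) + Φ(h_{t,η})`. -/
def stft (f : ℝ → ℂ) (Φ : 𝓢(ℝ, ℂ) → Ω → ℂ) (h : 𝓢(ℝ, ℂ)) (t η : ℝ) (ω : Ω) : ℂ :=
  signalSTFT f h t η + Φ (tfShift h t η) ω

/-- `∂_t V_{f+Φ}(t,η) = ∂_t f(h_{t,η}) + Φ(∂_t h_{t,η})`. -/
def stftDt (f : ℝ → ℂ) (Φ : 𝓢(ℝ, ℂ) → Ω → ℂ) (h : 𝓢(ℝ, ℂ)) (t η : ℝ) (ω : Ω) : ℂ :=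
  deriv (fun τ => signalSTFT f h τ η) t + Φ (tfShiftDt h t η) ω

/-- The reassignment rule `(2πi)⁻¹ ∂_t V / V`. Its value where `V = 0` (conventionally `-∞`)
plays no role, because the integrand `sstIntegrand` below vanishes there in any case. -/
def reassignment (f : ℝ → ℂ) (Φ : 𝓢(ℝ, ℂ) → Ω → ℂ) (h : 𝓢(ℝ, ℂ)) (t η : ℝ) (ω : Ω) : ℂ :=
  1 / (2 * Real.pi * Complex.I) * (stftDt f Φ h t η ω / stft f Φ h t η ω)

/-- The approximate delta `g_α(z) = (πα)⁻¹ exp (-|z|² / α)` on `ℂ`. -/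
def approxDelta (α : ℝ) (z : ℂ) : ℝ := 1 / (Real.pi * α) * Real.exp (-(‖z‖ ^ 2 / α))

/-- The integrand `V(t,η) g_α(ξ - Ω(t,η))` of the synchrosqueezing transform of `f + Φ`
with window `h`. -/
def sstIntegrand (f : ℝ → ℂ) (Φ : 𝓢(ℝ, ℂ) → Ω → ℂ) (h : 𝓢(ℝ, ℂ)) (α ξ t η : ℝ) (ω : Ω) : ℂ :=
  stft f Φ h t η ω * approxDelta α (ξ - reassignment f Φ h t η ω)

/-- The random variable `Y_{α,η}`: the synchrosqueezing integrand at time `t` and output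
frequency `ξ` for the signal `A exp (2πiξ₀s)` in the noise `Φ`, with Gaussian window. -/
def Y (Φ : 𝓢(ℝ, ℂ) → Ω → ℂ) (A ξ₀ t ξ α η : ℝ) : Ω → ℂ :=
  sstIntegrand (signal A ξ₀) Φ gaussWindow α ξ t η

/-- The covariance `E[(X - E X) conj (Z - E Z)]` of complex random variables. -/
def complexCov (P : Measure Ω) (X Z : Ω → ℂ) : ℂ :=
  ∫ ω, (X ω - ∫ ω', X ω' ∂P) * (starRingEnd ℂ) (Z ω - ∫ ω', Z ω' ∂P) ∂P

/-- The variance `E|X - E X|²` of a complex random variable. -/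
def complexVar (P : Measure Ω) (X : Ω → ℂ) : ℝ :=
  ∫ ω, ‖X ω - ∫ ω', X ω' ∂P‖ ^ 2 ∂P

end SST

end

/-! For the Gaussian window `h' = -x h`, so `∂_t h_{t,η} = (s - t) h_{t,η} + 2πiη h_{t,η}`, and `Y`
is almost surely a function of the Gaussian pair `z = Φ(h_{t,η})`, `m = Φ((· - t) h_{t,η})`. With
`v` the transform of the signal, `V = v + z` and `U = 2πi(ξ₀ - ξ)v + m - 2πi(ξ - η)z`, one has `ξ -
Ω = -U / (2πiV)`, hence `Y = (πα)⁻¹ V exp(-|U|² / (4π²α|V|²))`.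

The substitution `U = 2π√α |V| w` (fibre coordinates `(V, w)`) has Jacobian `4π²α|V|²` and turns `Y`
into `(πα)⁻¹ e^{-|w|²} V`; this is `IsWhiteNoise.map_Y`. The factor `α^(1-k)` of every `k`-th moment
is then explicit, and the remaining integral depends on `α` only through a Gaussian density. For
fixed `η > 0` the law of `(z, m)` is nondegenerate: `(re z, im m)` and `(im z, re m)` are
independent with explicit covariances. So the density has a Gaussian majorant in `V` uniform in `α`,
and a positive minimum on compact sets as `α → 0`. This gives the two-sided moment bounds and, since
the mean stays bounded, those for the variance.

As `η → 0` the noise becomes real and the density of `(z, m)` degenerates. The numerator `U` does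
not, because `ξ > 0`. Regressing `z` on `U` instead of `m` on `z` (`exists_integral_dampedPow_le`)
bounds the absolute moments by a constant times `α^(1-k)`, which is better than `η^(-1/2)`.

As `η → ∞` the pseudocovariances decay like `exp(-4π²η²)` up to polynomial factors. For the limiting
circular law without signal, rotation by a root of `-1` shows that all moments of order `k ≥ 1`
vanish. A Lipschitz estimate for Gaussian densities (`noiseDensity_sub_le`) bounds the moment by the
parameter error plus the size of the signal terms (`norm_integral_momentIntegrand_le`).

On the ridge `η = ξ = ξ₀` the limit `α → 0` leaves the integral of an even weight against `|z +
v|²(z + v)`, and symmetrisation in `z` shows that it has size `|v|(1 + |v|²)` with `|v| = A`. Off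
the ridge, `m` has size about `|ξ - ξ₀||V|` unless `w` is large. The integral of `|V|³` against a
Gaussian of width `|ξ - ξ₀|⁻¹` in the plane gives the exponent `-5`. -/

namespace SST

/-! ### Gaussian Fourier integrals with polynomial factors. -/

lemma integrable_pow_mul_cexp_sq (n : ℕ) (τ : ℝ) :
    Integrable fun u : ℝ => (u : ℂ) ^ n *
      (Complex.exp (Complex.I * τ * u) * Complex.exp (-1 * (u : ℂ) ^ 2)) := by
  have h := (integrable_rpow_mul_exp_neg_mul_sq (b := 1) one_pos (s := n)
    (by have : (0 : ℝ) ≤ n := n.cast_nonneg; linarith)).norm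
  refine h.mono' (by fun_prop) (ae_of_all _ fun u => le_of_eq ?_)
  have e1 : Complex.I * τ * u = ((τ * u : ℝ) : ℂ) * Complex.I := by push_cast; ring
  have e2 : (-1 * (u : ℂ) ^ 2) = ((-1 * u ^ 2 : ℝ) : ℂ) := by push_cast; ring
  rw [e1, e2, norm_mul, norm_mul, Complex.norm_exp_ofReal_mul_I, ← Complex.ofReal_exp,
    Complex.norm_real, norm_pow, Complex.norm_real, norm_mul, Real.rpow_natCast, norm_pow, one_mul]

lemma integral_cexp_sq (τ : ℝ) :
    ∫ u : ℝ, Complex.exp (Complex.I * τ * u) * Complex.exp (-1 * (u : ℂ) ^ 2) =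
      Real.sqrt Real.pi * Complex.exp (-(τ : ℂ) ^ 2 / 4) := by
  rw [fourierIntegral_gaussian (b := 1) (by simp) τ]
  rw [div_one, mul_one, Real.sqrt_eq_rpow, Complex.ofReal_cpow Real.pi_pos.le]
  norm_num

lemma hasDerivAt_cexp_sq (τ u : ℝ) :
    HasDerivAt (fun u : ℝ => Complex.exp (Complex.I * τ * u) * Complex.exp (-1 * (u : ℂ) ^ 2))
      ((Complex.I * τ - 2 * u) *
        (Complex.exp (Complex.I * τ * u) * Complex.exp (-1 * (u : ℂ) ^ 2))) u := by
  have h0 : HasDerivAt (fun u : ℝ => (u : ℂ)) 1 u := Complex.ofRealCLM.hasDerivAt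
  have h1 := (h0.const_mul (Complex.I * τ)).cexp
  have h2 := ((h0.pow 2).const_mul (-1 : ℂ)).cexp
  refine (h1.mul h2).congr_deriv ?_
  simp only [Pi.pow_apply]
  ring

/-- Integration by parts: the derivative `(iτ - 2u) e^{iτu - u²}` integrates to zero, which
expresses the first moment by the zeroth. -/
lemma integral_mul_cexp_sq (τ : ℝ) :
    ∫ u : ℝ, (u : ℂ) * (Complex.exp (Complex.I * τ * u) * Complex.exp (-1 * (u : ℂ) ^ 2)) =
      Complex.I * τ / 2 * (Real.sqrt Real.pi * Complex.exp (-(τ : ℂ) ^ 2 / 4)) := by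
  have i0 := integrable_pow_mul_cexp_sq 0 τ
  have i1 := integrable_pow_mul_cexp_sq 1 τ
  simp only [pow_zero, one_mul, pow_one] at i0 i1
  have key := integral_eq_zero_of_hasDerivAt_of_integrable (hasDerivAt_cexp_sq τ)
    (by
      refine ((i0.const_mul (Complex.I * τ)).sub (i1.const_mul 2)).congr (ae_of_all _ fun u => ?_)
      simp only [Pi.sub_apply]; ring) i0
  have e : ∀ u : ℝ, (Complex.I * τ - 2 * u) *
        (Complex.exp (Complex.I * τ * u) * Complex.exp (-1 * (u : ℂ) ^ 2)) =
      Complex.I * τ * (Complex.exp (Complex.I * τ * u) * Complex.exp (-1 * (u : ℂ) ^ 2)) -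
      2 * (u * (Complex.exp (Complex.I * τ * u) * Complex.exp (-1 * (u : ℂ) ^ 2))) := by
    intro u; ring
  simp_rw [e] at key
  rw [integral_sub (i0.const_mul _) (i1.const_mul _), integral_const_mul, integral_const_mul,
    integral_cexp_sq] at key
  linear_combination (-1 / 2 : ℂ) * key

/-- The same argument with the primitive `u e^{iτu - u²}`. -/
lemma integral_sq_mul_cexp_sq (τ : ℝ) :
    ∫ u : ℝ, (u : ℂ) ^ 2 *
        (Complex.exp (Complex.I * τ * u) * Complex.exp (-1 * (u : ℂ) ^ 2)) =
      (1 / 2 - (τ : ℂ) ^ 2 / 4) * (Real.sqrt Real.pi * Complex.exp (-(τ : ℂ) ^ 2 / 4)) := by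
  have i0 := integrable_pow_mul_cexp_sq 0 τ
  have i1 := integrable_pow_mul_cexp_sq 1 τ
  have i2 := integrable_pow_mul_cexp_sq 2 τ
  simp only [pow_zero, one_mul, pow_one] at i0 i1
  have h0 : ∀ u : ℝ, HasDerivAt (fun u : ℝ => (u : ℂ)) 1 u := fun u =>
    Complex.ofRealCLM.hasDerivAt
  have key := integral_eq_zero_of_hasDerivAt_of_integrable
    (fun u => (h0 u).mul (hasDerivAt_cexp_sq τ u))
    (by
      refine ((i0.add (i1.const_mul (Complex.I * τ))).sub (i2.const_mul 2)).congr
        (ae_of_all _ fun u => ?_)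
      simp only [Pi.sub_apply, Pi.add_apply]; ring) i1
  have e : ∀ u : ℝ, 1 * (Complex.exp (Complex.I * τ * u) * Complex.exp (-1 * (u : ℂ) ^ 2)) +
      (u : ℂ) * ((Complex.I * τ - 2 * u) *
        (Complex.exp (Complex.I * τ * u) * Complex.exp (-1 * (u : ℂ) ^ 2))) =
      (Complex.exp (Complex.I * τ * u) * Complex.exp (-1 * (u : ℂ) ^ 2)) +
      Complex.I * τ * (u * (Complex.exp (Complex.I * τ * u) * Complex.exp (-1 * (u : ℂ) ^ 2))) -
      2 * (u ^ 2 * (Complex.exp (Complex.I * τ * u) * Complex.exp (-1 * (u : ℂ) ^ 2))) := by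
    intro u; ring
  simp_rw [e] at key
  rw [integral_sub (by exact i0.add (i1.const_mul (Complex.I * τ))) (i2.const_mul _),
    integral_add i0 (i1.const_mul _), integral_const_mul, integral_const_mul, integral_cexp_sq,
    integral_mul_cexp_sq] at key
  have hI := Complex.I_sq
  linear_combination (-1 / 2 : ℂ) * key + (τ : ℂ) ^ 2 / 4 *
    (Real.sqrt Real.pi * Complex.exp (-(τ : ℂ) ^ 2 / 4)) * hI

/-! ### Inner products of the window and its first moment. -/

/-- The test function `s ↦ (s - t) h_{t,η}(s)` for the Gaussian window. -/
noncomputable def windowMoment (t η : ℝ) : 𝓢(ℝ, ℂ) :=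
  -(tfShift (SchwartzMap.derivCLM ℂ ℂ gaussWindow) t η)

lemma deriv_gaussWindow (u : ℝ) : deriv gaussWindow u = -(u : ℂ) * gaussWindow u := by
  have e : (gaussWindow : ℝ → ℂ) = fun x : ℝ =>
      (((Real.sqrt (2 * Real.pi))⁻¹ * Real.exp (-(x ^ 2 / 2)) : ℝ) : ℂ) := by
    funext x; exact gaussWindow_apply x
  have h1 : HasDerivAt (fun x : ℝ => -(x ^ 2 / 2)) (-u) u := by
    refine (((hasDerivAt_id u).pow 2).div_const 2).neg.congr_deriv ?_
    simp
  have h2 := ((h1.exp).const_mul (Real.sqrt (2 * Real.pi))⁻¹).ofReal_comp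
  rw [e, h2.deriv]
  push_cast
  ring

lemma windowMoment_apply (t η s : ℝ) :
    windowMoment t η s = ((s - t : ℝ) : ℂ) * tfShift gaussWindow t η s := by
  have h : windowMoment t η s = -(tfShift (SchwartzMap.derivCLM ℂ ℂ gaussWindow) t η s) := rfl
  rw [h, tfShift_apply, tfShift_apply, SchwartzMap.derivCLM_apply, deriv_gaussWindow]
  ring

/-- Without conjugation the modulations add up to the frequency `-4πη`. This is the source of the
decay `exp(-4π²η²)` of all pseudocovariances. -/
lemma tfShift_mul_self (t η s : ℝ) :
    tfShift gaussWindow t η s * tfShift gaussWindow t η s = (2 * Real.pi : ℂ)⁻¹ *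
      (Complex.exp (Complex.I * ((-(4 * Real.pi * η) : ℝ) : ℂ) * ((s - t : ℝ) : ℂ)) *
        Complex.exp (-1 * ((s - t : ℝ) : ℂ) ^ 2)) := by
  rw [tfShift_apply, gaussWindow_apply]
  generalize s - t = u
  have h : ((Real.sqrt (2 * Real.pi))⁻¹ : ℂ) ^ 2 = (2 * Real.pi : ℂ)⁻¹ := by
    rw [← Complex.ofReal_inv, ← Complex.ofReal_pow, inv_pow, Real.sq_sqrt (by positivity)]
    push_cast; rfl
  have e : Complex.exp (Complex.I * ((-(4 * Real.pi * η) : ℝ) : ℂ) * (u : ℂ)) *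
        Complex.exp (-1 * (u : ℂ) ^ 2) =
      (Complex.exp (-((u : ℂ) ^ 2 / 2)) *
        Complex.exp (-(2 * Real.pi * Complex.I * η * (u : ℂ)))) ^ 2 := by
    rw [← Complex.exp_add, ← Complex.exp_add, ← Complex.exp_nat_mul]
    congr 1; push_cast; ring
  rw [e, ← h]
  push_cast
  ring

/-- With conjugation the modulation cancels and the case `η = 0` of the previous product remains, so
the covariances do not depend on `η`. -/
lemma tfShift_mul_conj (t η s : ℝ) :
    tfShift gaussWindow t η s * (starRingEnd ℂ) (tfShift gaussWindow t η s) =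
      (2 * Real.pi : ℂ)⁻¹ *
      (Complex.exp (Complex.I * ((0 : ℝ) : ℂ) * ((s - t : ℝ) : ℂ)) *
        Complex.exp (-1 * ((s - t : ℝ) : ℂ) ^ 2)) := by
  have h0 := tfShift_mul_self t 0 s
  simp only [mul_zero, neg_zero] at h0
  rw [← h0, tfShift_apply, tfShift_apply, map_mul, ← Complex.exp_conj]
  have hc : (starRingEnd ℂ) (gaussWindow (s - t)) = gaussWindow (s - t) := by
    rw [gaussWindow_apply, Complex.conj_ofReal]
  rw [hc]
  have e : Complex.exp (-(2 * Real.pi * Complex.I * η * ((s - t : ℝ) : ℂ))) *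
      Complex.exp ((starRingEnd ℂ) (-(2 * Real.pi * Complex.I * η * ((s - t : ℝ) : ℂ)))) = 1 := by
    rw [← Complex.exp_add]
    simp [Complex.conj_ofNat]
  simp only [Complex.ofReal_zero, mul_zero, zero_mul, neg_zero, Complex.exp_zero, mul_one]
  linear_combination (gaussWindow (s - t)) ^ 2 * e

/-- The squared `L²` norm of the Gaussian window. -/
noncomputable def windowEnergy : ℝ := (2 * Real.sqrt Real.pi)⁻¹

lemma windowEnergy_pos : 0 < windowEnergy := by
  unfold windowEnergy
  have := Real.sqrt_pos.2 Real.pi_pos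
  positivity

lemma windowEnergy_eq : ((2 * Real.pi : ℂ)⁻¹) * (Real.sqrt Real.pi : ℂ) = (windowEnergy : ℂ) := by
  have h : Real.sqrt Real.pi ≠ 0 := (Real.sqrt_pos.2 Real.pi_pos).ne'
  have h2 : (2 * Real.pi)⁻¹ * Real.sqrt Real.pi = windowEnergy := by
    unfold windowEnergy
    have h3 := Real.sq_sqrt Real.pi_pos.le
    have hp := Real.pi_pos.ne'
    field_simp
    linarith
  rw [← h2]; push_cast; ring

lemma integral_tfShift_mul_self (t η : ℝ) :
    ∫ s, tfShift gaussWindow t η s * tfShift gaussWindow t η s =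
      ((windowEnergy * Real.exp (-(4 * Real.pi ^ 2 * η ^ 2)) : ℝ) : ℂ) := by
  simp_rw [tfShift_mul_self]
  rw [integral_sub_right_eq_self (fun u : ℝ => (2 * Real.pi : ℂ)⁻¹ *
      (Complex.exp (Complex.I * ((-(4 * Real.pi * η) : ℝ) : ℂ) * (u : ℂ)) *
        Complex.exp (-1 * (u : ℂ) ^ 2))) t, integral_const_mul, integral_cexp_sq, ← mul_assoc,
      windowEnergy_eq]
  push_cast
  ring_nf

lemma integral_tfShift_mul_windowMoment (t η : ℝ) :
    ∫ s, tfShift gaussWindow t η s * windowMoment t η s =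
      ((-(2 * Real.pi * η * windowEnergy * Real.exp (-(4 * Real.pi ^ 2 * η ^ 2))) : ℝ) : ℂ) *
        Complex.I := by
  have e : ∀ s, tfShift gaussWindow t η s * windowMoment t η s = (2 * Real.pi : ℂ)⁻¹ *
      (((s - t : ℝ) : ℂ) *
        (Complex.exp (Complex.I * ((-(4 * Real.pi * η) : ℝ) : ℂ) * ((s - t : ℝ) : ℂ)) *
        Complex.exp (-1 * ((s - t : ℝ) : ℂ) ^ 2))) := by
    intro s
    rw [windowMoment_apply]
    linear_combination ((s - t : ℝ) : ℂ) * tfShift_mul_self t η s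
  simp_rw [e]
  rw [integral_sub_right_eq_self (fun u : ℝ => (2 * Real.pi : ℂ)⁻¹ * ((u : ℂ) *
      (Complex.exp (Complex.I * ((-(4 * Real.pi * η) : ℝ) : ℂ) * (u : ℂ)) *
        Complex.exp (-1 * (u : ℂ) ^ 2)))) t, integral_const_mul, integral_mul_cexp_sq]
  have e2 : (-((-(4 * Real.pi * η) : ℝ) : ℂ) ^ 2 / 4) = ((-(4 * Real.pi ^ 2 * η ^ 2) : ℝ) : ℂ) := by
    push_cast; ring
  rw [e2]
  have := windowEnergy_eq
  push_cast
  linear_combination (Complex.I * (-(4 * Real.pi * η)) / 2 *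
    Complex.exp (-(4 * Real.pi ^ 2 * η ^ 2))) * this

lemma integral_windowMoment_mul_self (t η : ℝ) :
    ∫ s, windowMoment t η s * windowMoment t η s =
      ((windowEnergy * (1 / 2 - 4 * Real.pi ^ 2 * η ^ 2) *
        Real.exp (-(4 * Real.pi ^ 2 * η ^ 2)) : ℝ) : ℂ) := by
  have e : ∀ s, windowMoment t η s * windowMoment t η s = (2 * Real.pi : ℂ)⁻¹ *
      (((s - t : ℝ) : ℂ) ^ 2 *
        (Complex.exp (Complex.I * ((-(4 * Real.pi * η) : ℝ) : ℂ) * ((s - t : ℝ) : ℂ)) *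
        Complex.exp (-1 * ((s - t : ℝ) : ℂ) ^ 2))) := by
    intro s
    rw [windowMoment_apply]
    linear_combination ((s - t : ℝ) : ℂ) ^ 2 * tfShift_mul_self t η s
  simp_rw [e]
  rw [integral_sub_right_eq_self (fun u : ℝ => (2 * Real.pi : ℂ)⁻¹ * ((u : ℂ) ^ 2 *
      (Complex.exp (Complex.I * ((-(4 * Real.pi * η) : ℝ) : ℂ) * (u : ℂ)) *
        Complex.exp (-1 * (u : ℂ) ^ 2)))) t, integral_const_mul, integral_sq_mul_cexp_sq]
  have e2 : (-((-(4 * Real.pi * η) : ℝ) : ℂ) ^ 2 / 4) = ((-(4 * Real.pi ^ 2 * η ^ 2) : ℝ) : ℂ) := by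
    push_cast; ring
  rw [e2]
  have := windowEnergy_eq
  push_cast
  linear_combination ((1 / 2 - 4 * Real.pi ^ 2 * η ^ 2) *
    Complex.exp (-(4 * Real.pi ^ 2 * η ^ 2))) * this

lemma integral_tfShift_mul_conj (t η : ℝ) :
    ∫ s, tfShift gaussWindow t η s * (starRingEnd ℂ) (tfShift gaussWindow t η s) =
      (windowEnergy : ℂ) := by
  simp_rw [tfShift_mul_conj]
  rw [integral_sub_right_eq_self (fun u : ℝ => (2 * Real.pi : ℂ)⁻¹ *
      (Complex.exp (Complex.I * ((0 : ℝ) : ℂ) * (u : ℂ)) *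
        Complex.exp (-1 * (u : ℂ) ^ 2))) t, integral_const_mul, integral_cexp_sq, ← mul_assoc,
      windowEnergy_eq]
  simp

lemma integral_tfShift_mul_conj_windowMoment (t η : ℝ) :
    ∫ s, tfShift gaussWindow t η s * (starRingEnd ℂ) (windowMoment t η s) = 0 := by
  have e : ∀ s, tfShift gaussWindow t η s * (starRingEnd ℂ) (windowMoment t η s) =
      (2 * Real.pi : ℂ)⁻¹ * (((s - t : ℝ) : ℂ) *
        (Complex.exp (Complex.I * ((0 : ℝ) : ℂ) * ((s - t : ℝ) : ℂ)) *
        Complex.exp (-1 * ((s - t : ℝ) : ℂ) ^ 2))) := by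
    intro s
    rw [windowMoment_apply, map_mul, Complex.conj_ofReal]
    linear_combination ((s - t : ℝ) : ℂ) * tfShift_mul_conj t η s
  simp_rw [e]
  rw [integral_sub_right_eq_self (fun u : ℝ => (2 * Real.pi : ℂ)⁻¹ * ((u : ℂ) *
      (Complex.exp (Complex.I * ((0 : ℝ) : ℂ) * (u : ℂ)) *
        Complex.exp (-1 * (u : ℂ) ^ 2)))) t, integral_const_mul, integral_mul_cexp_sq]
  simp

lemma integral_windowMoment_mul_conj (t η : ℝ) :
    ∫ s, windowMoment t η s * (starRingEnd ℂ) (windowMoment t η s) =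
      ((windowEnergy / 2 : ℝ) : ℂ) := by
  have e : ∀ s, windowMoment t η s * (starRingEnd ℂ) (windowMoment t η s) =
      (2 * Real.pi : ℂ)⁻¹ * (((s - t : ℝ) : ℂ) ^ 2 *
        (Complex.exp (Complex.I * ((0 : ℝ) : ℂ) * ((s - t : ℝ) : ℂ)) *
        Complex.exp (-1 * ((s - t : ℝ) : ℂ) ^ 2))) := by
    intro s
    rw [windowMoment_apply, map_mul, Complex.conj_ofReal]
    linear_combination ((s - t : ℝ) : ℂ) ^ 2 * tfShift_mul_conj t η s
  simp_rw [e]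
  rw [integral_sub_right_eq_self (fun u : ℝ => (2 * Real.pi : ℂ)⁻¹ * ((u : ℂ) ^ 2 *
      (Complex.exp (Complex.I * ((0 : ℝ) : ℂ) * (u : ℂ)) *
        Complex.exp (-1 * (u : ℂ) ^ 2)))) t, integral_const_mul, integral_sq_mul_cexp_sq]
  have := windowEnergy_eq
  simp
  linear_combination this / 2

/-! ### The short-time Fourier transform of the signal. -/

/-- The value at `(t, η)` of the short-time Fourier transform of the harmonic signal. -/
noncomputable def signalValue (A ξ₀ t η : ℝ) : ℂ :=
  (A * Real.exp (-(2 * Real.pi ^ 2 * (η - ξ₀) ^ 2)) : ℝ) *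
    Complex.exp (2 * Real.pi * Complex.I * ξ₀ * t)

lemma norm_signalValue {A : ℝ} (hA : 0 ≤ A) (ξ₀ t η : ℝ) :
    ‖signalValue A ξ₀ t η‖ = A * Real.exp (-(2 * Real.pi ^ 2 * (η - ξ₀) ^ 2)) := by
  have e : (2 * Real.pi * Complex.I * ξ₀ * t : ℂ) =
      ((2 * Real.pi * ξ₀ * t : ℝ) : ℂ) * Complex.I := by
    push_cast; ring
  rw [signalValue, e, norm_mul, Complex.norm_exp_ofReal_mul_I, Complex.norm_real, mul_one,
    Real.norm_eq_abs, abs_of_nonneg (by positivity)]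

/-- After translation by `t` this is the Fourier transform of a Gaussian at `ξ₀ - η`. The time `t`
survives only in a phase, so `∂_t` acts as multiplication by `2πiξ₀` and all estimates through
`‖signalValue‖` are uniform in `t`. -/
lemma signalSTFT_eq (A ξ₀ t η : ℝ) :
    signalSTFT (signal A ξ₀) gaussWindow t η = signalValue A ξ₀ t η := by
  have e : ∀ s : ℝ, signal A ξ₀ s * tfShift gaussWindow t η s =
      (A * ((Real.sqrt (2 * Real.pi))⁻¹ : ℝ) *
        Complex.exp (2 * Real.pi * Complex.I * ξ₀ * t)) *
      (Complex.exp (Complex.I * ((2 * Real.pi * (ξ₀ - η) : ℝ) : ℂ) * ((s - t : ℝ) : ℂ)) *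
        Complex.exp (-(1 / 2) * ((s - t : ℝ) : ℂ) ^ 2)) := by
    intro s
    rw [signal, tfShift_apply, gaussWindow_apply]
    have e1 : Complex.exp (2 * Real.pi * Complex.I * ξ₀ * s) = 
        Complex.exp (2 * Real.pi * Complex.I * ξ₀ * t) *
        Complex.exp (2 * Real.pi * Complex.I * ξ₀ * ((s - t : ℝ) : ℂ)) := by
      rw [← Complex.exp_add]; congr 1; push_cast; ring
    have e2 : Complex.exp (Complex.I * ((2 * Real.pi * (ξ₀ - η) : ℝ) : ℂ) * ((s - t : ℝ) : ℂ)) =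
        Complex.exp (2 * Real.pi * Complex.I * ξ₀ * ((s - t : ℝ) : ℂ)) *
        Complex.exp (-(2 * Real.pi * Complex.I * η * ((s - t : ℝ) : ℂ))) := by
      rw [← Complex.exp_add]; congr 1; push_cast; ring
    have e3 : Complex.exp (-(1 / 2) * ((s - t : ℝ) : ℂ) ^ 2) =
        ((Real.exp (-((s - t) ^ 2 / 2)) : ℝ) : ℂ) := by
      push_cast; congr 1; ring
    rw [e1, e2, e3]
    push_cast
    ring
  rw [signalSTFT]
  simp_rw [e]
  rw [integral_sub_right_eq_self (fun u : ℝ => (A * ((Real.sqrt (2 * Real.pi))⁻¹ : ℝ) *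
        Complex.exp (2 * Real.pi * Complex.I * ξ₀ * t)) *
      (Complex.exp (Complex.I * ((2 * Real.pi * (ξ₀ - η) : ℝ) : ℂ) * (u : ℂ)) *
        Complex.exp (-(1 / 2) * (u : ℂ) ^ 2))) t, integral_const_mul,
      fourierIntegral_gaussian (b := 1 / 2) (by norm_num)]
  have h1 : ((Real.pi : ℂ) / (1 / 2)) ^ (1 / 2 : ℂ) = (Real.sqrt (2 * Real.pi) : ℂ) := by
    rw [Real.sqrt_eq_rpow, Complex.ofReal_cpow (by positivity)]
    push_cast
    congr 1
    ring
  have h2 : ((Real.sqrt (2 * Real.pi))⁻¹ : ℂ) * (Real.sqrt (2 * Real.pi) : ℂ) = 1 := by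
    refine inv_mul_cancel₀ ?_
    exact_mod_cast (Real.sqrt_pos.2 (by positivity)).ne'
  rw [h1, signalValue]
  have h3 : -((2 * Real.pi * (ξ₀ - η) : ℝ) : ℂ) ^ 2 / (4 * (1 / 2)) =
      ((-(2 * Real.pi ^ 2 * (η - ξ₀) ^ 2) : ℝ) : ℂ) := by push_cast; ring
  rw [h3]
  push_cast
  linear_combination (A * Complex.exp (2 * Real.pi * Complex.I * ξ₀ * t) *
    Complex.exp (-(2 * Real.pi ^ 2 * (η - ξ₀) ^ 2))) * h2

lemma deriv_signalSTFT (A ξ₀ t η : ℝ) :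
    deriv (fun τ => signalSTFT (signal A ξ₀) gaussWindow τ η) t =
      2 * Real.pi * Complex.I * ξ₀ * signalValue A ξ₀ t η := by
  simp_rw [signalSTFT_eq, signalValue]
  have h0 : HasDerivAt (fun u : ℝ => (u : ℂ)) 1 t := Complex.ofRealCLM.hasDerivAt
  have h1 := ((h0.const_mul (2 * Real.pi * Complex.I * ξ₀)).cexp).const_mul
    (((A * Real.exp (-(2 * Real.pi ^ 2 * (η - ξ₀) ^ 2)) : ℝ)) : ℂ)
  rw [h1.deriv]
  ring

/-! ### Independence structure of the noise pair. -/

section Law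

variable {Ω : Type*} [MeasurableSpace Ω] {P : Measure Ω}

lemma covariance_lin_lin [IsProbabilityMeasure P] {a b c d : Ω → ℝ} (ha : MemLp a 2 P)
    (hb : MemLp b 2 P) (hc : MemLp c 2 P) (hd : MemLp d 2 P) (p q r s : ℝ) :
    cov[fun ω => p * a ω + q * b ω, fun ω => r * c ω + s * d ω; P] =
      p * r * cov[a, c; P] + p * s * cov[a, d; P] + q * r * cov[b, c; P] +
        q * s * cov[b, d; P] := by
  have e1 : (fun ω => p * a ω + q * b ω) = (fun ω => p * a ω) + fun ω => q * b ω := rfl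
  have e2 : (fun ω => r * c ω + s * d ω) = (fun ω => r * c ω) + fun ω => s * d ω := rfl
  rw [e1, e2, covariance_add_left (ha.const_mul p) (hb.const_mul q)
    ((hc.const_mul r).add (hd.const_mul s)),
    covariance_add_right (ha.const_mul p) (hc.const_mul r) (hd.const_mul s),
    covariance_add_right (hb.const_mul q) (hc.const_mul r) (hd.const_mul s)]
  simp only [covariance_const_mul_left, covariance_const_mul_right]
  ring

/-- Four jointly Gaussian, centred and uncorrelated real random variables have a product law. -/
lemma map_eq_prod_of_uncorrelated [IsProbabilityMeasure P] {X : Fin 4 → Ω → ℝ}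
    (hX : HasGaussianLaw (fun ω => (X · ω)) P) (h0 : ∀ i, ∫ ω, X i ω ∂P = 0)
    (hc : ∀ i j, i ≠ j → cov[X i, X j; P] = 0) :
    P.map (fun ω => ((X 0 ω, X 1 ω), (X 2 ω, X 3 ω))) =
      ((gaussianReal 0 (cov[X 0, X 0; P]).toNNReal).prod
        (gaussianReal 0 (cov[X 1, X 1; P]).toNNReal)).prod
      ((gaussianReal 0 (cov[X 2, X 2; P]).toNNReal).prod
        (gaussianReal 0 (cov[X 3, X 3; P]).toNNReal)) := by
  have hi := hX.iIndepFun_of_covariance_eq_zero hc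
  have hm : ∀ i, AEMeasurable (X i) P := fun i => (hX.eval i).aemeasurable
  have hl : ∀ i, P.map (X i) = gaussianReal 0 (cov[X i, X i; P]).toNNReal := by
    intro i
    rw [(hX.eval i).map_eq_gaussianReal, h0 i, covariance_self (hm i)]
  have h1 := (hi.indepFun_prodMk_prodMk₀ hm 0 1 2 3 (by decide) (by decide) (by decide)
    (by decide)).map_prod_eq_prod_map_map ((hm 0).prodMk (hm 1)) ((hm 2).prodMk (hm 3))
  have h2 := (hi.indepFun (i := 0) (j := 1) (by decide)).map_prod_eq_prod_map_map (hm 0) (hm 1)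
  have h3 := (hi.indepFun (i := 2) (j := 3) (by decide)).map_prod_eq_prod_map_map (hm 2) (hm 3)
  rw [h1, h2, h3, hl, hl, hl, hl]

section RealParts

variable {X W : Ω → ℂ}

lemma memLp_re_two (hX : MemLp X 2 P) : MemLp (fun ω => (X ω).re) 2 P := hX.re

lemma memLp_im_two (hX : MemLp X 2 P) : MemLp (fun ω => (X ω).im) 2 P := hX.im

lemma integral_re_eq_zero [IsProbabilityMeasure P] (hX : MemLp X 2 P)
    (hX0 : ∫ ω, X ω ∂P = 0) :
    ∫ ω, (X ω).re ∂P = 0 := by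
  have h := integral_re (hX.integrable one_le_two)
  simp only [RCLike.re_eq_complex_re] at h
  rw [h, hX0, Complex.zero_re]

lemma integral_im_eq_zero [IsProbabilityMeasure P] (hX : MemLp X 2 P)
    (hX0 : ∫ ω, X ω ∂P = 0) :
    ∫ ω, (X ω).im ∂P = 0 := by
  have h := integral_im (hX.integrable one_le_two)
  simp only [RCLike.im_eq_complex_im] at h
  rw [h, hX0, Complex.zero_im]

lemma integrable_mul_of_memLp_two (hX : MemLp X 2 P) (hW : MemLp W 2 P) :
    Integrable (fun ω => X ω * W ω) P := hX.integrable_mul hW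

lemma integrable_mul_conj_of_memLp_two (hX : MemLp X 2 P) (hW : MemLp W 2 P) :
    Integrable (fun ω => X ω * (starRingEnd ℂ) (W ω)) P := hX.integrable_mul hW.star

/-- Polarisation: `re x · re w = re (x w̄ + x w) / 2`, and similarly for the other three products
below, so covariance and pseudocovariance together determine all real covariances. Centring one of
the two variables is enough. -/
lemma covariance_re_re [IsProbabilityMeasure P] (hX : MemLp X 2 P)
    (hW : MemLp W 2 P) (hX0 : ∫ ω, X ω ∂P = 0) :
    cov[fun ω => (X ω).re, fun ω => (W ω).re; P] =
    ((∫ ω, X ω * (starRingEnd ℂ) (W ω) ∂P) + ∫ ω, X ω * W ω ∂P).re / 2 := by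
  have i1 := integrable_mul_conj_of_memLp_two hX hW
  have i2 := integrable_mul_of_memLp_two hX hW
  rw [covariance_eq_sub (memLp_re_two hX) (memLp_re_two hW), integral_re_eq_zero hX hX0, zero_mul,
    sub_zero, ← integral_add i1 i2]
  have h := integral_re (i1.add i2)
  simp only [RCLike.re_eq_complex_re, Pi.add_apply] at h
  rw [← h, ← integral_div]
  congr 1; funext ω
  simp [Complex.mul_re]

lemma covariance_im_im [IsProbabilityMeasure P] (hX : MemLp X 2 P)
    (hW : MemLp W 2 P) (hX0 : ∫ ω, X ω ∂P = 0) :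
    cov[fun ω => (X ω).im, fun ω => (W ω).im; P] =
    ((∫ ω, X ω * (starRingEnd ℂ) (W ω) ∂P) - ∫ ω, X ω * W ω ∂P).re / 2 := by
  have i1 := integrable_mul_conj_of_memLp_two hX hW
  have i2 := integrable_mul_of_memLp_two hX hW
  rw [covariance_eq_sub (memLp_im_two hX) (memLp_im_two hW), integral_im_eq_zero hX hX0, zero_mul,
    sub_zero, ← integral_sub i1 i2]
  have h := integral_re (i1.sub i2)
  simp only [RCLike.re_eq_complex_re, Pi.sub_apply] at h
  rw [← h, ← integral_div]
  congr 1; funext ω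
  simp [Complex.mul_re]

lemma covariance_im_re [IsProbabilityMeasure P] (hX : MemLp X 2 P)
    (hW : MemLp W 2 P) (hX0 : ∫ ω, X ω ∂P = 0) :
    cov[fun ω => (X ω).im, fun ω => (W ω).re; P] =
    ((∫ ω, X ω * (starRingEnd ℂ) (W ω) ∂P) + ∫ ω, X ω * W ω ∂P).im / 2 := by
  have i1 := integrable_mul_conj_of_memLp_two hX hW
  have i2 := integrable_mul_of_memLp_two hX hW
  rw [covariance_eq_sub (memLp_im_two hX) (memLp_re_two hW), integral_im_eq_zero hX hX0, zero_mul,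
    sub_zero, ← integral_add i1 i2]
  have h := integral_im (i1.add i2)
  simp only [RCLike.im_eq_complex_im, Pi.add_apply] at h
  rw [← h, ← integral_div]
  congr 1; funext ω
  simp [Complex.mul_im]
  ring

lemma covariance_re_im [IsProbabilityMeasure P] (hX : MemLp X 2 P)
    (hW : MemLp W 2 P) (hX0 : ∫ ω, X ω ∂P = 0) :
    cov[fun ω => (X ω).re, fun ω => (W ω).im; P] =
    ((∫ ω, X ω * W ω ∂P) - ∫ ω, X ω * (starRingEnd ℂ) (W ω) ∂P).im / 2 := by
  have i1 := integrable_mul_conj_of_memLp_two hX hW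
  have i2 := integrable_mul_of_memLp_two hX hW
  rw [covariance_eq_sub (memLp_re_two hX) (memLp_im_two hW), integral_re_eq_zero hX hX0, zero_mul,
    sub_zero, ← integral_sub i2 i1]
  have h := integral_im (i2.sub i1)
  simp only [RCLike.im_eq_complex_im, Pi.sub_apply] at h
  rw [← h, ← integral_div]
  congr 1; funext ω
  simp [Complex.mul_im]

end RealParts

/-- The decay factor `exp (-4π²η²)` of the pseudocovariance. -/
noncomputable def pseudoDecay (η : ℝ) : ℝ := Real.exp (-(4 * Real.pi ^ 2 * η ^ 2))

/-- The covariance form of the pair `(Re Φ(h_{t,η}), Im Φ((· - t) h_{t,η}))`. -/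
noncomputable def evenForm (η p q r s : ℝ) : ℝ :=
  p * r * (windowEnergy * (1 + pseudoDecay η) / 2) -
    (p * s + q * r) * (Real.pi * η * windowEnergy * pseudoDecay η) +
    q * s * (windowEnergy / 2 * (1 / 2 - (1 / 2 - 4 * Real.pi ^ 2 * η ^ 2) * pseudoDecay η))

/-- The covariance form of the pair `(Im Φ(h_{t,η}), Re Φ((· - t) h_{t,η}))`. -/
noncomputable def oddForm (η p q r s : ℝ) : ℝ :=
  p * r * (windowEnergy * (1 - pseudoDecay η) / 2) -
    (p * s + q * r) * (Real.pi * η * windowEnergy * pseudoDecay η) +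
    q * s * (windowEnergy / 2 * (1 / 2 + (1 / 2 - 4 * Real.pi ^ 2 * η ^ 2) * pseudoDecay η))

variable {Φ : 𝓢(ℝ, ℂ) → Ω → ℂ}

lemma IsWhiteNoise.memLp (hΦ : IsWhiteNoise P Φ) (φ : 𝓢(ℝ, ℂ)) {p : ENNReal} (hp : p ≠ ⊤) :
    MemLp (Φ φ) p P := (hΦ.gaussian.hasGaussianLaw_eval φ).memLp hp

/-- The covariances of `z`, `m` and the pseudocovariances of each with itself are real, while `E[z
m]` is purely imaginary; hence `(re z, im m)` is uncorrelated with `(im z, re m)`. Within each pair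
the hypotheses ask for uncorrelated combinations, and jointly Gaussian uncorrelated variables are
independent. This serves twice: to regress `m` on `z` for the density, and to regress `z` on the
reassignment numerator for small `η`. -/
lemma IsWhiteNoise.map_linear_combinations [IsProbabilityMeasure P] (hΦ : IsWhiteNoise P Φ)
    (t η p q r s p' q' r' s' : ℝ) (h1 : evenForm η p q p' q' = 0) (h2 : oddForm η r s r' s' = 0) :
    P.map (fun ω =>
      ((p * (Φ (tfShift gaussWindow t η) ω).re + q * (Φ (windowMoment t η) ω).im,
        r * (Φ (tfShift gaussWindow t η) ω).im + s * (Φ (windowMoment t η) ω).re),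
       (p' * (Φ (tfShift gaussWindow t η) ω).re + q' * (Φ (windowMoment t η) ω).im,
        r' * (Φ (tfShift gaussWindow t η) ω).im + s' * (Φ (windowMoment t η) ω).re))) =
      ((gaussianReal 0 (evenForm η p q p q).toNNReal).prod
        (gaussianReal 0 (oddForm η r s r s).toNNReal)).prod
      ((gaussianReal 0 (evenForm η p' q' p' q').toNNReal).prod
        (gaussianReal 0 (oddForm η r' s' r' s').toNNReal)) := by
  set Z := Φ (tfShift gaussWindow t η) with hZ
  set M := Φ (windowMoment t η) with hM
  have hG : HasGaussianLaw (fun ω => (Z ω, M ω)) P := hΦ.gaussian.hasGaussianLaw_prodMk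
  have mZ : MemLp Z 2 P := hΦ.memLp _ (by simp)
  have mM : MemLp M 2 P := hΦ.memLp _ (by simp)
  have Z0 : ∫ ω, Z ω ∂P = 0 := hΦ.mean _
  have M0 : ∫ ω, M ω ∂P = 0 := hΦ.mean _
  have zz : ∫ ω, Z ω * Z ω ∂P = ((windowEnergy * pseudoDecay η : ℝ) : ℂ) := by
    rw [hΦ.pseudocovariance, integral_tfShift_mul_self]; rfl
  have zm : ∫ ω, Z ω * M ω ∂P =
      ((-(2 * Real.pi * η * windowEnergy * pseudoDecay η) : ℝ) : ℂ) * Complex.I := by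
    rw [hΦ.pseudocovariance, integral_tfShift_mul_windowMoment]; rfl
  have mm : ∫ ω, M ω * M ω ∂P = ((windowEnergy * (1 / 2 - 4 * Real.pi ^ 2 * η ^ 2) *
      pseudoDecay η : ℝ) : ℂ) := by
    rw [hΦ.pseudocovariance, integral_windowMoment_mul_self]; rfl
  have zz' : ∫ ω, Z ω * (starRingEnd ℂ) (Z ω) ∂P = (windowEnergy : ℂ) := by
    rw [hΦ.covariance, integral_tfShift_mul_conj]
  have zm' : ∫ ω, Z ω * (starRingEnd ℂ) (M ω) ∂P = 0 := by
    rw [hΦ.covariance, integral_tfShift_mul_conj_windowMoment]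
  have mm' : ∫ ω, M ω * (starRingEnd ℂ) (M ω) ∂P = ((windowEnergy / 2 : ℝ) : ℂ) := by
    rw [hΦ.covariance, integral_windowMoment_mul_conj]
  have c1 : cov[fun ω => (Z ω).re, fun ω => (Z ω).re; P] =
      windowEnergy * (1 + pseudoDecay η) / 2 := by
    rw [covariance_re_re mZ mZ Z0, zz, zz', ← Complex.ofReal_add, Complex.ofReal_re]; ring
  have c2 : cov[fun ω => (Z ω).im, fun ω => (Z ω).im; P] =
      windowEnergy * (1 - pseudoDecay η) / 2 := by
    rw [covariance_im_im mZ mZ Z0, zz, zz', ← Complex.ofReal_sub, Complex.ofReal_re]; ring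
  have c3 : cov[fun ω => (Z ω).re, fun ω => (Z ω).im; P] = 0 := by
    rw [covariance_re_im mZ mZ Z0, zz, zz', ← Complex.ofReal_sub, Complex.ofReal_im, zero_div]
  have c4 : cov[fun ω => (M ω).re, fun ω => (M ω).re; P] =
      windowEnergy / 2 * (1 / 2 + (1 / 2 - 4 * Real.pi ^ 2 * η ^ 2) * pseudoDecay η) := by
    rw [covariance_re_re mM mM M0, mm, mm', ← Complex.ofReal_add, Complex.ofReal_re]; ring
  have c5 : cov[fun ω => (M ω).im, fun ω => (M ω).im; P] =
      windowEnergy / 2 * (1 / 2 - (1 / 2 - 4 * Real.pi ^ 2 * η ^ 2) * pseudoDecay η) := by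
    rw [covariance_im_im mM mM M0, mm, mm', ← Complex.ofReal_sub, Complex.ofReal_re]; ring
  have c6 : cov[fun ω => (M ω).im, fun ω => (M ω).re; P] = 0 := by
    rw [covariance_im_re mM mM M0, mm, mm', ← Complex.ofReal_add, Complex.ofReal_im, zero_div]
  have c7 : cov[fun ω => (Z ω).re, fun ω => (M ω).re; P] = 0 := by
    rw [covariance_re_re mZ mM Z0, zm, zm', zero_add, Complex.re_ofReal_mul, Complex.I_re,
      mul_zero, zero_div]
  have c8 : cov[fun ω => (M ω).im, fun ω => (Z ω).im; P] = 0 := by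
    rw [covariance_comm, covariance_im_im mZ mM Z0, zm, zm', zero_sub, Complex.neg_re,
      Complex.re_ofReal_mul, Complex.I_re, mul_zero, neg_zero, zero_div]
  have c9 : cov[fun ω => (Z ω).re, fun ω => (M ω).im; P] =
      -(Real.pi * η * windowEnergy * pseudoDecay η) := by
    rw [covariance_re_im mZ mM Z0, zm, zm', sub_zero, Complex.im_ofReal_mul, Complex.I_im]
    ring
  have c10 : cov[fun ω => (Z ω).im, fun ω => (M ω).re; P] =
      -(Real.pi * η * windowEnergy * pseudoDecay η) := by
    rw [covariance_im_re mZ mM Z0, zm, zm', zero_add, Complex.im_ofReal_mul, Complex.I_im]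
    ring
  have zr := memLp_re_two mZ
  have zi := memLp_im_two mZ
  have mr := memLp_re_two mM
  have mi := memLp_im_two mM
  have even : ∀ p q r s : ℝ, cov[fun ω => p * (Z ω).re + q * (M ω).im,
      fun ω => r * (Z ω).re + s * (M ω).im; P] = evenForm η p q r s := by
    intro p q r s
    rw [covariance_lin_lin zr mi zr mi, c1, c9, c5, covariance_comm, c9, evenForm]
    ring
  have odd : ∀ p q r s : ℝ, cov[fun ω => p * (Z ω).im + q * (M ω).re,
      fun ω => r * (Z ω).im + s * (M ω).re; P] = oddForm η p q r s := by
    intro p q r s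
    rw [covariance_lin_lin zi mr zi mr, c2, c10, c4, covariance_comm, c10, oddForm]
    ring
  have mixed : ∀ p q r s : ℝ, cov[fun ω => p * (Z ω).re + q * (M ω).im,
      fun ω => r * (Z ω).im + s * (M ω).re; P] = 0 := by
    intro p q r s
    rw [covariance_lin_lin zr mi zi mr, c3, c7, c8, c6]
    ring
  let X : Fin 4 → Ω → ℝ := ![fun ω => p * (Z ω).re + q * (M ω).im,
    fun ω => r * (Z ω).im + s * (M ω).re, fun ω => p' * (Z ω).re + q' * (M ω).im,
    fun ω => r' * (Z ω).im + s' * (M ω).re]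
  have hXG : HasGaussianLaw (fun ω => (X · ω)) P := by
    let L1 : ℝ → ℝ → (ℂ × ℂ →L[ℝ] ℝ) := fun p q =>
      p • (Complex.reCLM.comp (ContinuousLinearMap.fst ℝ ℂ ℂ)) +
        q • (Complex.imCLM.comp (ContinuousLinearMap.snd ℝ ℂ ℂ))
    let L2 : ℝ → ℝ → (ℂ × ℂ →L[ℝ] ℝ) := fun p q =>
      p • (Complex.imCLM.comp (ContinuousLinearMap.fst ℝ ℂ ℂ)) +
        q • (Complex.reCLM.comp (ContinuousLinearMap.snd ℝ ℂ ℂ))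
    have h := hG.map_fun (ContinuousLinearMap.pi ![L1 p q, L2 r s, L1 p' q', L2 r' s'])
    convert! h using 2 with ω
    funext i
    fin_cases i <;> rfl
  have X0 : ∀ i, ∫ ω, X i ω ∂P = 0 := by
    have j1 := integral_re_eq_zero mZ Z0
    have j2 := integral_im_eq_zero mZ Z0
    have j3 := integral_re_eq_zero mM M0
    have j4 := integral_im_eq_zero mM M0
    have aux : ∀ (a b : Ω → ℝ) (p q : ℝ), MemLp a 2 P → MemLp b 2 P → ∫ ω, a ω ∂P = 0 →
        ∫ ω, b ω ∂P = 0 → ∫ ω, (p * a ω + q * b ω) ∂P = 0 := by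
      intro a b p q ha hb ha0 hb0
      rw [integral_add ((ha.integrable one_le_two).const_mul p)
        ((hb.integrable one_le_two).const_mul q), integral_const_mul, integral_const_mul, ha0, hb0]
      ring
    intro i
    fin_cases i
    exacts [aux _ _ _ _ zr mi j1 j4, aux _ _ _ _ zi mr j2 j3, aux _ _ _ _ zr mi j1 j4,
      aux _ _ _ _ zi mr j2 j3]
  have Xc : ∀ i j, i ≠ j → cov[X i, X j; P] = 0 := by
    have sym : ∀ p q r s : ℝ, cov[fun ω => r * (Z ω).im + s * (M ω).re,
        fun ω => p * (Z ω).re + q * (M ω).im; P] = 0 := by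
      intro p q r s; rw [covariance_comm, mixed]
    have h1' : evenForm η p' q' p q = 0 := by
      rw [← h1, evenForm, evenForm]; ring
    have h2' : oddForm η r' s' r s = 0 := by
      rw [← h2, oddForm, oddForm]; ring
    intro i j hij
    -- Of the sixteen pairs, the diagonal is excluded, the pairs mixing the two groups vanish
    -- unconditionally, and the others are `h1`, `h2` or their transposes.
    fin_cases i <;> fin_cases j
    all_goals first
      | exact absurd rfl hij
      | exact mixed _ _ _ _
      | exact sym _ _ _ _
      | exact (even _ _ _ _).trans h1
      | exact (odd _ _ _ _).trans h2
      | exact (even _ _ _ _).trans h1'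
      | exact (odd _ _ _ _).trans h2'
  have key := map_eq_prod_of_uncorrelated hXG X0 Xc
  rw [← even, ← even, ← odd, ← odd]
  exact key

end Law

/-! ### The density of the noise pair on `ℂ × ℂ`. -/

/-- The density of the centred real Gaussian law with variance `v`. -/
noncomputable def gaussDensity (v x : ℝ) : ℝ :=
  (Real.sqrt (2 * Real.pi * v))⁻¹ * Real.exp (-(x ^ 2 / (2 * v)))

lemma gaussianPDF_eq_gaussDensity {v : ℝ} (hv : 0 ≤ v) (x : ℝ) :
    gaussianPDF 0 v.toNNReal x = ENNReal.ofReal (gaussDensity v x) := by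
  rw [gaussianPDF, gaussianPDFReal, gaussDensity, Real.coe_toNNReal v hv, sub_zero, neg_div]

lemma gaussDensity_nonneg (v x : ℝ) : 0 ≤ gaussDensity v x := by
  unfold gaussDensity; positivity

lemma gaussDensity_pos {v : ℝ} (hv : 0 < v) (x : ℝ) : 0 < gaussDensity v x := by
  unfold gaussDensity
  have := Real.sqrt_pos.2 (show 0 < 2 * Real.pi * v by positivity)
  positivity

@[fun_prop]
lemma continuous_gaussDensity (v : ℝ) : Continuous (gaussDensity v) := by
  unfold gaussDensity; fun_prop

/-- Parameters of a centred Gaussian law of `(z, m) ∈ ℂ²` for which `(re z, im m)` and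
`(im z, re m)` are independent: the variances of `re z` and `im z`, the regression coefficients of
`im m` on `re z` and of `re m` on `im z`, and the variances of the regression residuals. -/
structure NoiseParam where
  zre : ℝ
  zim : ℝ
  mim : ℝ
  mre : ℝ
  slopeIm : ℝ
  slopeRe : ℝ

/-- The Gaussian density on `ℂ × ℂ` with the given parameters. -/
noncomputable def noiseDensity (θ : NoiseParam) (z m : ℂ) : ℝ :=
  gaussDensity θ.zre z.re * gaussDensity θ.zim z.im *
    (gaussDensity θ.mim (m.im - θ.slopeIm * z.re) * gaussDensity θ.mre (m.re - θ.slopeRe * z.im))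

lemma noiseDensity_nonneg (θ : NoiseParam) (z m : ℂ) : 0 ≤ noiseDensity θ z m := by
  unfold noiseDensity
  have := gaussDensity_nonneg
  exact mul_nonneg (mul_nonneg (this _ _) (this _ _)) (mul_nonneg (this _ _) (this _ _))

@[fun_prop]
lemma Continuous.noiseDensity {X : Type*} [TopologicalSpace X] (θ : NoiseParam) {f g : X → ℂ}
    (hf : Continuous f) (hg : Continuous g) :
    Continuous fun x => noiseDensity θ (f x) (g x) := by
  unfold SST.noiseDensity
  have := continuous_gaussDensity
  fun_prop

/-- The parameters of the law of `(Φ(h_{t,η}), Φ((· - t) h_{t,η}))`. -/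
noncomputable def noiseParam (η : ℝ) : NoiseParam where
  zre := windowEnergy * (1 + pseudoDecay η) / 2
  zim := windowEnergy * (1 - pseudoDecay η) / 2
  mim := windowEnergy / 2 * ((1 - pseudoDecay η) / 2 +
    4 * Real.pi ^ 2 * η ^ 2 * pseudoDecay η / (1 + pseudoDecay η))
  mre := windowEnergy / 2 * ((1 + pseudoDecay η) / 2 -
    4 * Real.pi ^ 2 * η ^ 2 * pseudoDecay η / (1 - pseudoDecay η))
  slopeIm := -(2 * Real.pi * η * pseudoDecay η / (1 + pseudoDecay η))
  slopeRe := -(2 * Real.pi * η * pseudoDecay η / (1 - pseudoDecay η))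

lemma pseudoDecay_pos (η : ℝ) : 0 < pseudoDecay η := Real.exp_pos _

lemma pseudoDecay_lt_one {η : ℝ} (hη : 0 < η) : pseudoDecay η < 1 := by
  unfold pseudoDecay
  rw [Real.exp_lt_one_iff]
  have := Real.pi_pos
  have : 0 < 4 * Real.pi ^ 2 * η ^ 2 := by positivity
  linarith

lemma noiseParam_zre_pos (η : ℝ) : 0 < (noiseParam η).zre := by
  have := windowEnergy_pos
  have := pseudoDecay_pos η
  simp only [noiseParam]; positivity

lemma noiseParam_zim_pos {η : ℝ} (hη : 0 < η) : 0 < (noiseParam η).zim := by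
  have := windowEnergy_pos
  have : 0 < 1 - pseudoDecay η := by linarith [pseudoDecay_lt_one hη]
  simp only [noiseParam]; positivity

lemma noiseParam_mim_pos {η : ℝ} (hη : 0 < η) : 0 < (noiseParam η).mim := by
  have := windowEnergy_pos
  have := pseudoDecay_pos η
  have : 0 < 1 - pseudoDecay η := by linarith [pseudoDecay_lt_one hη]
  simp only [noiseParam]; positivity

/-- With `x = 4π²η²`, positivity of this residual variance is the inequality `x < sinh x`. -/
lemma noiseParam_mre_pos {η : ℝ} (hη : 0 < η) : 0 < (noiseParam η).mre := by
  have := windowEnergy_pos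
  have h1 := pseudoDecay_pos η
  have h2 : 0 < 1 - pseudoDecay η := by linarith [pseudoDecay_lt_one hη]
  have hx : 0 < 4 * Real.pi ^ 2 * η ^ 2 := by have := Real.pi_pos; positivity
  have hs := Real.self_lt_sinh_iff.2 hx
  rw [Real.sinh_eq] at hs
  have he : Real.exp (4 * Real.pi ^ 2 * η ^ 2) * pseudoDecay η = 1 := by
    rw [pseudoDecay, ← Real.exp_add]; simp
  change _ < (_ - pseudoDecay η) / 2 at hs
  have h3 : 4 * Real.pi ^ 2 * η ^ 2 * pseudoDecay η < (1 - pseudoDecay η ^ 2) / 2 := by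
    have := mul_lt_mul_of_pos_right hs h1
    nlinarith
  have h4 : 4 * Real.pi ^ 2 * η ^ 2 * pseudoDecay η / (1 - pseudoDecay η) <
      (1 + pseudoDecay η) / 2 := by
    rw [div_lt_iff₀ h2]; nlinarith
  simp only [noiseParam]
  have : 0 < (1 + pseudoDecay η) / 2 -
    4 * Real.pi ^ 2 * η ^ 2 * pseudoDecay η / (1 - pseudoDecay η) := by linarith
  positivity

lemma lintegral_complex (f : ℂ → ENNReal) :
    ∫⁻ z, f z = ∫⁻ x : ℝ × ℝ, f ⟨x.1, x.2⟩ :=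
  (Complex.volume_preserving_equiv_real_prod.symm.lintegral_comp_emb
    (Complex.measurableEquivRealProd.symm.measurableEmbedding) f).symm

lemma lintegral_complex_swap (f : ℂ → ENNReal) :
    ∫⁻ z, f z = ∫⁻ x : ℝ × ℝ, f ⟨x.2, x.1⟩ := by
  rw [lintegral_complex]
  exact ((Measure.measurePreserving_swap (μ := (volume : Measure ℝ))
    (ν := (volume : Measure ℝ))).lintegral_comp_emb
    (MeasurableEquiv.prodComm.measurableEmbedding) (fun x : ℝ × ℝ => f ⟨x.1, x.2⟩)).symm

section Law

variable {Ω : Type*} [MeasurableSpace Ω] {P : Measure Ω} {Φ : 𝓢(ℝ, ℂ) → Ω → ℂ}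

lemma gaussianReal_prod_eq_withDensity {v w : ℝ} (hv : 0 < v) (hw : 0 < w) :
    (gaussianReal 0 v.toNNReal).prod (gaussianReal 0 w.toNNReal) =
      (volume : Measure (ℝ × ℝ)).withDensity
        fun x => ENNReal.ofReal (gaussDensity v x.1 * gaussDensity w x.2) := by
  rw [gaussianReal_of_var_ne_zero _ (by simpa using hv),
    gaussianReal_of_var_ne_zero _ (by simpa using hw),
    prod_withDensity (measurable_gaussianPDF _ _) (measurable_gaussianPDF _ _)]
  congr 1
  funext x
  rw [gaussianPDF_eq_gaussDensity hv.le, gaussianPDF_eq_gaussDensity hw.le,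
    ENNReal.ofReal_mul (gaussDensity_nonneg _ _)]

/-- The law of `(Φ(h_{t,η}), Φ((· - t) h_{t,η}))` has a density. -/
theorem IsWhiteNoise.map_eq_withDensity [IsProbabilityMeasure P] (hΦ : IsWhiteNoise P Φ)
    (t : ℝ) {η : ℝ} (hη : 0 < η) :
    P.map (fun ω => (Φ (tfShift gaussWindow t η) ω, Φ (windowMoment t η) ω)) =
      (volume : Measure (ℂ × ℂ)).withDensity
        fun x => ENNReal.ofReal (noiseDensity (noiseParam η) x.1 x.2) := by
  have h1 := pseudoDecay_pos η
  have h2 : 0 < 1 - pseudoDecay η := by linarith [pseudoDecay_lt_one hη]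
  have h3 : 0 < 1 + pseudoDecay η := by linarith
  set a := (noiseParam η).slopeIm with ha
  set b := (noiseParam η).slopeRe with hb
  have ha' : a = -(2 * Real.pi * η * pseudoDecay η / (1 + pseudoDecay η)) := rfl
  have hb' : b = -(2 * Real.pi * η * pseudoDecay η / (1 - pseudoDecay η)) := rfl
  -- The combinations are `re z`, `im z` and the residuals of `im m`, `re m`; the slopes `a`, `b`
  -- are exactly those that make residuals and regressors uncorrelated.
  have key := hΦ.map_linear_combinations t η 1 0 1 0 (-a) 1 (-b) 1
    (by rw [evenForm, ha']; field_simp; ring) (by rw [oddForm, hb']; field_simp; ring)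
  have e1 : evenForm η 1 0 1 0 = (noiseParam η).zre := by simp [evenForm, noiseParam]
  have e2 : oddForm η 1 0 1 0 = (noiseParam η).zim := by simp [oddForm, noiseParam]
  have e3 : evenForm η (-a) 1 (-a) 1 = (noiseParam η).mim := by
    simp only [evenForm, noiseParam]; rw [ha']; field_simp; ring
  have e4 : oddForm η (-b) 1 (-b) 1 = (noiseParam η).mre := by
    simp only [oddForm, noiseParam]; rw [hb']; field_simp; ring
  rw [e1, e2, e3, e4, gaussianReal_prod_eq_withDensity (noiseParam_zre_pos η)
    (noiseParam_zim_pos hη), gaussianReal_prod_eq_withDensity (noiseParam_mim_pos hη)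
    (noiseParam_mre_pos hη)] at key
  set Z := Φ (tfShift gaussWindow t η)
  set M := Φ (windowMoment t η)
  have mZ : AEMeasurable Z P := hΦ.gaussian.aemeasurable _
  have mM : AEMeasurable M P := hΦ.gaussian.aemeasurable _
  -- Reconstruction of `(z, m)` from regressors and residuals. The residual of `im m` comes first,
  -- so the two coordinates are swapped in `m`.
  let g : (ℝ × ℝ) × (ℝ × ℝ) → ℂ × ℂ := fun y =>
    (⟨y.1.1, y.1.2⟩, ⟨y.2.2 + b * y.1.2, y.2.1 + a * y.1.1⟩)
  have hmk : Measurable fun x : ℝ × ℝ => (⟨x.1, x.2⟩ : ℂ) :=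
    Complex.measurableEquivRealProd.symm.measurable
  have hg : Measurable g := by
    have h2 : Measurable fun y : (ℝ × ℝ) × (ℝ × ℝ) => (y.2.2 + b * y.1.2, y.2.1 + a * y.1.1) := by
      fun_prop
    exact (hmk.comp measurable_fst).prodMk (hmk.comp h2)
  refine Measure.ext_of_lintegral _ fun F hF => ?_
  rw [lintegral_map' hF.aemeasurable (mZ.prodMk mM)]
  have e : ∀ ω, F (Z ω, M ω) = (F ∘ g) ((1 * (Z ω).re + 0 * (M ω).im,
      1 * (Z ω).im + 0 * (M ω).re), (-a * (Z ω).re + 1 * (M ω).im,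
      -b * (Z ω).im + 1 * (M ω).re)) := by
    intro ω
    simp only [Function.comp, g]
    congr 1
    refine Prod.ext (Complex.ext ?_ ?_) (Complex.ext ?_ ?_) <;> simp
  simp_rw [e]
  have mre : Measurable fun z : ℂ => z.re := Complex.measurable_re
  have mim : Measurable fun z : ℂ => z.im := Complex.measurable_im
  rw [← lintegral_map' (hF.comp hg).aemeasurable (by fun_prop), key]
  have hd : ∀ v w : ℝ, Measurable fun x : ℝ × ℝ =>
      ENNReal.ofReal (gaussDensity v x.1 * gaussDensity w x.2) := by
    intro v w
    have := continuous_gaussDensity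
    exact (Continuous.measurable (by fun_prop)).ennreal_ofReal
  have hdm : Measurable fun x : ℂ × ℂ => ENNReal.ofReal (noiseDensity (noiseParam η) x.1 x.2) :=
    (Continuous.measurable (by fun_prop)).ennreal_ofReal
  have hdd : ∀ v w v' w' : ℝ, Measurable fun x : (ℝ × ℝ) × (ℝ × ℝ) =>
      ENNReal.ofReal (gaussDensity v x.1.1 * gaussDensity w x.1.2) *
        ENNReal.ofReal (gaussDensity v' x.2.1 * gaussDensity w' x.2.2) := fun v w v' w' =>
    ((hd v w).comp measurable_fst).mul ((hd v' w').comp measurable_snd)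
  rw [prod_withDensity (hd _ _) (hd _ _), lintegral_withDensity_eq_lintegral_mul _
    (hdd _ _ _ _) (hF.comp hg), lintegral_withDensity_eq_lintegral_mul _ hdm hF,
    lintegral_prod _ ((hdd _ _ _ _).mul (hF.comp hg)).aemeasurable, Measure.volume_eq_prod ℂ ℂ,
    lintegral_prod _ (hdm.mul hF).aemeasurable,
    lintegral_complex]
  congr 1
  funext x
  -- The swap matches the order of the residuals; the regression means are then removed by
  -- translation invariance.
  rw [lintegral_complex_swap]
  refine Eq.trans ?_ (lintegral_add_right_eq_self _ ((a * x.1, b * x.2) : ℝ × ℝ))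
  congr 1
  funext y
  simp only [Pi.mul_apply, Function.comp, g, Prod.fst_add, Prod.snd_add]
  congr 1
  rw [← ENNReal.ofReal_mul (mul_nonneg (gaussDensity_nonneg _ _) (gaussDensity_nonneg _ _)),
    noiseDensity]
  simp only [← ha, ← hb, add_sub_cancel_right]

end Law

/-! ### Fibre coordinates and the moment formulas. -/

/-- Polar-type change of variables on `ℂ²`, with fibrewise dilation by `r‖y₁‖`. -/
lemma lintegral_fibre_rescale {r : ℝ} (hr : 0 < r) (v a b : ℂ) {F : ℂ × ℂ → ENNReal}
    (hF : Measurable F) :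
    ∫⁻ x : ℂ × ℂ, F x = ∫⁻ y : ℂ × ℂ, ENNReal.ofReal ((r * ‖y.1‖) ^ 2) *
      F (y.1 - v, ((r * ‖y.1‖ : ℝ) : ℂ) * y.2 + (a * y.1 + b)) := by
  have hm : Measurable fun y : ℂ × ℂ => ENNReal.ofReal ((r * ‖y.1‖) ^ 2) *
      F (y.1 - v, ((r * ‖y.1‖ : ℝ) : ℂ) * y.2 + (a * y.1 + b)) := by
    refine Measurable.mul (by fun_prop) (hF.comp ?_)
    exact (Continuous.measurable (by fun_prop))
  rw [Measure.volume_eq_prod, lintegral_prod _ hF.aemeasurable, lintegral_prod _ hm.aemeasurable,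
    ← lintegral_sub_right_eq_self (fun z : ℂ => ∫⁻ m, F (z, m)) v]
  refine lintegral_congr_ae ?_
  -- The dilation degenerates at `z = 0`, a null set.
  have h0 : ∀ᵐ z : ℂ, z ≠ 0 := by
    simp [ae_iff]
  filter_upwards [h0] with z hz
  have hz' : 0 < r * ‖z‖ := mul_pos hr (norm_pos_iff.2 hz)
  have hF' : Measurable fun m => F (z - v, m + (a * z + b)) := by fun_prop
  rw [lintegral_const_mul _ (by fun_prop),
    ← lintegral_add_right_eq_self (fun m => F (z - v, m)) (a * z + b)]
  have h1 := Measure.map_addHaar_smul (volume : Measure ℂ) hz'.ne'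
  have h2 : ∫⁻ w : ℂ, F (z - v, ((r * ‖z‖ : ℝ) : ℂ) * w + (a * z + b)) =
      ∫⁻ m, F (z - v, m + (a * z + b)) ∂(Measure.map ((r * ‖z‖) • ·) (volume : Measure ℂ)) := by
    rw [lintegral_map hF' (by fun_prop)]
    simp [Complex.real_smul]
  rw [h2, h1, lintegral_smul_measure, Complex.finrank_real_complex, smul_eq_mul, ← mul_assoc,
    abs_of_pos (by positivity), ← ENNReal.ofReal_mul (by positivity),
    mul_inv_cancel₀ (by positivity), ENNReal.ofReal_one, one_mul]

/-- The noise density in the fibre coordinates `(V, w)`, in which the noise is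
`z = V - v`, `m = r ‖V‖ w + a V + b`. -/
noncomputable def fibreDensity (θ : NoiseParam) (r : ℝ) (v a b : ℂ) (y : ℂ × ℂ) : ℝ :=
  noiseDensity θ (y.1 - v) (((r * ‖y.1‖ : ℝ) : ℂ) * y.2 + (a * y.1 + b))

lemma fibreDensity_nonneg (θ : NoiseParam) (r : ℝ) (v a b : ℂ) (y : ℂ × ℂ) :
    0 ≤ fibreDensity θ r v a b y := noiseDensity_nonneg _ _ _

lemma continuous_fibreDensity (θ : NoiseParam) (r : ℝ) (v a b : ℂ) :
    Continuous (fibreDensity θ r v a b) := by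
  unfold fibreDensity; fun_prop

/-- The fibre density of the synchrosqueezing integrand. -/
noncomputable def sstDensity (A ξ₀ t ξ α η : ℝ) : ℂ × ℂ → ℝ :=
  fibreDensity (noiseParam η) (2 * Real.pi * Real.sqrt α) (signalValue A ξ₀ t η)
    (-(2 * Real.pi * Complex.I * (η - ξ)))
    (-(2 * Real.pi * Complex.I * (ξ₀ - η) * signalValue A ξ₀ t η))

lemma sstDensity_nonneg (A ξ₀ t ξ α η : ℝ) (y : ℂ × ℂ) : 0 ≤ sstDensity A ξ₀ t ξ α η y :=
  fibreDensity_nonneg _ _ _ _ _ _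

lemma continuous_sstDensity (A ξ₀ t ξ α η : ℝ) : Continuous (sstDensity A ξ₀ t ξ α η) :=
  continuous_fibreDensity _ _ _ _ _

/-- The synchrosqueezing integrand as a function of the noise pair
`(Φ(h_{t,η}), Φ((· - t) h_{t,η}))`. -/
noncomputable def sstOfNoise (A ξ₀ t ξ α η : ℝ) (x : ℂ × ℂ) : ℂ :=
  (signalValue A ξ₀ t η + x.1) * approxDelta α (ξ - 1 / (2 * Real.pi * Complex.I) *
    ((2 * Real.pi * Complex.I * ξ₀ * signalValue A ξ₀ t η +
      (x.2 + 2 * Real.pi * Complex.I * η * x.1)) / (signalValue A ξ₀ t η + x.1)))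

lemma measurable_sstOfNoise (A ξ₀ t ξ α η : ℝ) : Measurable (sstOfNoise A ξ₀ t ξ α η) := by
  have h : Measurable (approxDelta α) := by
    unfold approxDelta
    exact Continuous.measurable (by fun_prop)
  unfold sstOfNoise
  refine Measurable.mul (by fun_prop) (Complex.measurable_ofReal.comp (h.comp ?_))
  fun_prop

/-- The affine part `a V + b` of the fibre map is the value of `m` at which the numerator of `ξ - Ω`
vanishes, so that numerator becomes `2π√α ‖V‖ w` and `‖ξ - Ω‖² / α = ‖w‖²`. At `V = 0` both sides
vanish because of the factor `V`. -/
lemma sstOfNoise_fibre (A ξ₀ t ξ η : ℝ) {α : ℝ} (hα : 0 < α) (y : ℂ × ℂ) :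
    sstOfNoise A ξ₀ t ξ α η (y.1 - signalValue A ξ₀ t η,
      ((2 * Real.pi * Real.sqrt α * ‖y.1‖ : ℝ) : ℂ) * y.2 +
      (-(2 * Real.pi * Complex.I * (η - ξ)) * y.1 +
        -(2 * Real.pi * Complex.I * (ξ₀ - η) * signalValue A ξ₀ t η))) =
    (((Real.pi * α)⁻¹ * Real.exp (-‖y.2‖ ^ 2) : ℝ) : ℂ) * y.1 := by
  obtain ⟨V, w⟩ := y
  unfold sstOfNoise
  simp only [add_sub_cancel]
  by_cases hV : V = 0
  · simp [hV]
  set v := signalValue A ξ₀ t η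
  have hpi : (Real.pi : ℂ) ≠ 0 := by exact_mod_cast Real.pi_pos.ne'
  have e : (ξ : ℂ) - 1 / (2 * Real.pi * Complex.I) *
    ((2 * Real.pi * Complex.I * ξ₀ * v +
      (((2 * Real.pi * Real.sqrt α * ‖V‖ : ℝ) : ℂ) * w +
      (-(2 * Real.pi * Complex.I * (η - ξ)) * V +
        -(2 * Real.pi * Complex.I * (ξ₀ - η) * v)) + 2 * Real.pi * Complex.I * η * (V - v))) / V) =
      -(((Real.sqrt α * ‖V‖ : ℝ) : ℂ) * w) / (Complex.I * V) := by
    have hI := Complex.I_ne_zero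
    push_cast
    field_simp
    ring
  have hn : ‖-(((Real.sqrt α * ‖V‖ : ℝ) : ℂ) * w) / (Complex.I * V)‖ = Real.sqrt α * ‖w‖ := by
    have : ‖V‖ ≠ 0 := norm_ne_zero_iff.2 hV
    rw [norm_div, norm_neg, norm_mul, norm_mul, Complex.norm_I, Complex.norm_real,
      Real.norm_of_nonneg (by positivity)]
    field_simp
  rw [e, approxDelta, hn, mul_pow, Real.sq_sqrt hα.le, mul_div_cancel_left₀ _ hα.ne', mul_comm,
    one_div]

section Law

variable {Ω : Type*} [MeasurableSpace Ω] {P : Measure Ω} {Φ : 𝓢(ℝ, ℂ) → Ω → ℂ}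

/-- Linearity of the noise splits `Φ(∂_t h_{t,η})` into `m + 2πiη z`. It holds only almost surely,
and so does this identity. -/
lemma IsWhiteNoise.Y_ae_eq (hΦ : IsWhiteNoise P Φ) (A ξ₀ t ξ α η : ℝ) :
    Y Φ A ξ₀ t ξ α η =ᵐ[P] fun ω => sstOfNoise A ξ₀ t ξ α η
      (Φ (tfShift gaussWindow t η) ω, Φ (windowMoment t η) ω) := by
  have h := hΦ.linear 1 (2 * Real.pi * Complex.I * η) (windowMoment t η) (tfShift gaussWindow t η)
  have e : tfShiftDt gaussWindow t η = (1 : ℂ) • windowMoment t η +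
      (2 * Real.pi * Complex.I * η : ℂ) • tfShift gaussWindow t η := by
    rw [one_smul]; rfl
  filter_upwards [h] with ω hω
  simp only [Y, sstIntegrand, reassignment, stft, stftDt, deriv_signalSTFT, sstOfNoise]
  rw [e, hω, one_mul, signalSTFT_eq]

lemma IsWhiteNoise.aemeasurable_Y (hΦ : IsWhiteNoise P Φ) (A ξ₀ t ξ α η : ℝ) :
    AEMeasurable (Y Φ A ξ₀ t ξ α η) P := by
  refine AEMeasurable.congr ?_ (hΦ.Y_ae_eq A ξ₀ t ξ α η).symm
  exact (measurable_sstOfNoise _ _ _ _ _ _).comp_aemeasurable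
    ((hΦ.gaussian.aemeasurable _).prodMk (hΦ.gaussian.aemeasurable _))

/-- Since `g_α ≤ (πα)⁻¹`, the integrand is dominated by a multiple of `|V|`, which is Gaussian up to
a constant. -/
lemma IsWhiteNoise.memLp_Y (hΦ : IsWhiteNoise P Φ) [IsProbabilityMeasure P] (A ξ₀ t ξ : ℝ)
    {α : ℝ} (hα : 0 < α) (η : ℝ) {p : ENNReal} (hp : p ≠ ⊤) :
    MemLp (Y Φ A ξ₀ t ξ α η) p P := by
  have h0 : MemLp (fun _ : Ω => signalSTFT (signal A ξ₀) gaussWindow t η) p P := memLp_const _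
  have h1 : MemLp (stft (signal A ξ₀) Φ gaussWindow t η) p P :=
    h0.add (hΦ.memLp (tfShift gaussWindow t η) hp)
  refine h1.of_le_mul (c := 1 / (Real.pi * α)) (hΦ.aemeasurable_Y _ _ _ _ _ _).aestronglyMeasurable
    (ae_of_all _ fun ω => ?_)
  rw [Y, sstIntegrand, norm_mul, Complex.norm_real, mul_comm]
  refine mul_le_mul_of_nonneg_right ?_ (norm_nonneg _)
  have := Real.pi_pos
  rw [approxDelta, Real.norm_of_nonneg (by positivity)]
  refine mul_le_of_le_one_right (by positivity) (Real.exp_le_one_iff.2 ?_)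
  rw [neg_nonpos]; positivity

/-- The law of the synchrosqueezing integrand in fibre coordinates. -/
theorem IsWhiteNoise.map_Y [IsProbabilityMeasure P] (hΦ : IsWhiteNoise P Φ) (A ξ₀ t ξ : ℝ)
    {α η : ℝ} (hα : 0 < α) (hη : 0 < η) :
    P.map (Y Φ A ξ₀ t ξ α η) =
      ((volume : Measure (ℂ × ℂ)).withDensity fun y =>
        ENNReal.ofReal (4 * Real.pi ^ 2 * α * (‖y.1‖ ^ 2 * sstDensity A ξ₀ t ξ α η y))).map
      fun y => (((Real.pi * α)⁻¹ * Real.exp (-‖y.2‖ ^ 2) : ℝ) : ℂ) * y.1 := by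
  have hr : 0 < 2 * Real.pi * Real.sqrt α := by
    have := Real.pi_pos; have := Real.sqrt_pos.2 hα; positivity
  have mY := hΦ.aemeasurable_Y A ξ₀ t ξ α η
  have mZM := (hΦ.gaussian.aemeasurable (tfShift gaussWindow t η)).prodMk
    (hΦ.gaussian.aemeasurable (windowMoment t η))
  have mS := measurable_sstOfNoise A ξ₀ t ξ α η
  have hmap : Measurable fun y : ℂ × ℂ =>
      (((Real.pi * α)⁻¹ * Real.exp (-‖y.2‖ ^ 2) : ℝ) : ℂ) * y.1 :=
    Continuous.measurable (by fun_prop)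
  have hden : Measurable fun y : ℂ × ℂ =>
      ENNReal.ofReal (4 * Real.pi ^ 2 * α * (‖y.1‖ ^ 2 * sstDensity A ξ₀ t ξ α η y)) := by
    have := continuous_sstDensity A ξ₀ t ξ α η
    exact (Continuous.measurable (by fun_prop)).ennreal_ofReal
  have hdm : Measurable fun x : ℂ × ℂ => ENNReal.ofReal (noiseDensity (noiseParam η) x.1 x.2) :=
    (Continuous.measurable (by fun_prop)).ennreal_ofReal
  refine Measure.ext_of_lintegral _ fun F hF => ?_
  have hY : ∫⁻ ω, F (Y Φ A ξ₀ t ξ α η ω) ∂P = ∫⁻ ω, F (sstOfNoise A ξ₀ t ξ α η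
      (Φ (tfShift gaussWindow t η) ω, Φ (windowMoment t η) ω)) ∂P :=
    lintegral_congr_ae ((hΦ.Y_ae_eq A ξ₀ t ξ α η).fun_comp F)
  have hFS : Measurable fun x => F (sstOfNoise A ξ₀ t ξ α η x) := hF.comp mS
  have hFm : Measurable fun y : ℂ × ℂ =>
      F ((((Real.pi * α)⁻¹ * Real.exp (-‖y.2‖ ^ 2) : ℝ) : ℂ) * y.1) := hF.comp hmap
  rw [lintegral_map' hF.aemeasurable mY, hY,
    ← lintegral_map' hFS.aemeasurable mZM,
    hΦ.map_eq_withDensity t hη, lintegral_withDensity_eq_lintegral_mul _ hdm hFS,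
    lintegral_fibre_rescale hr (signalValue A ξ₀ t η) (-(2 * Real.pi * Complex.I * (η - ξ)))
      (-(2 * Real.pi * Complex.I * (ξ₀ - η) * signalValue A ξ₀ t η)) (hdm.mul hFS),
    lintegral_map hF hmap, lintegral_withDensity_eq_lintegral_mul _ hden hFm]
  congr 1
  funext y
  simp only [Pi.mul_apply]
  rw [sstOfNoise_fibre A ξ₀ t ξ η hα, ← mul_assoc, ← ENNReal.ofReal_mul (by positivity),
    mul_pow, mul_pow, mul_pow, Real.sq_sqrt hα.le, sstDensity, fibreDensity]
  congr 2
  ring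

lemma IsWhiteNoise.integral_comp_Y [IsProbabilityMeasure P] (hΦ : IsWhiteNoise P Φ)
    (A ξ₀ t ξ : ℝ) {α η : ℝ} (hα : 0 < α) (hη : 0 < η) {E : Type*} [NormedAddCommGroup E]
    [NormedSpace ℝ E] {G : ℂ → E} (hG : Continuous G) [SecondCountableTopology E] :
    ∫ ω, G (Y Φ A ξ₀ t ξ α η ω) ∂P = ∫ y : ℂ × ℂ,
      (4 * Real.pi ^ 2 * α * (‖y.1‖ ^ 2 * sstDensity A ξ₀ t ξ α η y)) •
        G ((((Real.pi * α)⁻¹ * Real.exp (-‖y.2‖ ^ 2) : ℝ) : ℂ) * y.1) := by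
  have hc := continuous_sstDensity A ξ₀ t ξ α η
  have hmap : Measurable fun y : ℂ × ℂ =>
      (((Real.pi * α)⁻¹ * Real.exp (-‖y.2‖ ^ 2) : ℝ) : ℂ) * y.1 :=
    Continuous.measurable (by fun_prop)
  rw [← integral_map (hΦ.aemeasurable_Y A ξ₀ t ξ α η) hG.aestronglyMeasurable,
    hΦ.map_Y A ξ₀ t ξ hα hη, integral_map hmap.aemeasurable hG.aestronglyMeasurable,
    integral_withDensity_eq_integral_toReal_smul
      (Continuous.measurable (by fun_prop)).ennreal_ofReal (ae_of_all _ fun _ => by simp)]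
  congr 1
  funext y
  have := sstDensity_nonneg A ξ₀ t ξ α η y
  rw [ENNReal.toReal_ofReal (by positivity)]

lemma scale_factor {α : ℝ} (hα : 0 < α) (k : ℕ) :
    4 * Real.pi ^ 2 * α * (Real.pi * α)⁻¹ ^ k =
      4 * Real.pi ^ 2 * (Real.pi ^ k)⁻¹ * α ^ (1 - (k : ℤ)) := by
  have := Real.pi_pos.ne'
  rw [zpow_sub₀ hα.ne', zpow_one, zpow_natCast, inv_pow, mul_pow]
  field_simp

/-- The integrand of the absolute moments in fibre coordinates. -/
noncomputable def absMomentIntegrand (A ξ₀ t ξ α η : ℝ) (k : ℕ) (y : ℂ × ℂ) : ℝ :=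
  sstDensity A ξ₀ t ξ α η y * (‖y.1‖ ^ (k + 2) * Real.exp (-(k * ‖y.2‖ ^ 2)))

/-- The integrand of the moments in fibre coordinates. -/
noncomputable def momentIntegrand (A ξ₀ t ξ α η : ℝ) (k : ℕ) (y : ℂ × ℂ) : ℂ :=
  ((sstDensity A ξ₀ t ξ α η y * (‖y.1‖ ^ 2 * Real.exp (-(k * ‖y.2‖ ^ 2))) : ℝ) : ℂ) * y.1 ^ k

/-- The Jacobian contributes one factor `α` and the `k`-th power of `(πα)⁻¹` contributes `α^(-k)`.
In the remaining integral `α` enters only through `√α` inside a continuous density. -/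
theorem IsWhiteNoise.integral_norm_Y_pow [IsProbabilityMeasure P] (hΦ : IsWhiteNoise P Φ)
    (A ξ₀ t ξ : ℝ) {α η : ℝ} (hα : 0 < α) (hη : 0 < η) (k : ℕ) :
    ∫ ω, ‖Y Φ A ξ₀ t ξ α η ω‖ ^ k ∂P = 4 * Real.pi ^ 2 * (Real.pi ^ k)⁻¹ * α ^ (1 - (k : ℤ)) *
      ∫ y, absMomentIntegrand A ξ₀ t ξ α η k y := by
  rw [hΦ.integral_comp_Y A ξ₀ t ξ hα hη (G := fun z => ‖z‖ ^ k) (by fun_prop), ← scale_factor hα,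
    ← integral_const_mul]
  congr 1
  funext y
  have := Real.pi_pos
  rw [norm_mul, Complex.norm_real, Real.norm_of_nonneg (by positivity), absMomentIntegrand,
    smul_eq_mul, mul_pow, mul_pow, ← Real.exp_nat_mul]
  ring_nf

theorem IsWhiteNoise.integral_Y_pow [IsProbabilityMeasure P] (hΦ : IsWhiteNoise P Φ)
    (A ξ₀ t ξ : ℝ) {α η : ℝ} (hα : 0 < α) (hη : 0 < η) (k : ℕ) :
    ∫ ω, Y Φ A ξ₀ t ξ α η ω ^ k ∂P =
      ((4 * Real.pi ^ 2 * (Real.pi ^ k)⁻¹ * α ^ (1 - (k : ℤ)) : ℝ) : ℂ) *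
      ∫ y, momentIntegrand A ξ₀ t ξ α η k y := by
  rw [hΦ.integral_comp_Y A ξ₀ t ξ hα hη (G := fun z => z ^ k) (by fun_prop), ← scale_factor hα,
    ← integral_const_mul]
  congr 1
  funext y
  have e : ((Real.exp (-‖y.2‖ ^ 2) : ℝ) : ℂ) ^ k = ((Real.exp (-(k * ‖y.2‖ ^ 2)) : ℝ) : ℂ) := by
    rw [← Complex.ofReal_pow, ← Real.exp_nat_mul]
    ring_nf
  rw [momentIntegrand, Complex.real_smul, mul_pow, Complex.ofReal_mul (Real.pi * α)⁻¹, mul_pow, e]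
  push_cast
  ring

end Law

/-! ### Gaussian bounds uniform over a box of parameters. -/

/-- All variances lie in `[l, L]` and all regression coefficients in `[-L, L]`. -/
structure NoiseParam.InBox (θ : NoiseParam) (l L : ℝ) : Prop where
  pos : 0 < l
  le_zre : l ≤ θ.zre
  zre_le : θ.zre ≤ L
  le_zim : l ≤ θ.zim
  zim_le : θ.zim ≤ L
  le_mim : l ≤ θ.mim
  mim_le : θ.mim ≤ L
  le_mre : l ≤ θ.mre
  mre_le : θ.mre ≤ L
  slopeIm_le : |θ.slopeIm| ≤ L
  slopeRe_le : |θ.slopeRe| ≤ L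

lemma NoiseParam.InBox.upper_pos {θ : NoiseParam} {l L : ℝ} (h : θ.InBox l L) : 0 < L :=
  h.pos.trans_le (h.le_zre.trans h.zre_le)

/-- The value at zero of the centred Gaussian density with variance `l`. -/
noncomputable def peak (l : ℝ) : ℝ := (Real.sqrt (2 * Real.pi * l))⁻¹

lemma peak_pos {l : ℝ} (hl : 0 < l) : 0 < peak l := by
  unfold peak
  have := Real.sqrt_pos.2 (show 0 < 2 * Real.pi * l by have := Real.pi_pos; positivity)
  positivity

lemma gaussDensity_le {l L v : ℝ} (hl : 0 < l) (h1 : l ≤ v) (h2 : v ≤ L) (x : ℝ) :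
    gaussDensity v x ≤ peak l * Real.exp (-(x ^ 2 / (2 * L))) := by
  have hv : 0 < v := hl.trans_le h1
  have := Real.pi_pos
  have := Real.sqrt_pos.2 (show 0 < 2 * Real.pi * l by positivity)
  unfold gaussDensity peak
  gcongr

lemma gaussDensity_le_peak {l v : ℝ} (hl : 0 < l) (h1 : l ≤ v) (x : ℝ) :
    gaussDensity v x ≤ peak l := by
  refine (gaussDensity_le hl h1 le_rfl x).trans (mul_le_of_le_one_right (peak_pos hl).le ?_)
  rw [Real.exp_le_one_iff, neg_nonpos]
  have : 0 < v := hl.trans_le h1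
  positivity

/-- The exponential rate in the Gaussian bounds for parameters in a box. -/
noncomputable def boxRate (L : ℝ) : ℝ := (4 * L * (1 + L ^ 2))⁻¹

lemma boxRate_pos {L : ℝ} (hL : 0 < L) : 0 < boxRate L := by unfold boxRate; positivity

/-- This undoes the shear of the regression: `y² ≤ 2(y - cx)² + 2L²x²`, so `x² + y²` is at most `2(1
+ L²)` times the sheared form. -/
lemma boxRate_pair {L c x y : ℝ} (hL : 0 < L) (hc : |c| ≤ L) :
    boxRate L * (x ^ 2 + y ^ 2) ≤ x ^ 2 / (2 * L) + (y - c * x) ^ 2 / (2 * L) := by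
  have hc2 : c ^ 2 ≤ L ^ 2 := sq_le_sq' (by linarith [neg_abs_le c]) (by linarith [le_abs_self c])
  have hy : y ^ 2 ≤ 2 * (y - c * x) ^ 2 + 2 * (L ^ 2 * x ^ 2) := by
    nlinarith [sq_nonneg (y - c * x - c * x), mul_le_mul_of_nonneg_right hc2 (sq_nonneg x)]
  rw [← add_div, boxRate, inv_mul_le_iff₀ (by positivity)]
  have e : 4 * L * (1 + L ^ 2) * ((x ^ 2 + (y - c * x) ^ 2) / (2 * L)) =
      2 * (1 + L ^ 2) * (x ^ 2 + (y - c * x) ^ 2) := by field_simp; ring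
  rw [e]
  nlinarith [sq_nonneg x, mul_nonneg (sq_nonneg L) (sq_nonneg (y - c * x)),
    mul_nonneg (sq_nonneg L) (sq_nonneg x)]

lemma noiseDensity_le {θ : NoiseParam} {l L : ℝ} (h : θ.InBox l L) (z m : ℂ) :
    noiseDensity θ z m ≤ peak l ^ 4 * Real.exp (-(boxRate L * (‖z‖ ^ 2 + ‖m‖ ^ 2))) := by
  have hL := h.upper_pos
  have hp := (peak_pos h.pos).le
  have h1 := gaussDensity_le h.pos h.le_zre h.zre_le z.re
  have h2 := gaussDensity_le h.pos h.le_zim h.zim_le z.im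
  have h3 := gaussDensity_le h.pos h.le_mim h.mim_le (m.im - θ.slopeIm * z.re)
  have h4 := gaussDensity_le h.pos h.le_mre h.mre_le (m.re - θ.slopeRe * z.im)
  have n := gaussDensity_nonneg
  calc noiseDensity θ z m
      ≤ (peak l * Real.exp (-(z.re ^ 2 / (2 * L)))) * (peak l * Real.exp (-(z.im ^ 2 / (2 * L)))) *
        ((peak l * Real.exp (-((m.im - θ.slopeIm * z.re) ^ 2 / (2 * L)))) *
          (peak l * Real.exp (-((m.re - θ.slopeRe * z.im) ^ 2 / (2 * L))))) := by
        unfold noiseDensity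
        have := n θ.zre z.re
        have := n θ.zim z.im
        have := n θ.mim (m.im - θ.slopeIm * z.re)
        have := n θ.mre (m.re - θ.slopeRe * z.im)
        gcongr
    _ = peak l ^ 4 * Real.exp (-((z.re ^ 2 / (2 * L) + (m.im - θ.slopeIm * z.re) ^ 2 / (2 * L)) +
          (z.im ^ 2 / (2 * L) + (m.re - θ.slopeRe * z.im) ^ 2 / (2 * L)))) := by
        rw [neg_add, neg_add, neg_add, Real.exp_add, Real.exp_add, Real.exp_add]; ring
    _ ≤ _ := by
        have a1 := boxRate_pair (x := z.re) (y := m.im) hL h.slopeIm_le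
        have a2 := boxRate_pair (x := z.im) (y := m.re) hL h.slopeRe_le
        have e : ‖z‖ ^ 2 + ‖m‖ ^ 2 = (z.re ^ 2 + m.im ^ 2) + (z.im ^ 2 + m.re ^ 2) := by
          rw [Complex.sq_norm, Complex.sq_norm, Complex.normSq_apply, Complex.normSq_apply]; ring
        rw [e]
        gcongr
        linarith

lemma noiseDensity_le_left {θ : NoiseParam} {l L : ℝ} (h : θ.InBox l L) (z m : ℂ) :
    noiseDensity θ z m ≤ peak l ^ 4 * Real.exp (-(boxRate L * ‖z‖ ^ 2)) := by
  refine (noiseDensity_le h z m).trans ?_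
  have := boxRate_pos h.upper_pos
  have := peak_pos h.pos
  gcongr
  linarith [sq_nonneg ‖m‖]

lemma noiseDensity_le_right {θ : NoiseParam} {l L : ℝ} (h : θ.InBox l L) (z m : ℂ) :
    noiseDensity θ z m ≤ peak l ^ 4 * Real.exp (-(boxRate L * ‖m‖ ^ 2)) := by
  refine (noiseDensity_le h z m).trans ?_
  have := boxRate_pos h.upper_pos
  have := peak_pos h.pos
  gcongr
  linarith [sq_nonneg ‖z‖]

lemma noiseDensity_pos {θ : NoiseParam} {l L : ℝ} (h : θ.InBox l L) (z m : ℂ) :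
    0 < noiseDensity θ z m := by
  have h1 := gaussDensity_pos (h.pos.trans_le h.le_zre) z.re
  have h2 := gaussDensity_pos (h.pos.trans_le h.le_zim) z.im
  have h3 := gaussDensity_pos (h.pos.trans_le h.le_mim) (m.im - θ.slopeIm * z.re)
  have h4 := gaussDensity_pos (h.pos.trans_le h.le_mre) (m.re - θ.slopeRe * z.im)
  unfold noiseDensity
  positivity

lemma exists_inBox {η : ℝ} (hη : 0 < η) : ∃ l L, (noiseParam η).InBox l L := by
  have h1 := noiseParam_zre_pos η
  have h2 := noiseParam_zim_pos hη
  have h3 := noiseParam_mim_pos hη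
  have h4 := noiseParam_mre_pos hη
  set θ := noiseParam η
  refine ⟨min (min θ.zre θ.zim) (min θ.mim θ.mre),
    θ.zre + θ.zim + θ.mim + θ.mre + |θ.slopeIm| + |θ.slopeRe|, ?_, ?_, ?_, ?_, ?_, ?_, ?_, ?_, ?_,
    ?_, ?_⟩
  · exact lt_min (lt_min h1 h2) (lt_min h3 h4)
  · exact (min_le_left _ _).trans (min_le_left _ _)
  · linarith [abs_nonneg θ.slopeIm, abs_nonneg θ.slopeRe]
  · exact (min_le_left _ _).trans (min_le_right _ _)
  · linarith [abs_nonneg θ.slopeIm, abs_nonneg θ.slopeRe]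
  · exact (min_le_right _ _).trans (min_le_left _ _)
  · linarith [abs_nonneg θ.slopeIm, abs_nonneg θ.slopeRe]
  · exact (min_le_right _ _).trans (min_le_right _ _)
  · linarith [abs_nonneg θ.slopeIm, abs_nonneg θ.slopeRe]
  · linarith [abs_nonneg θ.slopeIm, abs_nonneg θ.slopeRe]
  · linarith [abs_nonneg θ.slopeIm, abs_nonneg θ.slopeRe]

lemma integrable_exp_neg_mul_sq_norm {κ : ℝ} (hκ : 0 < κ) :
    Integrable fun z : ℂ => Real.exp (-(κ * ‖z‖ ^ 2)) := by
  have h := (integrable_exp_neg_mul_sq hκ).mul_prod (integrable_exp_neg_mul_sq hκ)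
  rw [← Measure.volume_eq_prod] at h
  have h2 := (Complex.volume_preserving_equiv_real_prod.integrable_comp_emb
    Complex.measurableEquivRealProd.measurableEmbedding).2 h
  refine h2.congr (ae_of_all _ fun z => ?_)
  simp only [Function.comp, Complex.measurableEquivRealProd_apply]
  rw [← Real.exp_add, Complex.sq_norm, Complex.normSq_apply]
  congr 1; ring

lemma pow_mul_exp_le (n : ℕ) {κ : ℝ} (hκ : 0 < κ) : ∃ C, 0 ≤ C ∧ ∀ x : ℝ, 0 ≤ x →
    x ^ n * Real.exp (-(κ * x ^ 2)) ≤ C := by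
  refine ⟨1 + (n.factorial / κ ^ n), by positivity, fun x hx => ?_⟩
  have h1 : Real.exp (-(κ * x ^ 2)) ≤ 1 := by
    rw [Real.exp_le_one_iff, neg_nonpos]; positivity
  have h0 : 0 ≤ (n.factorial / κ ^ n : ℝ) := by positivity
  by_cases h : x ≤ 1
  · have : x ^ n ≤ 1 := pow_le_one₀ hx h
    have := mul_le_one₀ this (Real.exp_pos _).le h1
    linarith
  · push Not at h
    have h2 : (κ * x) ^ n / n.factorial ≤ Real.exp (κ * x ^ 2) := by
      refine (Real.pow_div_factorial_le_exp (κ * x) (by positivity) n).trans ?_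
      refine Real.exp_le_exp.2 ?_
      nlinarith [mul_pos hκ (by linarith : 0 < x)]
    have h3 : x ^ n ≤ n.factorial / κ ^ n * Real.exp (κ * x ^ 2) := by
      rw [div_mul_eq_mul_div, le_div_iff₀ (by positivity), mul_comm, ← mul_pow]
      rw [div_le_iff₀ (by positivity)] at h2
      linarith
    calc x ^ n * Real.exp (-(κ * x ^ 2))
        ≤ n.factorial / κ ^ n * Real.exp (κ * x ^ 2) * Real.exp (-(κ * x ^ 2)) := by gcongr
      _ = n.factorial / κ ^ n := by rw [mul_assoc, ← Real.exp_add]; simp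
      _ ≤ _ := by linarith

lemma integrable_norm_pow_mul_exp (n : ℕ) {κ : ℝ} (hκ : 0 < κ) :
    Integrable fun z : ℂ => ‖z‖ ^ n * Real.exp (-(κ * ‖z‖ ^ 2)) := by
  obtain ⟨C, hC, h⟩ := pow_mul_exp_le n (half_pos hκ)
  refine ((integrable_exp_neg_mul_sq_norm (half_pos hκ)).const_mul C).mono'
    (Continuous.aestronglyMeasurable (by fun_prop)) (ae_of_all _ fun z => ?_)
  rw [Real.norm_of_nonneg (by positivity)]
  have e : Real.exp (-(κ * ‖z‖ ^ 2)) =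
      Real.exp (-(κ / 2 * ‖z‖ ^ 2)) * Real.exp (-(κ / 2 * ‖z‖ ^ 2)) := by
    rw [← Real.exp_add]; congr 1; ring
  rw [e, ← mul_assoc]
  exact mul_le_mul_of_nonneg_right (h _ (norm_nonneg z)) (Real.exp_pos _).le

lemma exp_shift_le {κ : ℝ} (hκ : 0 < κ) (V v : ℂ) :
    Real.exp (-(κ * ‖V - v‖ ^ 2)) ≤ Real.exp (κ * ‖v‖ ^ 2) * Real.exp (-(κ / 2 * ‖V‖ ^ 2)) := by
  rw [← Real.exp_add, Real.exp_le_exp]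
  have h : ‖V‖ ≤ ‖V - v‖ + ‖v‖ := by simpa using norm_add_le (V - v) v
  have h2 : ‖V‖ ^ 2 ≤ 2 * ‖V - v‖ ^ 2 + 2 * ‖v‖ ^ 2 := by
    nlinarith [sq_nonneg (‖V - v‖ - ‖v‖), norm_nonneg V]
  nlinarith

/-- The decay in `m` is discarded, which makes the bound independent of `r`, and hence of `α`.
Integrability in `w` comes from the factor `exp(-k‖w‖²)`, which is why `k ≥ 1` is assumed later. -/
lemma fibreDensity_le {θ : NoiseParam} {l L : ℝ} (h : θ.InBox l L) (r : ℝ) (v a b : ℂ)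
    (y : ℂ × ℂ) : fibreDensity θ r v a b y ≤
      peak l ^ 4 * Real.exp (boxRate L * ‖v‖ ^ 2) * Real.exp (-(boxRate L / 2 * ‖y.1‖ ^ 2)) := by
  refine (noiseDensity_le_left h _ _).trans ?_
  rw [mul_assoc]
  have := peak_pos h.pos
  gcongr
  exact exp_shift_le (boxRate_pos h.upper_pos) _ _

/-! ### Absolute moments at fixed `η`. -/

/-- A common integrable majorant for the moment integrands. -/
lemma integrable_majorant (n : ℕ) {κ κ' : ℝ} (hκ : 0 < κ) (hκ' : 0 < κ') (C : ℝ) :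
    Integrable fun y : ℂ × ℂ => C * ((‖y.1‖ ^ n * Real.exp (-(κ * ‖y.1‖ ^ 2))) *
      Real.exp (-(κ' * ‖y.2‖ ^ 2))) := by
  rw [Measure.volume_eq_prod]
  exact ((integrable_norm_pow_mul_exp n hκ).mul_prod
    (integrable_exp_neg_mul_sq_norm hκ')).const_mul C

lemma absMomentIntegrand_nonneg (A ξ₀ t ξ α η : ℝ) (k : ℕ) (y : ℂ × ℂ) :
    0 ≤ absMomentIntegrand A ξ₀ t ξ α η k y := by
  have := sstDensity_nonneg A ξ₀ t ξ α η y
  unfold absMomentIntegrand; positivity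

lemma continuous_absMomentIntegrand (A ξ₀ t ξ α η : ℝ) (k : ℕ) :
    Continuous (absMomentIntegrand A ξ₀ t ξ α η k) := by
  have := continuous_sstDensity A ξ₀ t ξ α η
  unfold absMomentIntegrand; fun_prop

lemma continuous_momentIntegrand (A ξ₀ t ξ α η : ℝ) (k : ℕ) :
    Continuous (momentIntegrand A ξ₀ t ξ α η k) := by
  have := continuous_sstDensity A ξ₀ t ξ α η
  unfold momentIntegrand; fun_prop

lemma norm_momentIntegrand (A ξ₀ t ξ α η : ℝ) (k : ℕ) (y : ℂ × ℂ) :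
    ‖momentIntegrand A ξ₀ t ξ α η k y‖ = absMomentIntegrand A ξ₀ t ξ α η k y := by
  have := sstDensity_nonneg A ξ₀ t ξ α η y
  rw [momentIntegrand, absMomentIntegrand, norm_mul, Complex.norm_real, norm_pow,
    Real.norm_of_nonneg (by positivity)]
  ring

lemma absMomentIntegrand_le {l L η : ℝ} (h : (noiseParam η).InBox l L) (A ξ₀ t ξ α : ℝ) (k : ℕ)
    (y : ℂ × ℂ) : absMomentIntegrand A ξ₀ t ξ α η k y ≤
      peak l ^ 4 * Real.exp (boxRate L * ‖signalValue A ξ₀ t η‖ ^ 2) *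
        ((‖y.1‖ ^ (k + 2) * Real.exp (-(boxRate L / 2 * ‖y.1‖ ^ 2))) *
          Real.exp (-(k * ‖y.2‖ ^ 2))) := by
  have := fibreDensity_le h (2 * Real.pi * Real.sqrt α) (signalValue A ξ₀ t η)
    (-(2 * Real.pi * Complex.I * (η - ξ)))
    (-(2 * Real.pi * Complex.I * (ξ₀ - η) * signalValue A ξ₀ t η)) y
  unfold absMomentIntegrand sstDensity
  calc _ ≤ peak l ^ 4 * Real.exp (boxRate L * ‖signalValue A ξ₀ t η‖ ^ 2) *
        Real.exp (-(boxRate L / 2 * ‖y.1‖ ^ 2)) *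
        (‖y.1‖ ^ (k + 2) * Real.exp (-(k * ‖y.2‖ ^ 2))) := by gcongr
    _ = _ := by ring

lemma integrable_absMomentIntegrand (A ξ₀ t ξ α : ℝ) {η : ℝ} (hη : 0 < η) {k : ℕ} (hk : 1 ≤ k) :
    Integrable (absMomentIntegrand A ξ₀ t ξ α η k) := by
  obtain ⟨l, L, h⟩ := exists_inBox hη
  have hk' : (0 : ℝ) < k := by exact_mod_cast hk
  refine (integrable_majorant (k + 2) (half_pos (boxRate_pos h.upper_pos)) hk'
    (peak l ^ 4 * Real.exp (boxRate L * ‖signalValue A ξ₀ t η‖ ^ 2))).mono'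
    (continuous_absMomentIntegrand _ _ _ _ _ _ _).aestronglyMeasurable (ae_of_all _ fun y => ?_)
  rw [Real.norm_of_nonneg (absMomentIntegrand_nonneg _ _ _ _ _ _ _ _)]
  exact absMomentIntegrand_le h A ξ₀ t ξ α k y

lemma exists_integral_absMomentIntegrand_le (A ξ₀ t ξ : ℝ) {η : ℝ} (hη : 0 < η) {k : ℕ}
    (hk : 1 ≤ k) : ∃ C, ∀ α, ∫ y, absMomentIntegrand A ξ₀ t ξ α η k y ≤ C := by
  obtain ⟨l, L, h⟩ := exists_inBox hη
  have hk' : (0 : ℝ) < k := by exact_mod_cast hk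
  exact ⟨_, fun α => integral_mono (integrable_absMomentIntegrand A ξ₀ t ξ α hη hk)
    (integrable_majorant (k + 2) (half_pos (boxRate_pos h.upper_pos)) hk' _)
    (absMomentIntegrand_le h A ξ₀ t ξ α k)⟩

/-- As a function of `(√α, y)` the fibre density is continuous and positive up to and including `√α
= 0`. It therefore has a positive minimum on `[0, 1]` times the closed unit ball. -/
lemma exists_le_integral_absMomentIntegrand (A ξ₀ t ξ : ℝ) {η : ℝ} (hη : 0 < η) {k : ℕ}
    (hk : 1 ≤ k) : ∃ c, 0 < c ∧ ∀ α, α < 1 →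
      c ≤ ∫ y, absMomentIntegrand A ξ₀ t ξ α η k y := by
  obtain ⟨l, L, h⟩ := exists_inBox hη
  set S : Set (ℂ × ℂ) := Metric.closedBall 0 1 with hS
  have hSc : IsCompact S := isCompact_closedBall _ _
  let F : ℝ × (ℂ × ℂ) → ℝ := fun q => fibreDensity (noiseParam η) (2 * Real.pi * q.1)
    (signalValue A ξ₀ t η) (-(2 * Real.pi * Complex.I * (η - ξ)))
    (-(2 * Real.pi * Complex.I * (ξ₀ - η) * signalValue A ξ₀ t η)) q.2
  have hF : Continuous F := by
    simp only [F, fibreDensity]; fun_prop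
  obtain ⟨q, hq, hmin⟩ := (isCompact_Icc.prod hSc).exists_isMinOn
    (⟨(0, 0), ⟨by simp, by simp [hS]⟩⟩ : (Icc (0 : ℝ) 1 ×ˢ S).Nonempty) hF.continuousOn
  have hpos : 0 < F q := noiseDensity_pos h _ _
  let u : ℂ × ℂ → ℝ := fun y => ‖y.1‖ ^ (k + 2) * Real.exp (-(k * ‖y.2‖ ^ 2))
  have hu : Continuous u := by simp only [u]; fun_prop
  have hui : IntegrableOn u S := hu.continuousOn.integrableOn_compact hSc
  have hupos : 0 < ∫ y in S, u y := by
    rw [setIntegral_pos_iff_support_of_nonneg_ae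
      (ae_of_all _ fun y => by simp only [u, Pi.zero_apply]; positivity) hui]
    -- The weight vanishes where `y.1 = 0`; a small ball around `(1/2, 0)` stays away from that set
    -- and inside `S`.
    have hsub : Metric.ball ((1 / 2 : ℂ), (0 : ℂ)) (1 / 4) ⊆ Function.support u ∩ S := by
      intro y hy
      rw [← ball_prod_same] at hy
      obtain ⟨h1, h2⟩ := hy
      rw [Metric.mem_ball, dist_eq_norm] at h1 h2
      have hn : ‖(1 / 2 : ℂ)‖ = 1 / 2 := by simp
      have h3 : ‖y.1‖ ≤ ‖y.1 - 1 / 2‖ + ‖(1 / 2 : ℂ)‖ := by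
        simpa using norm_add_le (y.1 - 1 / 2) (1 / 2)
      have h4 : ‖(1 / 2 : ℂ)‖ ≤ ‖y.1 - 1 / 2‖ + ‖y.1‖ := by
        have := norm_sub_le y.1 (y.1 - 1 / 2)
        rw [sub_sub_cancel] at this
        linarith
      rw [sub_zero] at h2
      refine ⟨?_, ?_⟩
      · rw [Function.mem_support]
        have : 0 < ‖y.1‖ := by linarith
        simp only [u]
        positivity
      · rw [hS, mem_closedBall_zero_iff, Prod.norm_def]
        exact max_le (by linarith) (by linarith)
    exact (Metric.measure_ball_pos _ _ (by norm_num)).trans_le (measure_mono hsub)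
  refine ⟨F q * ∫ y in S, u y, mul_pos hpos hupos, fun α hα => ?_⟩
  have hint := integrable_absMomentIntegrand A ξ₀ t ξ α hη hk
  calc F q * ∫ y in S, u y = ∫ y in S, F q * u y := by rw [integral_const_mul]
    _ ≤ ∫ y in S, absMomentIntegrand A ξ₀ t ξ α η k y := by
        refine setIntegral_mono_on (hui.const_mul _) hint.integrableOn
          Metric.isClosed_closedBall.measurableSet fun y hy => ?_
        have hm : F q ≤ F (Real.sqrt α, y) := by
          refine hmin ⟨⟨Real.sqrt_nonneg _, ?_⟩, hy⟩
          exact Real.sqrt_le_one.2 hα.le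
        have : 0 ≤ u y := by simp only [u]; positivity
        exact mul_le_mul_of_nonneg_right hm this
    _ ≤ _ := setIntegral_le_integral hint
        (ae_of_all _ fun y => absMomentIntegrand_nonneg _ _ _ _ _ _ _ _)

/-! ### Vanishing of odd moments without signal. -/

lemma noiseDensity_neg (θ : NoiseParam) (z m : ℂ) :
    noiseDensity θ (-z) (-m) = noiseDensity θ z m := by
  have e : ∀ v x, gaussDensity v (-x) = gaussDensity v x := by
    intro v x; rw [gaussDensity, gaussDensity, neg_sq]
  unfold noiseDensity
  rw [← e θ.zre z.re, ← e θ.zim z.im, ← e θ.mim (m.im - θ.slopeIm * z.re),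
    ← e θ.mre (m.re - θ.slopeRe * z.im)]
  simp only [Complex.neg_re, Complex.neg_im]
  ring_nf

lemma signalValue_zero (ξ₀ t η : ℝ) : signalValue 0 ξ₀ t η = 0 := by simp [signalValue]

lemma sstDensity_neg (ξ₀ t ξ α η : ℝ) (y : ℂ × ℂ) :
    sstDensity 0 ξ₀ t ξ α η (-y) = sstDensity 0 ξ₀ t ξ α η y := by
  rw [sstDensity, fibreDensity, fibreDensity, signalValue_zero, ← noiseDensity_neg]
  congr 1
  · simp
  · simp; ring

/-- Without signal the fibre density is even in `(V, w)`, while `V ^ k` is odd. -/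
lemma integral_momentIntegrand_odd (ξ₀ t ξ α η : ℝ) {k : ℕ} (hk : Odd k) :
    ∫ y, momentIntegrand 0 ξ₀ t ξ α η k y = 0 := by
  have h := Measure.integral_comp_smul ((volume : Measure ℂ).prod volume)
    (momentIntegrand 0 ξ₀ t ξ α η k) (-1)
  simp only [neg_smul, one_smul, abs_inv, abs_pow, abs_neg, abs_one, one_pow, inv_one,
    ← Measure.volume_eq_prod] at h
  have e : ∀ y, momentIntegrand 0 ξ₀ t ξ α η k (-y) = -momentIntegrand 0 ξ₀ t ξ α η k y := by
    intro y
    rw [momentIntegrand, momentIntegrand, sstDensity_neg, Prod.fst_neg, Prod.snd_neg, hk.neg_pow,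
      norm_neg, norm_neg, mul_neg]
  simp_rw [e, integral_neg] at h
  exact self_eq_neg.1 h.symm

/-! ### Large `η`: comparison with the circular law. -/

lemma pseudoDecay_mul_exp (η : ℝ) :
    pseudoDecay η * Real.exp (4 * Real.pi ^ 2 * η ^ 2) = 1 := by
  rw [pseudoDecay, ← Real.exp_add]; simp

lemma phase_large {η : ℝ} (hη : 1 ≤ η) : 36 ≤ 4 * Real.pi ^ 2 * η ^ 2 := by
  have h1 := Real.pi_gt_three
  have h2 : 9 ≤ Real.pi ^ 2 := by nlinarith
  have h3 : 1 ≤ η ^ 2 := by nlinarith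
  nlinarith

/-- From `1 + x + x²/2 ≤ eˣ` one gets `x e^{-x} ≤ 2/x`, and here `x ≥ 36`. -/
lemma phase_mul_pseudoDecay_le {η : ℝ} (hη : 1 ≤ η) :
    4 * Real.pi ^ 2 * η ^ 2 * pseudoDecay η ≤ 1 / 18 := by
  have hx := phase_large hη
  have h1 := pseudoDecay_mul_exp η
  have h0 := pseudoDecay_pos η
  generalize 4 * Real.pi ^ 2 * η ^ 2 = x at *
  generalize pseudoDecay η = e at *
  have h2 := Real.quadratic_le_exp_of_nonneg (show 0 ≤ x by linarith)
  have h3 : e * (1 + x + x ^ 2 / 2) ≤ 1 := by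
    exact (mul_le_mul_of_nonneg_left h2 h0.le).trans_eq h1
  nlinarith [mul_pos h0 (show 0 < x by linarith),
    mul_le_mul_of_nonneg_left hx (mul_pos h0 (show 0 < x by linarith)).le]

lemma pseudoDecay_le {η : ℝ} (hη : 1 ≤ η) : pseudoDecay η ≤ 1 / 18 := by
  have h1 := phase_mul_pseudoDecay_le hη
  have h2 := phase_large hη
  nlinarith [pseudoDecay_pos η]

lemma two_pi_mul_le_phase {η : ℝ} (hη : 1 ≤ η) :
    2 * Real.pi * η ≤ 4 * Real.pi ^ 2 * η ^ 2 := by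
  have h1 := Real.pi_gt_three
  have : 1 ≤ 2 * Real.pi * η := by nlinarith
  nlinarith

/-- The parameters of the circular Gaussian law that is approached as `η → ∞`. -/
noncomputable def circularParam : NoiseParam where
  zre := windowEnergy / 2
  zim := windowEnergy / 2
  mim := windowEnergy / 4
  mre := windowEnergy / 4
  slopeIm := 0
  slopeRe := 0

lemma circularParam_inBox : circularParam.InBox (windowEnergy / 8) (windowEnergy + 1) := by
  have := windowEnergy_pos
  constructor <;> simp [circularParam] <;> linarith

/-- All parameters differ by at most `ε`. -/
structure NoiseParam.Close (θ θ' : NoiseParam) (ε : ℝ) : Prop where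
  zre : |θ.zre - θ'.zre| ≤ ε
  zim : |θ.zim - θ'.zim| ≤ ε
  mim : |θ.mim - θ'.mim| ≤ ε
  mre : |θ.mre - θ'.mre| ≤ ε
  slopeIm : |θ.slopeIm - θ'.slopeIm| ≤ ε
  slopeRe : |θ.slopeRe - θ'.slopeRe| ≤ ε

/-- With `x = 4π²η²` and `e = exp(-x)`, each parameter differs from its circular value by a
combination of `e` and `x e`, with denominators `1 ± e` bounded below. For `η ≥ 1` both quantities
are at most `1/18`, so one box serves all such `η`; this gives the uniformity in `ξ₀ ≥ 1` later. -/
lemma noiseParam_inBox {η : ℝ} (hη : 1 ≤ η) :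
    (noiseParam η).InBox (windowEnergy / 8) (windowEnergy + 1) ∧
    (noiseParam η).Close circularParam
      ((windowEnergy + 2) * ((1 + 4 * Real.pi ^ 2 * η ^ 2) * pseudoDecay η)) := by
  have hE := windowEnergy_pos
  have hx := phase_large hη
  have h0 := pseudoDecay_pos η
  have h1 := phase_mul_pseudoDecay_le hη
  have h2 := pseudoDecay_le hη
  have h3 := two_pi_mul_le_phase hη
  have h4 : 0 < 2 * Real.pi * η := by have := Real.pi_pos; positivity
  have s1 : 2 * Real.pi * η * pseudoDecay η / (1 + pseudoDecay η) ≤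
      4 * Real.pi ^ 2 * η ^ 2 * pseudoDecay η := by
    rw [div_le_iff₀ (by linarith)]
    nlinarith [mul_pos h4 h0]
  have s2 : 2 * Real.pi * η * pseudoDecay η / (1 - pseudoDecay η) ≤
      2 * (4 * Real.pi ^ 2 * η ^ 2 * pseudoDecay η) := by
    rw [div_le_iff₀ (by linarith)]
    nlinarith [mul_pos h4 h0, mul_pos (show 0 < 4 * Real.pi ^ 2 * η ^ 2 by linarith) h0]
  have s1' : 0 ≤ 2 * Real.pi * η * pseudoDecay η / (1 + pseudoDecay η) := by positivity
  have s2' : 0 ≤ 2 * Real.pi * η * pseudoDecay η / (1 - pseudoDecay η) :=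
    div_nonneg (by positivity) (by linarith)
  have t1 : 4 * Real.pi ^ 2 * η ^ 2 * pseudoDecay η / (1 + pseudoDecay η) ≤
      4 * Real.pi ^ 2 * η ^ 2 * pseudoDecay η := div_le_self (by positivity) (by linarith)
  have t1' : 0 ≤ 4 * Real.pi ^ 2 * η ^ 2 * pseudoDecay η / (1 + pseudoDecay η) := by positivity
  have t2 : 4 * Real.pi ^ 2 * η ^ 2 * pseudoDecay η / (1 - pseudoDecay η) ≤
      2 * (4 * Real.pi ^ 2 * η ^ 2 * pseudoDecay η) := by
    rw [div_le_iff₀ (by linarith)]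
    nlinarith [mul_pos (show 0 < 4 * Real.pi ^ 2 * η ^ 2 by linarith) h0]
  have t2' : 0 ≤ 4 * Real.pi ^ 2 * η ^ 2 * pseudoDecay η / (1 - pseudoDecay η) :=
    div_nonneg (by positivity) (by linarith)
  rw [show (1 + 4 * Real.pi ^ 2 * η ^ 2) * pseudoDecay η =
    pseudoDecay η + 4 * Real.pi ^ 2 * η ^ 2 * pseudoDecay η by ring]
  simp only [noiseParam, circularParam]
  generalize 2 * Real.pi * η * pseudoDecay η / (1 + pseudoDecay η) = S1 at *
  generalize 2 * Real.pi * η * pseudoDecay η / (1 - pseudoDecay η) = S2 at *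
  generalize 4 * Real.pi ^ 2 * η ^ 2 * pseudoDecay η / (1 + pseudoDecay η) = T1 at *
  generalize 4 * Real.pi ^ 2 * η ^ 2 * pseudoDecay η / (1 - pseudoDecay η) = T2 at *
  generalize 4 * Real.pi ^ 2 * η ^ 2 * pseudoDecay η = q at *
  generalize pseudoDecay η = e at *
  have hq : 0 ≤ q := by linarith
  have Eq : 0 ≤ windowEnergy * q := by positivity
  have Ee : 0 ≤ windowEnergy * e := by positivity
  have ET1 : windowEnergy * T1 ≤ windowEnergy * q := by gcongr
  have ET1' : 0 ≤ windowEnergy * T1 := by positivity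
  have ET2 : windowEnergy * T2 ≤ 2 * (windowEnergy * q) := by
    calc _ ≤ windowEnergy * (2 * q) := by gcongr
      _ = _ := by ring
  have ET2' : 0 ≤ windowEnergy * T2 := by positivity
  have Eq2 : windowEnergy * q ≤ windowEnergy * (1 / 18) := by gcongr
  have Ee2 : windowEnergy * e ≤ windowEnergy * (1 / 18) := by gcongr
  constructor
  · constructor
    any_goals simp only [abs_neg, abs_of_nonneg s1', abs_of_nonneg s2']
    all_goals linarith
  · constructor
    all_goals rw [abs_le]
    all_goals constructor
    all_goals linarith

lemma gaussDensity_deriv (v x : ℝ) :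
    HasDerivAt (gaussDensity v) (-(x / v) * gaussDensity v x) x := by
  have h : HasDerivAt (fun x : ℝ => -(x ^ 2 / (2 * v))) (-(x / v)) x := by
    refine (((hasDerivAt_id x).pow 2).div_const (2 * v)).neg.congr_deriv ?_
    simp only [id, Nat.cast_ofNat, mul_one]
    rcases eq_or_ne v 0 with rfl | hv
    · simp
    · field_simp; norm_num
  refine ((h.exp).const_mul (Real.sqrt (2 * Real.pi * v))⁻¹).congr_deriv ?_
  rw [gaussDensity]; ring

lemma gaussDensity_deriv_var {v : ℝ} (hv : 0 < v) (x : ℝ) :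
    HasDerivAt (fun v => gaussDensity v x)
      ((x ^ 2 / (2 * v ^ 2) - 1 / (2 * v)) * gaussDensity v x) v := by
  have hp := Real.pi_pos
  have hs := Real.sqrt_pos.2 (show 0 < 2 * Real.pi * v by positivity)
  have h1 : HasDerivAt (fun v : ℝ => -(x ^ 2 / (2 * v))) (x ^ 2 / (2 * v ^ 2)) v := by
    have := ((hasDerivAt_const v (x ^ 2)).div ((hasDerivAt_id v).const_mul 2)
      (by simpa using hv.ne')).neg
    refine this.congr_deriv ?_
    simp only [id]
    field_simp
    ring
  have h2 : HasDerivAt (fun v : ℝ => (Real.sqrt (2 * Real.pi * v))⁻¹)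
      (-(1 / (2 * v)) * (Real.sqrt (2 * Real.pi * v))⁻¹) v := by
    have := (((hasDerivAt_id v).const_mul (2 * Real.pi)).sqrt (by simp only [id]; positivity)).inv
      (by simp only [id]; exact hs.ne')
    refine this.congr_deriv ?_
    simp only [id]
    have hsq := Real.sq_sqrt (show 0 ≤ 2 * Real.pi * v by positivity)
    field_simp
    rw [hsq]
  refine (h2.mul h1.exp).congr_deriv ?_
  rw [gaussDensity]; ring

lemma exists_sq_mul_exp_le {L : ℝ} (hL : 0 < L) : ∃ C, 0 ≤ C ∧ ∀ x : ℝ,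
    (1 + |x| + x ^ 2) * Real.exp (-(x ^ 2 / (2 * L))) ≤ C * Real.exp (-(x ^ 2 / (4 * L))) := by
  have hκ : 0 < (4 * L)⁻¹ := by positivity
  obtain ⟨C1, h1, H1⟩ := pow_mul_exp_le 1 hκ
  obtain ⟨C2, h2, H2⟩ := pow_mul_exp_le 2 hκ
  refine ⟨1 + C1 + C2, by positivity, fun x => ?_⟩
  have e : Real.exp (-(x ^ 2 / (2 * L))) =
      Real.exp (-((4 * L)⁻¹ * |x| ^ 2)) * Real.exp (-(x ^ 2 / (4 * L))) := by
    rw [← Real.exp_add, sq_abs]; congr 1; field_simp; ring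
  rw [e, ← mul_assoc]
  refine mul_le_mul_of_nonneg_right ?_ (Real.exp_pos _).le
  have a1 := H1 |x| (abs_nonneg x)
  have a2 := H2 |x| (abs_nonneg x)
  have a0 : Real.exp (-((4 * L)⁻¹ * |x| ^ 2)) ≤ 1 := by
    rw [Real.exp_le_one_iff, neg_nonpos]; positivity
  rw [← sq_abs x] 
  rw [pow_one] at a1
  linarith

/-- Mean value inequality along the segment. The bound `D` on the exponential is left free because
it is used both with a decaying value, for bounded shifts, and with `D = 1`, for a plain Lipschitz
estimate. -/
lemma gaussDensity_sub_le {l L : ℝ} (hl : 0 < l) (hL : 0 < L) : ∃ C, 0 ≤ C ∧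
    ∀ v, l ≤ v → v ≤ L → ∀ D : ℝ, ∀ x x' : ℝ,
      (∀ ζ ∈ segment ℝ x' x, Real.exp (-(ζ ^ 2 / (4 * L))) ≤ D) →
      |gaussDensity v x - gaussDensity v x'| ≤ C * D * |x - x'| := by
  obtain ⟨C, hC, H⟩ := exists_sq_mul_exp_le hL
  have hp := (peak_pos hl).le
  refine ⟨l⁻¹ * peak l * C, by positivity, fun v h1 h2 D x x' hD => ?_⟩
  have hv : 0 < v := hl.trans_le h1
  have := (convex_segment x' x).norm_image_sub_le_of_norm_hasDerivWithin_le
    (f := gaussDensity v) (f' := fun ζ => -(ζ / v) * gaussDensity v ζ) (C := l⁻¹ * peak l * C * D)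
    (fun ζ _ => (gaussDensity_deriv v ζ).hasDerivWithinAt) (fun ζ hζ => ?_)
    (left_mem_segment ℝ x' x) (right_mem_segment ℝ x' x)
  · exact this
  · rw [norm_mul, norm_neg, norm_div, Real.norm_of_nonneg (gaussDensity_nonneg _ _),
      Real.norm_of_nonneg hv.le, Real.norm_eq_abs]
    calc |ζ| / v * gaussDensity v ζ
        ≤ (1 + |ζ| + ζ ^ 2) / l * (peak l * Real.exp (-(ζ ^ 2 / (2 * L)))) := by
          have := gaussDensity_le hl h1 h2 ζ
          have := gaussDensity_nonneg v ζ
          gcongr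
          linarith [sq_nonneg ζ]
      _ = l⁻¹ * peak l * ((1 + |ζ| + ζ ^ 2) * Real.exp (-(ζ ^ 2 / (2 * L)))) := by ring
      _ ≤ l⁻¹ * peak l * (C * Real.exp (-(ζ ^ 2 / (4 * L)))) :=
          mul_le_mul_of_nonneg_left (H ζ) (by positivity)
      _ ≤ l⁻¹ * peak l * (C * D) := by
          have := hD ζ hζ
          gcongr
      _ = _ := by ring

lemma gaussDensity_var_sub_le {l L : ℝ} (hl : 0 < l) (hL : 0 < L) : ∃ C, 0 ≤ C ∧
    ∀ v v', l ≤ v → v ≤ L → l ≤ v' → v' ≤ L → ∀ x : ℝ,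
      |gaussDensity v x - gaussDensity v' x| ≤ C * Real.exp (-(x ^ 2 / (4 * L))) * |v - v'| := by
  obtain ⟨C, hC, H⟩ := exists_sq_mul_exp_le hL
  have hp := (peak_pos hl).le
  refine ⟨(l⁻¹ ^ 2 + l⁻¹) * peak l * C, by positivity, fun v v' h1 h2 h1' h2' x => ?_⟩
  have := (convex_Icc l L).norm_image_sub_le_of_norm_hasDerivWithin_le
    (f := fun v => gaussDensity v x)
    (f' := fun v => (x ^ 2 / (2 * v ^ 2) - 1 / (2 * v)) * gaussDensity v x)
    (C := (l⁻¹ ^ 2 + l⁻¹) * peak l * C * Real.exp (-(x ^ 2 / (4 * L))))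
    (fun u hu => (gaussDensity_deriv_var (hl.trans_le hu.1) x).hasDerivWithinAt) (fun u hu => ?_)
    (show v' ∈ Icc l L from ⟨h1', h2'⟩) (show v ∈ Icc l L from ⟨h1, h2⟩)
  · exact this
  · have hu0 : 0 < u := hl.trans_le hu.1
    rw [norm_mul, Real.norm_of_nonneg (gaussDensity_nonneg _ _)]
    have hn : ‖x ^ 2 / (2 * u ^ 2) - 1 / (2 * u)‖ ≤ (l⁻¹ ^ 2 + l⁻¹) * (1 + |x| + x ^ 2) := by
      have b1 : x ^ 2 / (2 * u ^ 2) ≤ l⁻¹ ^ 2 * x ^ 2 := by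
        rw [inv_pow, inv_mul_eq_div]
        have := hu.1
        gcongr
        nlinarith [sq_nonneg u]
      have b2 : 1 / (2 * u) ≤ l⁻¹ := by
        rw [← one_div]
        have := hu.1
        gcongr
        linarith
      have b3 : 0 ≤ x ^ 2 / (2 * u ^ 2) := by positivity
      have b4 : 0 ≤ 1 / (2 * u) := by positivity
      have b5 : 0 ≤ l⁻¹ := by positivity
      have b6 := sq_nonneg x
      have b7 := abs_nonneg x
      have b8 : 0 ≤ l⁻¹ ^ 2 := by positivity
      rw [Real.norm_eq_abs, abs_le]
      constructor <;> nlinarith [mul_nonneg b5 b6, mul_nonneg b5 b7, mul_nonneg b8 b7]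
    calc ‖x ^ 2 / (2 * u ^ 2) - 1 / (2 * u)‖ * gaussDensity u x
        ≤ ((l⁻¹ ^ 2 + l⁻¹) * (1 + |x| + x ^ 2)) * (peak l * Real.exp (-(x ^ 2 / (2 * L)))) := by
          have := gaussDensity_le hl hu.1 hu.2 x
          have := gaussDensity_nonneg u x
          gcongr
      _ = (l⁻¹ ^ 2 + l⁻¹) * peak l * ((1 + |x| + x ^ 2) * Real.exp (-(x ^ 2 / (2 * L)))) := by ring
      _ ≤ (l⁻¹ ^ 2 + l⁻¹) * peak l * (C * Real.exp (-(x ^ 2 / (4 * L)))) :=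
          mul_le_mul_of_nonneg_left (H x) (by positivity)
      _ = _ := by ring

/-- A shift of size at most `R` costs half of the exponential rate, by `x² ≤ 2ζ² + 2R²`; this
explains `8L` in place of `4L`. -/
lemma gaussDensity_shift_sub_le {l L R : ℝ} (hl : 0 < l) (hL : 0 < L) (hR : 0 ≤ R) : ∃ C, 0 ≤ C ∧
    ∀ v v', l ≤ v → v ≤ L → l ≤ v' → v' ≤ L → ∀ x u : ℝ, |u| ≤ R →
      gaussDensity v (x - u) ≤ C * Real.exp (-(x ^ 2 / (8 * L))) ∧
      gaussDensity v' x ≤ C * Real.exp (-(x ^ 2 / (8 * L))) ∧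
      |gaussDensity v (x - u) - gaussDensity v' x| ≤
        C * (|v - v'| + |u|) * Real.exp (-(x ^ 2 / (8 * L))) := by
  obtain ⟨C1, h1, H1⟩ := gaussDensity_sub_le hl hL
  obtain ⟨C2, h2, H2⟩ := gaussDensity_var_sub_le hl hL
  have hp := (peak_pos hl).le
  set K := Real.exp (R ^ 2 / (4 * L)) with hK
  have hK0 : 0 < K := Real.exp_pos _
  have hK1 : 1 ≤ K := Real.one_le_exp (by positivity)
  have key : ∀ x ζ : ℝ, |x - ζ| ≤ R →
      Real.exp (-(ζ ^ 2 / (4 * L))) ≤ K * Real.exp (-(x ^ 2 / (8 * L))) := by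
    intro x ζ h
    rw [hK, ← Real.exp_add, Real.exp_le_exp]
    have h3 : (x - ζ) ^ 2 ≤ R ^ 2 := by
      rw [← sq_abs]; exact pow_le_pow_left₀ (abs_nonneg _) h 2
    have h4 : x ^ 2 ≤ 2 * ζ ^ 2 + 2 * R ^ 2 := by nlinarith [sq_nonneg (x - 2 * ζ)]
    have e : R ^ 2 / (4 * L) + -(x ^ 2 / (8 * L)) + ζ ^ 2 / (4 * L) =
        (2 * ζ ^ 2 + 2 * R ^ 2 - x ^ 2) / (8 * L) := by field_simp; ring
    have : 0 ≤ (2 * ζ ^ 2 + 2 * R ^ 2 - x ^ 2) / (8 * L) := div_nonneg (by linarith) (by positivity)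
    linarith
  have weak : ∀ ζ : ℝ, Real.exp (-(ζ ^ 2 / (2 * L))) ≤ Real.exp (-(ζ ^ 2 / (4 * L))) := by
    intro ζ
    rw [Real.exp_le_exp, neg_le_neg_iff]
    gcongr
    norm_num
  refine ⟨peak l * K + C1 * K + C2 * K, by positivity, ?_⟩
  intro v v' a1 a2 a3 a4 x u hu
  set D := Real.exp (-(x ^ 2 / (8 * L))) with hD
  have hD0 : 0 < D := Real.exp_pos _
  have n1 : 0 ≤ peak l * K * D := by positivity
  have n2 : 0 ≤ C1 * K * D := by positivity
  have n3 : 0 ≤ C2 * K * D := by positivity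
  have kx : Real.exp (-(x ^ 2 / (4 * L))) ≤ K * D := key x x (by simpa using hR)
  refine ⟨?_, ?_, ?_⟩
  · have : gaussDensity v (x - u) ≤ peak l * (K * D) :=
      (gaussDensity_le hl a1 a2 (x - u)).trans
        (mul_le_mul_of_nonneg_left ((weak _).trans (key x (x - u) (by simpa using hu))) hp)
    linarith
  · have : gaussDensity v' x ≤ peak l * (K * D) :=
      (gaussDensity_le hl a3 a4 x).trans (mul_le_mul_of_nonneg_left ((weak _).trans kx) hp)
    linarith
  · have b1 : |gaussDensity v (x - u) - gaussDensity v x| ≤ C1 * (K * D) * |u| := by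
      have := H1 v a1 a2 (K * D) (x - u) x (fun ζ hζ => key x ζ ?_)
      · simpa using this
      · rw [segment_eq_uIcc] at hζ
        have h5 := abs_sub_left_of_mem_uIcc hζ
        have h6 : |x - u - x| = |u| := by rw [sub_sub_cancel_left, abs_neg]
        rw [abs_sub_comm]
        linarith
    have b2 : |gaussDensity v x - gaussDensity v' x| ≤ C2 * (K * D) * |v - v'| := by
      refine (H2 v v' a1 a2 a3 a4 x).trans ?_
      gcongr
    have b3 := abs_sub_le (gaussDensity v (x - u)) (gaussDensity v x) (gaussDensity v' x)
    have p1 := mul_nonneg n1 (abs_nonneg u)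
    have p2 := mul_nonneg n1 (abs_nonneg (v - v'))
    have p3 := mul_nonneg n2 (abs_nonneg (v - v'))
    have p4 := mul_nonneg n3 (abs_nonneg u)
    nlinarith

lemma gaussDensity_lipschitz {l L : ℝ} (hl : 0 < l) (hL : 0 < L) : ∃ C, 0 ≤ C ∧
    ∀ v v', l ≤ v → v ≤ L → l ≤ v' → v' ≤ L → ∀ x x' : ℝ,
      gaussDensity v x ≤ C ∧ |gaussDensity v x - gaussDensity v' x'| ≤
        C * (|v - v'| + |x - x'|) := by
  obtain ⟨C1, h1, H1⟩ := gaussDensity_sub_le hl hL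
  obtain ⟨C2, h2, H2⟩ := gaussDensity_var_sub_le hl hL
  have hp := (peak_pos hl).le
  have one : ∀ x : ℝ, Real.exp (-(x ^ 2 / (4 * L))) ≤ 1 := fun x => by
    rw [Real.exp_le_one_iff, neg_nonpos]; positivity
  refine ⟨peak l + C1 + C2, by positivity, fun v v' a1 a2 a3 a4 x x' => ⟨?_, ?_⟩⟩
  · linarith [gaussDensity_le_peak hl a1 x]
  · have b1 := H1 v a1 a2 1 x x' (fun ζ _ => one ζ)
    have b2 : |gaussDensity v x' - gaussDensity v' x'| ≤ C2 * 1 * |v - v'| := by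
      refine (H2 v v' a1 a2 a3 a4 x').trans ?_
      have := one x'
      gcongr
    have b3 := abs_sub_le (gaussDensity v x) (gaussDensity v x') (gaussDensity v' x')
    have p1 := abs_nonneg (v - v')
    have p2 := abs_nonneg (x - x')
    nlinarith [mul_nonneg hp p1, mul_nonneg hp p2, mul_nonneg h1 p1, mul_nonneg h2 p2]

lemma abs_mul_sub_mul_le {a b a' b' A B α β : ℝ} (hb : |b| ≤ B) (ha' : |a'| ≤ A)
    (h1 : |a - a'| ≤ α) (h2 : |b - b'| ≤ β) : |a * b - a' * b'| ≤ α * B + A * β := by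
  have e : a * b - a' * b' = (a - a') * b + a' * (b - b') := by ring
  rw [e]
  refine (abs_add_le _ _).trans ?_
  rw [abs_mul, abs_mul]
  have := (abs_nonneg _).trans h1
  have := (abs_nonneg _).trans ha'
  gcongr

/-- The two factors in `z` are compared with Gaussian decay in `V`, the two factors in `m` only in
the Lipschitz sense, since no decay in `m` is needed. A change of slope is multiplied by a component
of `V`, whence the factor `1 + ‖V‖`. -/
lemma noiseDensity_sub_le {l L R : ℝ} (hl : 0 < l) (hL : 0 < L) (hR : 0 ≤ R) : ∃ C, 0 ≤ C ∧
    ∀ θ θ' : NoiseParam, θ.InBox l L → θ'.InBox l L → ∀ ε, θ.Close θ' ε → ∀ V v m b : ℂ, ‖v‖ ≤ R →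
      |noiseDensity θ (V - v) (m + b) - noiseDensity θ' V m| ≤
        C * (ε + ‖v‖ + ‖b‖) * ((1 + ‖V‖) * Real.exp (-((8 * L)⁻¹ * ‖V‖ ^ 2))) := by
  obtain ⟨C1, h1, H1⟩ := gaussDensity_shift_sub_le hl hL hR
  obtain ⟨C2, h2, H2⟩ := gaussDensity_lipschitz hl hL
  refine ⟨2 * C1 ^ 2 * C2 ^ 2 + 2 * C1 ^ 2 * (C2 ^ 2 * (2 + L)), by positivity, ?_⟩
  intro θ θ' B B' ε hc V v m b hv
  have hre : |v.re| ≤ ‖v‖ := Complex.abs_re_le_norm v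
  have him : |v.im| ≤ ‖v‖ := Complex.abs_im_le_norm v
  have hbre : |b.re| ≤ ‖b‖ := Complex.abs_re_le_norm b
  have hbim : |b.im| ≤ ‖b‖ := Complex.abs_im_le_norm b
  have hVre : |V.re| ≤ ‖V‖ := Complex.abs_re_le_norm V
  have hVim : |V.im| ≤ ‖V‖ := Complex.abs_im_le_norm V
  have hε : 0 ≤ ε := (abs_nonneg _).trans hc.zre
  set δ := ε + ‖v‖ + ‖b‖ with hδ
  have hδ0 : 0 ≤ δ := by positivity
  obtain ⟨f1, f1', d1⟩ := H1 θ.zre θ'.zre B.le_zre B.zre_le B'.le_zre B'.zre_le V.re v.re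
    (hre.trans hv)
  obtain ⟨f2, f2', d2⟩ := H1 θ.zim θ'.zim B.le_zim B.zim_le B'.le_zim B'.zim_le V.im v.im
    (him.trans hv)
  obtain ⟨f3, d3⟩ := H2 θ.mim θ'.mim B.le_mim B.mim_le B'.le_mim B'.mim_le
    ((m + b).im - θ.slopeIm * (V - v).re) (m.im - θ'.slopeIm * V.re)
  obtain ⟨f4, d4⟩ := H2 θ.mre θ'.mre B.le_mre B.mre_le B'.le_mre B'.mre_le
    ((m + b).re - θ.slopeRe * (V - v).im) (m.re - θ'.slopeRe * V.im)
  have f3' := (H2 θ'.mim θ'.mim B'.le_mim B'.mim_le B'.le_mim B'.mim_le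
    (m.im - θ'.slopeIm * V.re) 0).1
  have slope : ∀ s s' x u c y : ℝ, |s| ≤ L → |s - s'| ≤ ε → |x| ≤ ‖V‖ → |u| ≤ ‖v‖ → |c| ≤ ‖b‖ →
      |(y + c - s * (x - u)) - (y - s' * x)| ≤ (1 + L) * δ * (1 + ‖V‖) := by
    intro s s' x u c y q1 q2 q3 q4 q5
    have e : (y + c - s * (x - u)) - (y - s' * x) = c + s * u - (s - s') * x := by ring
    rw [e]
    have t1 : |c + s * u - (s - s') * x| ≤ |c| + |s| * |u| + |s - s'| * |x| := by
      refine (abs_sub _ _).trans ?_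
      rw [abs_mul (s - s')]
      have := abs_add_le c (s * u)
      rw [abs_mul] at this
      linarith
    have t2 : |s| * |u| ≤ L * ‖v‖ := by gcongr
    have t3 : |s - s'| * |x| ≤ ε * ‖V‖ := by gcongr
    have n1 := norm_nonneg V
    have n2 := norm_nonneg v
    have n3 := norm_nonneg b
    have m1 : 0 ≤ (‖v‖ + ‖b‖) * ‖V‖ := by positivity
    have m2 : 0 ≤ L * (ε + ‖b‖ + δ * ‖V‖) := by positivity
    rw [hδ] at m2 ⊢
    nlinarith
  have w3 := slope θ.slopeIm θ'.slopeIm V.re v.re b.im m.im B.slopeIm_le hc.slopeIm hVre hre hbim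
  have w4 := slope θ.slopeRe θ'.slopeRe V.im v.im b.re m.re B.slopeRe_le hc.slopeRe hVim him hbre
  rw [← Complex.add_im, ← Complex.sub_re] at w3
  rw [← Complex.add_re, ← Complex.sub_im] at w4
  rw [← Complex.sub_re] at f1 d1
  rw [← Complex.sub_im] at f2 d2
  set D1 := Real.exp (-(V.re ^ 2 / (8 * L)))
  set D2 := Real.exp (-(V.im ^ 2 / (8 * L)))
  have hD1 : 0 < D1 := Real.exp_pos _
  have hD2 : 0 < D2 := Real.exp_pos _
  have eD : Real.exp (-((8 * L)⁻¹ * ‖V‖ ^ 2)) = D1 * D2 := by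
    rw [← Real.exp_add, Complex.sq_norm, Complex.normSq_apply]
    congr 1
    field_simp
    ring
  have hVn := norm_nonneg V
  have δV : δ ≤ δ * (1 + ‖V‖) := le_mul_of_one_le_right hδ0 (by linarith)
  have vb : 0 ≤ ‖v‖ := norm_nonneg v
  have bb : 0 ≤ ‖b‖ := norm_nonneg b
  have d1' : |gaussDensity θ.zre (V - v).re - gaussDensity θ'.zre V.re| ≤
      C1 * δ * D1 := by
    refine d1.trans ?_
    gcongr
    linarith [hc.zre]
  have d2' : |gaussDensity θ.zim (V - v).im - gaussDensity θ'.zim V.im| ≤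
      C1 * δ * D2 := by
    refine d2.trans ?_
    gcongr
    linarith [hc.zim]
  have d3' : |gaussDensity θ.mim ((m + b).im - θ.slopeIm * (V - v).re) -
      gaussDensity θ'.mim (m.im - θ'.slopeIm * V.re)| ≤ C2 * ((2 + L) * δ * (1 + ‖V‖)) := by
    refine d3.trans (mul_le_mul_of_nonneg_left ?_ h2)
    linarith [hc.mim]
  have d4' : |gaussDensity θ.mre ((m + b).re - θ.slopeRe * (V - v).im) -
      gaussDensity θ'.mre (m.re - θ'.slopeRe * V.im)| ≤ C2 * ((2 + L) * δ * (1 + ‖V‖)) := by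
    refine d4.trans (mul_le_mul_of_nonneg_left ?_ h2)
    linarith [hc.mre]
  have ab : ∀ {v x C : ℝ}, gaussDensity v x ≤ C → |gaussDensity v x| ≤ C := by
    intro v x C h; rwa [abs_of_nonneg (gaussDensity_nonneg v x)]
  have z1 := abs_mul_sub_mul_le (ab f2) (ab f1') d1' d2'
  have m1 := abs_mul_sub_mul_le (ab f4) (ab f3') d3' d4'
  have mprod : |gaussDensity θ.mim ((m + b).im - θ.slopeIm * (V - v).re) *
      gaussDensity θ.mre ((m + b).re - θ.slopeRe * (V - v).im)| ≤ C2 * C2 := by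
    rw [abs_mul]; exact mul_le_mul (ab f3) (ab f4) (abs_nonneg _) h2
  have zprod : |gaussDensity θ'.zre V.re * gaussDensity θ'.zim V.im| ≤ (C1 * D1) * (C1 * D2) := by
    rw [abs_mul]; exact mul_le_mul (ab f1') (ab f2') (abs_nonneg _) (by positivity)
  have fin := abs_mul_sub_mul_le mprod zprod z1 m1
  rw [eD]
  unfold noiseDensity
  refine fin.trans ?_
  have g1 : 0 ≤ C1 ^ 2 * C2 ^ 2 * (D1 * D2) := by positivity
  have g2 := mul_le_mul_of_nonneg_left δV g1
  linarith

lemma noiseDensity_circular (z m : ℂ) : noiseDensity circularParam z m =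
    peak (windowEnergy / 2) ^ 2 * peak (windowEnergy / 4) ^ 2 *
      Real.exp (-(‖z‖ ^ 2 / windowEnergy + 2 * ‖m‖ ^ 2 / windowEnergy)) := by
  have hE := windowEnergy_pos.ne'
  have e : Real.exp (-(‖z‖ ^ 2 / windowEnergy + 2 * ‖m‖ ^ 2 / windowEnergy)) =
      Real.exp (-(z.re ^ 2 / (2 * (windowEnergy / 2)))) *
      Real.exp (-(z.im ^ 2 / (2 * (windowEnergy / 2)))) *
      (Real.exp (-(m.im ^ 2 / (2 * (windowEnergy / 4)))) *
      Real.exp (-(m.re ^ 2 / (2 * (windowEnergy / 4))))) := by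
    rw [← Real.exp_add, ← Real.exp_add, ← Real.exp_add, Complex.sq_norm, Complex.sq_norm,
      Complex.normSq_apply, Complex.normSq_apply]
    congr 1
    field_simp
    ring
  rw [e]
  simp only [noiseDensity, circularParam, gaussDensity, peak, zero_mul, sub_zero]
  ring

/-- The moment integrand of the circular law. -/
noncomputable def circularIntegrand (r : ℝ) (a : ℂ) (k : ℕ) (y : ℂ × ℂ) : ℂ :=
  ((fibreDensity circularParam r 0 a 0 y * (‖y.1‖ ^ 2 * Real.exp (-(k * ‖y.2‖ ^ 2))) : ℝ) : ℂ) *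
    y.1 ^ k

/-- The circular density depends only on `‖z‖` and `‖m‖`, and without shifts the fibre map commutes
with a simultaneous rotation of `V` and `w`. -/
lemma circularIntegrand_rotate (r : ℝ) (a : ℂ) (k : ℕ) {ζ : ℂ} (hζ : ‖ζ‖ = 1) (y : ℂ × ℂ) :
    circularIntegrand r a k (ζ * y.1, ζ * y.2) = ζ ^ k * circularIntegrand r a k y := by
  have h1 : ∀ z : ℂ, ‖ζ * z‖ = ‖z‖ := fun z => by rw [norm_mul, hζ, one_mul]
  have e : ((r * ‖y.1‖ : ℝ) : ℂ) * (ζ * y.2) + (a * (ζ * y.1) + 0) =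
      ζ * (((r * ‖y.1‖ : ℝ) : ℂ) * y.2 + (a * y.1 + 0)) := by ring
  have e2 : fibreDensity circularParam r 0 a 0 (ζ * y.1, ζ * y.2) =
      fibreDensity circularParam r 0 a 0 y := by
    simp only [fibreDensity, noiseDensity_circular, sub_zero, h1]
    rw [e, h1]
  simp only [circularIntegrand]
  rw [e2, h1, h1]
  ring

lemma integral_circularIntegrand (r : ℝ) (a : ℂ) {k : ℕ} (hk : 1 ≤ k) :
    ∫ y, circularIntegrand r a k y = 0 := by
  have hk' : (k : ℂ) ≠ 0 := by exact_mod_cast (by omega : k ≠ 0)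
  -- A rotation with `c ^ k = -1`, so that the integral equals its own negative.
  let c : Circle := Circle.exp (Real.pi / k)
  have hc : (c : ℂ) ^ k = -1 := by
    rw [Circle.coe_exp, ← Complex.exp_nat_mul, ← Complex.exp_pi_mul_I]
    congr 1
    push_cast
    field_simp
  have hp := (rotation c).measurePreserving
  have hpp := hp.prod hp
  have he : MeasurableEmbedding (Prod.map (rotation c) (rotation c)) :=
    ((rotation c).toHomeomorph.prodCongr (rotation c).toHomeomorph).measurableEmbedding
  have h := hpp.integral_comp he (circularIntegrand r a k)
  rw [← Measure.volume_eq_prod] at h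
  have e : ∀ y : ℂ × ℂ, circularIntegrand r a k (Prod.map (rotation c) (rotation c) y) =
      -circularIntegrand r a k y := by
    intro y
    have := circularIntegrand_rotate r a k (ζ := c) (Circle.norm_coe c) y
    rw [hc, neg_one_mul] at this
    exact this
  simp_rw [e, integral_neg] at h
  exact self_eq_neg.1 h.symm

lemma integrable_circularIntegrand (r : ℝ) (a : ℂ) {k : ℕ} (hk : 1 ≤ k) :
    Integrable (circularIntegrand r a k) := by
  have h := circularParam_inBox
  have hk' : (0 : ℝ) < k := by exact_mod_cast hk
  refine (integrable_majorant (k + 2) (half_pos (boxRate_pos h.upper_pos)) hk'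
    (peak (windowEnergy / 8) ^ 4 *
      Real.exp (boxRate (windowEnergy + 1) * ‖(0 : ℂ)‖ ^ 2))).mono'
    (Continuous.aestronglyMeasurable ?_) (ae_of_all _ fun y => ?_)
  · have := continuous_fibreDensity circularParam r 0 a 0
    unfold circularIntegrand; fun_prop
  · have h1 := fibreDensity_le h r 0 a 0 y
    have h2 := fibreDensity_nonneg circularParam r 0 a 0 y
    rw [circularIntegrand, norm_mul, Complex.norm_real, norm_pow,
      Real.norm_of_nonneg (by positivity)]
    calc _ = fibreDensity circularParam r 0 a 0 y *
          (‖y.1‖ ^ (k + 2) * Real.exp (-(k * ‖y.2‖ ^ 2))) := by ring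
      _ ≤ _ * (‖y.1‖ ^ (k + 2) * Real.exp (-(k * ‖y.2‖ ^ 2))) :=
          mul_le_mul_of_nonneg_right h1 (by positivity)
      _ = _ := by ring

lemma integrable_momentIntegrand (A ξ₀ t ξ α : ℝ) {η : ℝ} (hη : 0 < η) {k : ℕ} (hk : 1 ≤ k) :
    Integrable (momentIntegrand A ξ₀ t ξ α η k) :=
  (integrable_absMomentIntegrand A ξ₀ t ξ α hη hk).mono'
    (continuous_momentIntegrand _ _ _ _ _ _ _).aestronglyMeasurable
    (ae_of_all _ fun _ => (norm_momentIntegrand _ _ _ _ _ _ _ _).le)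

/-- For large `η` the moments are controlled by the distance to the circular law. -/
theorem norm_integral_momentIntegrand_le {A : ℝ} (hA : 0 ≤ A) (ξ₀ t ξ : ℝ) {k : ℕ} (hk : 1 ≤ k) :
    ∃ C, 0 ≤ C ∧ ∀ η α, 1 ≤ η → ‖∫ y, momentIntegrand A ξ₀ t ξ α η k y‖ ≤
      C * ((windowEnergy + 2) * ((1 + 4 * Real.pi ^ 2 * η ^ 2) * pseudoDecay η) +
        ‖signalValue A ξ₀ t η‖ +
        ‖-(2 * Real.pi * Complex.I * (ξ₀ - η) * signalValue A ξ₀ t η)‖) := by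
  have hE := windowEnergy_pos
  have hl : 0 < windowEnergy / 8 := by positivity
  have hL : 0 < windowEnergy + 1 := by positivity
  obtain ⟨C, hC, H⟩ := noiseDensity_sub_le hl hL hA
  have hk' : (0 : ℝ) < k := by exact_mod_cast hk
  have hκ : 0 < (8 * (windowEnergy + 1))⁻¹ := by positivity
  have i1 := integrable_majorant (k + 2) hκ hk' 1
  have i2 := integrable_majorant (k + 3) hκ hk' 1
  have n0 : 0 ≤ ∫ y : ℂ × ℂ, (1 * ((‖y.1‖ ^ (k + 2) *
      Real.exp (-((8 * (windowEnergy + 1))⁻¹ * ‖y.1‖ ^ 2))) * Real.exp (-(k * ‖y.2‖ ^ 2))) +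
      1 * ((‖y.1‖ ^ (k + 3) *
      Real.exp (-((8 * (windowEnergy + 1))⁻¹ * ‖y.1‖ ^ 2))) * Real.exp (-(k * ‖y.2‖ ^ 2)))) :=
    integral_nonneg fun y => by positivity
  refine ⟨C * ∫ y : ℂ × ℂ, (1 * ((‖y.1‖ ^ (k + 2) *
      Real.exp (-((8 * (windowEnergy + 1))⁻¹ * ‖y.1‖ ^ 2))) * Real.exp (-(k * ‖y.2‖ ^ 2))) +
      1 * ((‖y.1‖ ^ (k + 3) *
      Real.exp (-((8 * (windowEnergy + 1))⁻¹ * ‖y.1‖ ^ 2))) * Real.exp (-(k * ‖y.2‖ ^ 2)))),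
    mul_nonneg hC n0, fun η α hη => ?_⟩
  obtain ⟨hbox, hclose⟩ := noiseParam_inBox hη
  have hv : ‖signalValue A ξ₀ t η‖ ≤ A := by
    rw [norm_signalValue hA]
    refine mul_le_of_le_one_right hA (Real.exp_le_one_iff.2 ?_)
    rw [neg_nonpos]; positivity
  set v := signalValue A ξ₀ t η with hvdef
  set b := -(2 * Real.pi * Complex.I * (ξ₀ - η) * v) with hb
  set a := -(2 * Real.pi * Complex.I * (η - ξ) : ℂ) with ha
  set r := 2 * Real.pi * Real.sqrt α with hr
  set δ := (windowEnergy + 2) * ((1 + 4 * Real.pi ^ 2 * η ^ 2) * pseudoDecay η) + ‖v‖ + ‖b‖ with hδ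
  -- The circular integrand has integral zero and may be subtracted, with the same `r` and `a`. Only
  -- the parameter error and the shifts `v`, `b` remain, so the bound does not depend on `α`.
  have hsub : ∫ y, momentIntegrand A ξ₀ t ξ α η k y =
      ∫ y, (momentIntegrand A ξ₀ t ξ α η k y - circularIntegrand r a k y) := by
    rw [integral_sub (integrable_momentIntegrand A ξ₀ t ξ α (by linarith) hk)
      (integrable_circularIntegrand r a hk), integral_circularIntegrand r a hk, sub_zero]
  rw [hsub, mul_right_comm, ← integral_const_mul]
  refine norm_integral_le_of_norm_le ((i1.add i2).const_mul _) (ae_of_all _ fun y => ?_)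
  have e : momentIntegrand A ξ₀ t ξ α η k y - circularIntegrand r a k y =
      (((sstDensity A ξ₀ t ξ α η y - fibreDensity circularParam r 0 a 0 y) *
        (‖y.1‖ ^ 2 * Real.exp (-(k * ‖y.2‖ ^ 2))) : ℝ) : ℂ) * y.1 ^ k := by
    rw [momentIntegrand, circularIntegrand]; push_cast; ring
  have hd : |sstDensity A ξ₀ t ξ α η y - fibreDensity circularParam r 0 a 0 y| ≤
      C * δ * ((1 + ‖y.1‖) * Real.exp (-((8 * (windowEnergy + 1))⁻¹ * ‖y.1‖ ^ 2))) := by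
    have := H _ _ hbox circularParam_inBox _ hclose y.1 v
      (((r * ‖y.1‖ : ℝ) : ℂ) * y.2 + (a * y.1 + 0)) b hv
    have e2 : ((r * ‖y.1‖ : ℝ) : ℂ) * y.2 + (a * y.1 + 0) + b =
        ((r * ‖y.1‖ : ℝ) : ℂ) * y.2 + (a * y.1 + b) := by ring
    rw [e2] at this
    simpa only [sstDensity, fibreDensity, sub_zero] using this
  rw [e, norm_mul, Complex.norm_real, norm_pow, norm_mul, Real.norm_eq_abs,
    Real.norm_of_nonneg (show 0 ≤ ‖y.1‖ ^ 2 * Real.exp (-(k * ‖y.2‖ ^ 2)) by positivity)]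
  calc _ ≤ C * δ * ((1 + ‖y.1‖) * Real.exp (-((8 * (windowEnergy + 1))⁻¹ * ‖y.1‖ ^ 2))) *
        (‖y.1‖ ^ 2 * Real.exp (-(k * ‖y.2‖ ^ 2))) * ‖y.1‖ ^ k := by gcongr
    _ = _ := by ring

/-! ### Small `η`: regression on the reassignment numerator. -/

lemma integral_gaussianReal_eq {v : ℝ} (hv : 0 < v) (f : ℝ → ℝ) :
    ∫ x, f x ∂(gaussianReal 0 v.toNNReal) = ∫ x, gaussDensity v x * f x := by
  rw [integral_gaussianReal_eq_integral_smul (by simpa using hv)]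
  congr 1
  funext x
  rw [smul_eq_mul, gaussianPDFReal, gaussDensity, Real.coe_toNNReal v hv.le, sub_zero, neg_div]

lemma integrable_one_add_abs_pow (n : ℕ) (v : NNReal) :
    Integrable (fun x : ℝ => (1 + |x|) ^ n) (gaussianReal 0 v) := by
  have h := memLp_id_gaussianReal' (μ := 0) (v := v) (n : ENNReal) (by simp)
  have h1 : MemLp (fun x : ℝ => 1 + |x|) n (gaussianReal 0 v) := (memLp_const (1 : ℝ)).add h.norm
  have h2 := h1.integrable_norm_pow'
  refine h2.congr (ae_of_all _ fun x => ?_)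
  simp only
  rw [Real.norm_of_nonneg (by positivity)]

lemma exists_gaussian_moment_le (n : ℕ) (L : ℝ) : ∃ C, 0 ≤ C ∧ ∀ v : ℝ, 0 ≤ v → v ≤ L →
    ∫ x, (1 + |x|) ^ n ∂(gaussianReal 0 v.toNNReal) ≤ C := by
  refine ⟨(1 + Real.sqrt L) ^ n * ∫ x, (1 + |x|) ^ n ∂(gaussianReal 0 1), ?_, fun v h0 hv => ?_⟩
  · exact mul_nonneg (by positivity) (integral_nonneg fun x => by positivity)
  have e : gaussianReal 0 v.toNNReal = (gaussianReal 0 1).map (Real.sqrt v * ·) := by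
    rw [gaussianReal_map_const_mul]
    congr 1
    · simp
    · ext; simp [Real.sq_sqrt h0, Real.coe_toNNReal v h0]
  rw [e, integral_map (by fun_prop) (Continuous.aestronglyMeasurable (by fun_prop)),
    ← integral_const_mul]
  refine integral_mono_of_nonneg (ae_of_all _ fun x => by positivity)
    ((integrable_one_add_abs_pow n 1).const_mul _) (ae_of_all _ fun x => ?_)
  simp only
  rw [← mul_pow, abs_mul, abs_of_nonneg (Real.sqrt_nonneg v)]
  have h1 := Real.sqrt_le_sqrt hv
  have h2 := Real.sqrt_nonneg L
  have h3 := Real.sqrt_nonneg v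
  have h4 := abs_nonneg x
  gcongr
  nlinarith

/-- Bounding the density by its peak gives a factor of order `κ^(-1/2)`, uniformly in the centre.
The two coordinates of the numerator together contribute `κ⁻¹`, which is proportional to `α`. -/
lemma integral_exp_neg_sq_gaussianReal_le {l w κ : ℝ} (hl : 0 < l) (hw : l ≤ w) (hκ : 0 < κ)
    (c : ℝ) : ∫ x, Real.exp (-(κ * (c + x) ^ 2)) ∂(gaussianReal 0 w.toNNReal) ≤
      peak l * Real.sqrt (Real.pi / κ) := by
  rw [integral_gaussianReal_eq (hl.trans_le hw), ← integral_gaussian]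
  have hi : Integrable fun x : ℝ => Real.exp (-κ * (c + x) ^ 2) :=
    (integrable_exp_neg_mul_sq hκ).comp_add_left c
  have he : ∫ x : ℝ, Real.exp (-κ * (c + x) ^ 2) = ∫ x : ℝ, Real.exp (-κ * x ^ 2) :=
    integral_add_left_eq_self (fun x : ℝ => Real.exp (-κ * x ^ 2)) c
  rw [← he, ← integral_const_mul]
  refine integral_mono_of_nonneg
    (ae_of_all _ fun x => mul_nonneg (gaussDensity_nonneg _ _) (Real.exp_pos _).le)
    (hi.const_mul _) (ae_of_all _ fun x => ?_)
  simp only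
  rw [neg_mul]
  exact mul_le_mul_of_nonneg_right (gaussDensity_le_peak hl hw x) (Real.exp_pos _).le

/-- The damped modulus `‖V‖ᵏ exp (-k ‖U‖² / (4π²α‖V‖²))`. -/
noncomputable def dampedPow (k : ℕ) (α : ℝ) (V U : ℂ) : ℝ :=
  ‖V‖ ^ k * Real.exp (-(k * (‖U‖ ^ 2 / (4 * Real.pi ^ 2 * α * ‖V‖ ^ 2))))

lemma dampedPow_nonneg (k : ℕ) (α : ℝ) (V U : ℂ) : 0 ≤ dampedPow k α V U := by
  unfold dampedPow; positivity

/-- If `‖V‖ ≤ 2‖V0‖`, then `V` may be replaced by `2 V0`, which later is independent of `U`.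
Otherwise `‖V‖ ≤ 4L‖U‖`, so the exponent is at least `(64π²L²α)⁻¹` and the exponential alone gains a
factor `α`. -/
lemma dampedPow_le {k : ℕ} (hk : 1 ≤ k) {α L : ℝ} (hα : 0 < α) (hL : 0 < L) {V V0 U : ℂ}
    (h : ‖V - V0‖ ≤ 2 * L * ‖U‖) :
    dampedPow k α V U ≤
      (2 * ‖V0‖) ^ k * Real.exp (-(k * (‖U‖ ^ 2 / (16 * Real.pi ^ 2 * α * ‖V0‖ ^ 2)))) +
      α * (64 * Real.pi ^ 2 * L ^ 2) * ‖V‖ ^ k := by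
  have hp := Real.pi_pos
  have hk' : (1 : ℝ) ≤ k := by exact_mod_cast hk
  unfold dampedPow
  by_cases hV : V = 0
  · rw [hV, norm_zero, zero_pow (by omega), zero_mul, mul_zero, add_zero]
    positivity
  have hVp : 0 < ‖V‖ := norm_pos_iff.2 hV
  by_cases hc : ‖V‖ ≤ 2 * ‖V0‖
  · have hV0 : 0 < ‖V0‖ := by linarith
    have h1 : ‖V‖ ^ k * Real.exp (-(k * (‖U‖ ^ 2 / (4 * Real.pi ^ 2 * α * ‖V‖ ^ 2)))) ≤
        (2 * ‖V0‖) ^ k * Real.exp (-(k * (‖U‖ ^ 2 / (16 * Real.pi ^ 2 * α * ‖V0‖ ^ 2)))) := by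
      have h2 : 4 * Real.pi ^ 2 * α * ‖V‖ ^ 2 ≤ 16 * Real.pi ^ 2 * α * ‖V0‖ ^ 2 := by
        calc _ ≤ 4 * Real.pi ^ 2 * α * (2 * ‖V0‖) ^ 2 := by gcongr
          _ = _ := by ring
      gcongr
    have : 0 ≤ α * (64 * Real.pi ^ 2 * L ^ 2) * ‖V‖ ^ k := by positivity
    linarith
  · push Not at hc
    have h1 : ‖V‖ ≤ ‖V - V0‖ + ‖V0‖ := by simpa using norm_add_le (V - V0) V0
    have h2 : ‖V‖ ≤ 4 * L * ‖U‖ := by linarith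
    have h3 : (64 * Real.pi ^ 2 * L ^ 2 * α)⁻¹ ≤
        k * (‖U‖ ^ 2 / (4 * Real.pi ^ 2 * α * ‖V‖ ^ 2)) := by
      have h4 : ‖V‖ ^ 2 ≤ 16 * L ^ 2 * ‖U‖ ^ 2 := by
        calc _ ≤ (4 * L * ‖U‖) ^ 2 := by gcongr
          _ = _ := by ring
      have h5 : (64 * Real.pi ^ 2 * L ^ 2 * α)⁻¹ ≤ ‖U‖ ^ 2 / (4 * Real.pi ^ 2 * α * ‖V‖ ^ 2) := by
        rw [inv_eq_one_div, div_le_div_iff₀ (by positivity) (by positivity)]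
        nlinarith [mul_le_mul_of_nonneg_left h4 (show 0 ≤ 4 * Real.pi ^ 2 * α by positivity)]
      have h6 : 0 ≤ ‖U‖ ^ 2 / (4 * Real.pi ^ 2 * α * ‖V‖ ^ 2) := by positivity
      nlinarith
    have h7 : Real.exp (-(k * (‖U‖ ^ 2 / (4 * Real.pi ^ 2 * α * ‖V‖ ^ 2)))) ≤
        64 * Real.pi ^ 2 * L ^ 2 * α := by
      -- This is `exp(-1/x) ≤ x`, a consequence of `1 + 1/x ≤ exp(1/x)`.
      have h8 : Real.exp (-(64 * Real.pi ^ 2 * L ^ 2 * α)⁻¹) ≤ 64 * Real.pi ^ 2 * L ^ 2 * α := by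
        rw [Real.exp_neg]
        refine inv_le_of_inv_le₀ (by positivity) ?_
        linarith [Real.add_one_le_exp (64 * Real.pi ^ 2 * L ^ 2 * α)⁻¹]
      exact (Real.exp_le_exp.2 (neg_le_neg h3)).trans h8
    have h9 : 0 ≤ (2 * ‖V0‖) ^ k *
        Real.exp (-(k * (‖U‖ ^ 2 / (16 * Real.pi ^ 2 * α * ‖V0‖ ^ 2)))) := by positivity
    have h10 := mul_le_mul_of_nonneg_left h7 (show 0 ≤ ‖V‖ ^ k by positivity)
    linarith

/-- The product law of the residuals and of the centred reassignment numerator. -/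
noncomputable def prodLaw (σ₁ σ₂ w₁ w₂ : ℝ) : Measure ((ℝ × ℝ) × (ℝ × ℝ)) :=
  ((gaussianReal 0 σ₁.toNNReal).prod (gaussianReal 0 σ₂.toNNReal)).prod
    ((gaussianReal 0 w₁.toNNReal).prod (gaussianReal 0 w₂.toNNReal))

/-- The product weight `∏ (1 + |xᵢ|)ⁿ`. -/
noncomputable def weight (n : ℕ) (x : (ℝ × ℝ) × (ℝ × ℝ)) : ℝ :=
  ((1 + |x.1.1|) ^ n * (1 + |x.1.2|) ^ n) * ((1 + |x.2.1|) ^ n * (1 + |x.2.2|) ^ n)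

lemma integrable_weight (n : ℕ) (σ₁ σ₂ w₁ w₂ : ℝ) :
    Integrable (weight n) (prodLaw σ₁ σ₂ w₁ w₂) :=
  ((integrable_one_add_abs_pow n _).mul_prod (integrable_one_add_abs_pow n _)).mul_prod
    ((integrable_one_add_abs_pow n _).mul_prod (integrable_one_add_abs_pow n _))

lemma exists_integral_weight_le (n : ℕ) (L : ℝ) : ∃ C, 0 ≤ C ∧ ∀ σ₁ σ₂ w₁ w₂ : ℝ,
    0 ≤ σ₁ → σ₁ ≤ L → 0 ≤ σ₂ → σ₂ ≤ L → 0 ≤ w₁ → w₁ ≤ L → 0 ≤ w₂ → w₂ ≤ L →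
    ∫ x, weight n x ∂(prodLaw σ₁ σ₂ w₁ w₂) ≤ C := by
  obtain ⟨C, hC, H⟩ := exists_gaussian_moment_le n L
  refine ⟨C ^ 4, by positivity, fun σ₁ σ₂ w₁ w₂ a1 a2 a3 a4 a5 a6 a7 a8 => ?_⟩
  have h0 : ∀ v : ℝ, 0 ≤ ∫ x, (1 + |x|) ^ n ∂(gaussianReal 0 v.toNNReal) := fun v =>
    integral_nonneg fun x => by positivity
  unfold weight prodLaw
  rw [integral_prod_mul (fun x : ℝ × ℝ => (1 + |x.1|) ^ n * (1 + |x.2|) ^ n)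
    (fun x : ℝ × ℝ => (1 + |x.1|) ^ n * (1 + |x.2|) ^ n),
    integral_prod_mul (fun x : ℝ => (1 + |x|) ^ n) (fun x : ℝ => (1 + |x|) ^ n),
    integral_prod_mul (fun x : ℝ => (1 + |x|) ^ n) (fun x : ℝ => (1 + |x|) ^ n)]
  have b1 := H σ₁ a1 a2
  have b2 := H σ₂ a3 a4
  have b3 := H w₁ a5 a6
  have b4 := H w₂ a7 a8
  have := h0 σ₁
  have := h0 σ₂
  have := h0 w₁
  have := h0 w₂
  calc _ ≤ C * C * (C * C) := by gcongr
    _ = _ := by ring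

/-- A product majorant for a sum, so that moments under `prodLaw` factor into one-dimensional
Gaussian moments. -/
lemma one_add_sum_le {a b c d L : ℝ} (hL : 0 ≤ L) (ha : 0 ≤ a) (hb : 0 ≤ b) (hc : 0 ≤ c)
    (hd : 0 ≤ d) : L + a + b + L * c + L * d ≤
      (1 + L) * (((1 + a) * (1 + b)) * ((1 + c) * (1 + d))) := by
  have h1 : 1 + a + b ≤ (1 + a) * (1 + b) := by nlinarith [mul_nonneg ha hb]
  have h2 : 1 + c + d ≤ (1 + c) * (1 + d) := by nlinarith [mul_nonneg hc hd]
  have h3 : (1 + a + b) * (1 + c + d) ≤ ((1 + a) * (1 + b)) * ((1 + c) * (1 + d)) := by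
    gcongr
  have h4 := mul_le_mul_of_nonneg_left h3 (show 0 ≤ 1 + L by linarith)
  have n1 : 0 ≤ (a + b) * (c + d) := by positivity
  have n2 : 0 ≤ L * ((a + b) * (c + d)) := by positivity
  have n3 : 0 ≤ L * (a + b) := by positivity
  nlinarith

lemma norm_mk_le (x y : ℝ) : ‖(⟨x, y⟩ : ℂ)‖ ≤ |x| + |y| := by
  simpa using Complex.norm_le_abs_re_add_abs_im ⟨x, y⟩

/-- Uniform bound for the damped moments under the product law. -/
theorem exists_integral_dampedPow_le {k : ℕ} (hk : 1 ≤ k) {l L : ℝ} (hl : 0 < l) (hL : 0 < L) :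
    ∃ B, 0 ≤ B ∧ ∀ σ₁ σ₂ w₁ w₂ : ℝ, 0 ≤ σ₁ → σ₁ ≤ L → 0 ≤ σ₂ → σ₂ ≤ L →
      l ≤ w₁ → w₁ ≤ L → l ≤ w₂ → w₂ ≤ L → ∀ a b : ℝ, |a| ≤ L → |b| ≤ L →
      ∀ q u : ℂ, ‖q‖ ≤ L → ‖u‖ ≤ L → ∀ α, 0 < α →
      ∫ x, dampedPow k α (q + ⟨x.1.1 + a * x.2.1, x.1.2 + b * x.2.2⟩) (u + ⟨x.2.2, x.2.1⟩)
        ∂(prodLaw σ₁ σ₂ w₁ w₂) ≤ B * α := by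
  obtain ⟨C1, hC1, H1⟩ := exists_integral_weight_le k L
  obtain ⟨C2, hC2, H2⟩ := exists_integral_weight_le (k + 2) L
  have hp := Real.pi_pos
  have hk' : (0 : ℝ) < k := by exact_mod_cast hk
  have hpk := peak_pos hl
  set Q := L + 2 * L ^ 2 with hQ
  have hQ0 : 0 < Q := by positivity
  refine ⟨2 ^ k * (1 + Q) ^ (k + 2) * C2 * (peak l ^ 2 * (16 * Real.pi ^ 3 / k)) +
    64 * Real.pi ^ 2 * L ^ 2 * ((1 + L) ^ k * C1), by positivity, ?_⟩
  intro σ₁ σ₂ w₁ w₂ a1 a2 a3 a4 a5 a6 a7 a8 a b ha hb q u hq hu α hα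
  let V : (ℝ × ℝ) × (ℝ × ℝ) → ℂ := fun x => q + ⟨x.1.1 + a * x.2.1, x.1.2 + b * x.2.2⟩
  let U : ℝ × ℝ → ℂ := fun x => u + ⟨x.2, x.1⟩
  -- The part of `V` left after removing its linear dependence on `U`. It involves only the residual
  -- coordinates, hence is independent of `U`, and `V - V0` is linear in `U`.
  let V0 : ℝ × ℝ → ℂ := fun x => q - ⟨a * u.im, b * u.re⟩ + ⟨x.1, x.2⟩
  let κ : ℝ × ℝ → ℝ := fun x => k / (16 * Real.pi ^ 2 * α * ‖V0 x‖ ^ 2)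
  have hmk : Continuous fun p : ℝ × ℝ => (⟨p.1, p.2⟩ : ℂ) :=
    Complex.equivRealProdCLM.symm.continuous
  have cV : Continuous V := by
    have : Continuous fun x : (ℝ × ℝ) × (ℝ × ℝ) =>
      ((x.1.1 + a * x.2.1, x.1.2 + b * x.2.2) : ℝ × ℝ) := by fun_prop
    exact continuous_const.add (hmk.comp this)
  have cU : Continuous U := by
    have : Continuous fun x : ℝ × ℝ => ((x.2, x.1) : ℝ × ℝ) := by fun_prop
    exact continuous_const.add (hmk.comp this)
  have cV0 : Continuous V0 := continuous_const.add hmk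
  have hdiff : ∀ x, ‖V x - V0 x.1‖ ≤ 2 * L * ‖U x.2‖ := by
    intro x
    have e : V x - V0 x.1 = ⟨a * (U x.2).im, b * (U x.2).re⟩ := by
      refine Complex.ext ?_ ?_
      · simp [V, V0, U]; ring
      · simp [V, V0, U]; ring
    rw [e]
    refine (norm_mk_le _ _).trans ?_
    rw [abs_mul, abs_mul]
    have h1 : |a| * |(U x.2).im| ≤ L * ‖U x.2‖ := by
      gcongr; exact Complex.abs_im_le_norm _
    have h2 : |b| * |(U x.2).re| ≤ L * ‖U x.2‖ := by
      gcongr; exact Complex.abs_re_le_norm _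
    linarith
  have hVb : ∀ x, ‖V x‖ ^ k ≤ (1 + L) ^ k * weight k x := by
    intro x
    have h1 : ‖V x‖ ≤ (1 + L) * (((1 + |x.1.1|) * (1 + |x.1.2|)) *
        ((1 + |x.2.1|) * (1 + |x.2.2|))) := by
      refine le_trans ?_ (one_add_sum_le hL.le (abs_nonneg x.1.1) (abs_nonneg x.1.2)
        (abs_nonneg x.2.1) (abs_nonneg x.2.2))
      refine (norm_add_le _ _).trans ?_
      have h2 := norm_mk_le (x.1.1 + a * x.2.1) (x.1.2 + b * x.2.2)
      have h3 := abs_add_le x.1.1 (a * x.2.1)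
      have h4 := abs_add_le x.1.2 (b * x.2.2)
      rw [abs_mul] at h3 h4
      have h5 : |a| * |x.2.1| ≤ L * |x.2.1| := by gcongr
      have h6 : |b| * |x.2.2| ≤ L * |x.2.2| := by gcongr
      linarith
    calc _ ≤ _ := pow_le_pow_left₀ (norm_nonneg _) h1 k
      _ = _ := by rw [weight]; simp only [mul_pow]
  have hV0b : ∀ x : (ℝ × ℝ) × (ℝ × ℝ), ∀ n : ℕ, ‖V0 x.1‖ ^ n ≤ (1 + Q) ^ n * weight n x := by
    intro x n
    have h1 : ‖V0 x.1‖ ≤ (1 + Q) * (((1 + |x.1.1|) * (1 + |x.1.2|)) *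
        ((1 + |x.2.1|) * (1 + |x.2.2|))) := by
      refine le_trans ?_ (one_add_sum_le hQ0.le (abs_nonneg x.1.1) (abs_nonneg x.1.2)
        (abs_nonneg x.2.1) (abs_nonneg x.2.2))
      refine (norm_add_le _ _).trans ?_
      have h2 := norm_sub_le q ⟨a * u.im, b * u.re⟩
      have h3 := norm_mk_le (a * u.im) (b * u.re)
      have h4 := norm_mk_le x.1.1 x.1.2
      rw [abs_mul, abs_mul] at h3
      have h5 : |a| * |u.im| ≤ L * L := by
        gcongr; exact (Complex.abs_im_le_norm _).trans hu
      have h6 : |b| * |u.re| ≤ L * L := by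
        gcongr; exact (Complex.abs_re_le_norm _).trans hu
      have h7 : 0 ≤ Q * |x.2.1| + Q * |x.2.2| := by positivity
      rw [hQ] at h7 ⊢
      linarith
    calc _ ≤ _ := pow_le_pow_left₀ (norm_nonneg _) h1 n
      _ = _ := by rw [weight]; simp only [mul_pow]
  let F1 : (ℝ × ℝ) × (ℝ × ℝ) → ℝ := fun x =>
    (2 * ‖V0 x.1‖) ^ k * Real.exp (-(κ x.1 * ‖U x.2‖ ^ 2))
  have κ_nonneg : ∀ x, 0 ≤ κ x := fun x => by simp only [κ]; positivity
  have iF1 : Integrable F1 (prodLaw σ₁ σ₂ w₁ w₂) := by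
    refine ((integrable_weight k σ₁ σ₂ w₁ w₂).const_mul (2 ^ k * (1 + Q) ^ k)).mono'
      (Measurable.aestronglyMeasurable ?_) (ae_of_all _ fun x => ?_)
    · have m1 : Measurable V0 := cV0.measurable
      have m2 : Measurable U := cU.measurable
      simp only [F1, κ]
      fun_prop
    · have h1 : Real.exp (-(κ x.1 * ‖U x.2‖ ^ 2)) ≤ 1 := by
        rw [Real.exp_le_one_iff, neg_nonpos]
        have := κ_nonneg x.1
        positivity
      have h2 := hV0b x k
      simp only [F1]
      rw [Real.norm_of_nonneg (by positivity), mul_pow]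
      calc _ ≤ 2 ^ k * ‖V0 x.1‖ ^ k * 1 := by gcongr
        _ = 2 ^ k * ‖V0 x.1‖ ^ k := mul_one _
        _ ≤ 2 ^ k * ((1 + Q) ^ k * weight k x) := by gcongr
        _ = _ := by ring
  have iV : Integrable (fun x => ‖V x‖ ^ k) (prodLaw σ₁ σ₂ w₁ w₂) := by
    refine ((integrable_weight k σ₁ σ₂ w₁ w₂).const_mul ((1 + L) ^ k)).mono'
      (Continuous.aestronglyMeasurable (by fun_prop)) (ae_of_all _ fun x => ?_)
    rw [Real.norm_of_nonneg (by positivity)]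
    exact hVb x
  have hsplit : ∫ x, dampedPow k α (V x) (U x.2) ∂(prodLaw σ₁ σ₂ w₁ w₂) ≤
      ∫ x, (F1 x + α * (64 * Real.pi ^ 2 * L ^ 2) * ‖V x‖ ^ k) ∂(prodLaw σ₁ σ₂ w₁ w₂) := by
    refine integral_mono_of_nonneg (ae_of_all _ fun x => dampedPow_nonneg _ _ _ _)
      (iF1.add (iV.const_mul _)) (ae_of_all _ fun x => ?_)
    have := dampedPow_le hk hα hL (hdiff x)
    simp only [F1, κ]
    refine this.trans (le_of_eq ?_)
    congr 3
    ring
  have hVint : ∫ x, ‖V x‖ ^ k ∂(prodLaw σ₁ σ₂ w₁ w₂) ≤ (1 + L) ^ k * C1 := by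
    refine (integral_mono iV ((integrable_weight k σ₁ σ₂ w₁ w₂).const_mul _) hVb).trans ?_
    rw [integral_const_mul]
    exact mul_le_mul_of_nonneg_left
      (H1 _ _ _ _ a1 a2 a3 a4 (hl.le.trans a5) a6 (hl.le.trans a7) a8) (by positivity)
  -- With the residuals frozen, the Gaussian factor in `U` integrates to at most `peak l ^ 2 * π /
  -- κ`, and `π / κ = 16π³ α ‖V0‖² / k`.
  have inner : ∀ x : ℝ × ℝ, ∫ y, F1 (x, y) ∂((gaussianReal 0 w₁.toNNReal).prod
      (gaussianReal 0 w₂.toNNReal)) ≤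
      2 ^ k * (peak l ^ 2 * (16 * Real.pi ^ 3 / k)) * α * ‖V0 x‖ ^ (k + 2) := by
    intro x
    by_cases hx : V0 x = 0
    · simp only [F1, hx, norm_zero, mul_zero, zero_pow (show k ≠ 0 by omega), zero_mul,
        integral_zero, zero_pow (show k + 2 ≠ 0 by omega), le_refl]
    have hx0 : 0 < ‖V0 x‖ := norm_pos_iff.2 hx
    have hκ : 0 < κ x := by simp only [κ]; positivity
    have e : ∀ y : ℝ × ℝ, F1 (x, y) = (2 * ‖V0 x‖) ^ k *
        (Real.exp (-(κ x * (u.im + y.1) ^ 2)) * Real.exp (-(κ x * (u.re + y.2) ^ 2))) := by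
      intro y
      simp only [F1]
      rw [← Real.exp_add, Complex.sq_norm, Complex.normSq_apply]
      simp only [U, Complex.add_re, Complex.add_im]
      congr 2
      ring
    simp_rw [e]
    rw [integral_const_mul, integral_prod_mul (fun y : ℝ => Real.exp (-(κ x * (u.im + y) ^ 2)))
      (fun y : ℝ => Real.exp (-(κ x * (u.re + y) ^ 2)))]
    have b1 := integral_exp_neg_sq_gaussianReal_le hl a5 hκ u.im
    have b2 := integral_exp_neg_sq_gaussianReal_le hl a7 hκ u.re
    have b3 := mul_le_mul b1 b2 (integral_nonneg fun y => (Real.exp_pos _).le) (by positivity)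
    refine (mul_le_mul_of_nonneg_left b3 (by positivity)).trans (le_of_eq ?_)
    have e2 : Real.sqrt (Real.pi / κ x) * Real.sqrt (Real.pi / κ x) = Real.pi / κ x :=
      Real.mul_self_sqrt (by positivity)
    calc _ = (2 * ‖V0 x‖) ^ k * (peak l ^ 2 *
          (Real.sqrt (Real.pi / κ x) * Real.sqrt (Real.pi / κ x))) := by ring
      _ = _ := by
          rw [e2]
          simp only [κ]
          rw [mul_pow]
          field_simp
          ring
  have iV0 : ∀ n : ℕ, Integrable (fun x : (ℝ × ℝ) × (ℝ × ℝ) => ‖V0 x.1‖ ^ n)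
      (prodLaw σ₁ σ₂ w₁ w₂) := by
    intro n
    refine ((integrable_weight n σ₁ σ₂ w₁ w₂).const_mul ((1 + Q) ^ n)).mono'
      (Continuous.aestronglyMeasurable (by fun_prop)) (ae_of_all _ fun x => ?_)
    rw [Real.norm_of_nonneg (by positivity)]
    exact hV0b x n
  have hF1int : ∫ x, F1 x ∂(prodLaw σ₁ σ₂ w₁ w₂) ≤
      ∫ x, 2 ^ k * (peak l ^ 2 * (16 * Real.pi ^ 3 / k)) * α * ‖V0 x.1‖ ^ (k + 2)
        ∂(prodLaw σ₁ σ₂ w₁ w₂) := by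
    have iR := (iV0 (k + 2)).const_mul (2 ^ k * (peak l ^ 2 * (16 * Real.pi ^ 3 / k)) * α)
    unfold prodLaw at iF1 iR ⊢
    rw [integral_prod _ iF1, integral_prod _ iR]
    refine integral_mono iF1.integral_prod_left iR.integral_prod_left fun x => ?_
    simp only [integral_const, probReal_univ, one_smul]
    exact inner x
  have hV0int : ∫ x, ‖V0 x.1‖ ^ (k + 2) ∂(prodLaw σ₁ σ₂ w₁ w₂) ≤ (1 + Q) ^ (k + 2) * C2 := by
    refine (integral_mono (iV0 _) ((integrable_weight (k + 2) σ₁ σ₂ w₁ w₂).const_mul _)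
      fun x => hV0b x (k + 2)).trans ?_
    rw [integral_const_mul]
    exact mul_le_mul_of_nonneg_left
      (H2 _ _ _ _ a1 a2 a3 a4 (hl.le.trans a5) a6 (hl.le.trans a7) a8) (by positivity)
  refine hsplit.trans ?_
  rw [integral_add iF1 (iV.const_mul _), integral_const_mul]
  rw [integral_const_mul] at hF1int
  calc _ ≤ 2 ^ k * (peak l ^ 2 * (16 * Real.pi ^ 3 / k)) * α * ((1 + Q) ^ (k + 2) * C2) +
        α * (64 * Real.pi ^ 2 * L ^ 2) * ((1 + L) ^ k * C1) := by
        gcongr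
        refine hF1int.trans ?_
        gcongr
    _ = _ := by ring

lemma norm_sstOfNoise_pow (A ξ₀ t ξ η : ℝ) {α : ℝ} (hα : 0 < α) {k : ℕ} (hk : 1 ≤ k)
    (z m : ℂ) : ‖sstOfNoise A ξ₀ t ξ α η (z, m)‖ ^ k = ((Real.pi * α) ^ k)⁻¹ *
      dampedPow k α (signalValue A ξ₀ t η + z)
        (2 * Real.pi * Complex.I * (ξ₀ - ξ) * signalValue A ξ₀ t η +
          (m - 2 * Real.pi * Complex.I * (ξ - η) * z)) := by
  unfold sstOfNoise dampedPow
  set v := signalValue A ξ₀ t η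
  by_cases hV : v + z = 0
  · simp [hV, show k ≠ 0 by omega]
  have hpi : (Real.pi : ℂ) ≠ 0 := by exact_mod_cast Real.pi_pos.ne'
  have e : (ξ : ℂ) - 1 / (2 * Real.pi * Complex.I) *
      ((2 * Real.pi * Complex.I * ξ₀ * v + (m + 2 * Real.pi * Complex.I * η * z)) / (v + z)) =
      -(2 * Real.pi * Complex.I * (ξ₀ - ξ) * v + (m - 2 * Real.pi * Complex.I * (ξ - η) * z)) /
        (2 * Real.pi * Complex.I * (v + z)) := by
    have hI := Complex.I_ne_zero
    field_simp
    ring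
  simp only [e]
  set U := 2 * Real.pi * Complex.I * (ξ₀ - ξ) * v + (m - 2 * Real.pi * Complex.I * (ξ - η) * z)
  have hp := Real.pi_pos
  have hn : ‖(2 * Real.pi * Complex.I * (v + z) : ℂ)‖ = 2 * Real.pi * ‖v + z‖ := by
    simp [abs_of_pos hp]
  rw [norm_mul, Complex.norm_real, approxDelta, Real.norm_of_nonneg (by positivity), norm_div,
    norm_neg, hn, mul_pow, mul_pow, ← Real.exp_nat_mul]
  have h2 : k * -((‖U‖ / (2 * Real.pi * ‖v + z‖)) ^ 2 / α) =
      -(k * (‖U‖ ^ 2 / (4 * Real.pi ^ 2 * α * ‖v + z‖ ^ 2))) := by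
    have : ‖v + z‖ ≠ 0 := norm_ne_zero_iff.2 hV
    field_simp
    norm_num
  rw [h2, one_div, inv_pow]
  ring

lemma continuous_pseudoDecay : Continuous pseudoDecay := by
  unfold pseudoDecay; fun_prop

section Law

variable {Ω : Type*} [MeasurableSpace Ω] {P : Measure Ω} {Φ : 𝓢(ℝ, ℂ) → Ω → ℂ}

/-- The last two combinations are the imaginary and real parts, in this order, of `m - 2πi(ξ - η)z`;
the first two are the residuals of `re z` and `im z` after regression on them. No density of `(z,
m)` enters, so the formula survives the degeneration at `η = 0`. -/
lemma IsWhiteNoise.integral_norm_Y_pow_eq_prodLaw [IsProbabilityMeasure P] (hΦ : IsWhiteNoise P Φ)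
    (A ξ₀ t ξ η : ℝ) {α : ℝ} (hα : 0 < α) {k : ℕ} (hk : 1 ≤ k) {δ a b : ℝ}
    (hδ : δ = 2 * Real.pi * (ξ - η))
    (ha : evenForm η (1 + a * δ) (-a) (-δ) 1 = 0) (hb : oddForm η (1 - b * δ) (-b) δ 1 = 0) :
    ∫ ω, ‖Y Φ A ξ₀ t ξ α η ω‖ ^ k ∂P = ((Real.pi * α) ^ k)⁻¹ *
      ∫ x, dampedPow k α (signalValue A ξ₀ t η + ⟨x.1.1 + a * x.2.1, x.1.2 + b * x.2.2⟩)
        (2 * Real.pi * Complex.I * (ξ₀ - ξ) * signalValue A ξ₀ t η + ⟨x.2.2, x.2.1⟩)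
        ∂(prodLaw (evenForm η (1 + a * δ) (-a) (1 + a * δ) (-a))
          (oddForm η (1 - b * δ) (-b) (1 - b * δ) (-b))
          (evenForm η (-δ) 1 (-δ) 1) (oddForm η δ 1 δ 1)) := by
  have hmap := hΦ.map_linear_combinations t η (1 + a * δ) (-a) (1 - b * δ) (-b) (-δ) 1 δ 1 ha hb
  have mZ := hΦ.gaussian.aemeasurable (tfShift gaussWindow t η)
  have mM := hΦ.gaussian.aemeasurable (windowMoment t η)
  have h1 : ∫ ω, ‖Y Φ A ξ₀ t ξ α η ω‖ ^ k ∂P = ∫ ω, ‖sstOfNoise A ξ₀ t ξ α η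
      (Φ (tfShift gaussWindow t η) ω, Φ (windowMoment t η) ω)‖ ^ k ∂P :=
    integral_congr_ae ((hΦ.Y_ae_eq A ξ₀ t ξ α η).fun_comp fun z => ‖z‖ ^ k)
  have hmk : Measurable fun p : ℝ × ℝ => (⟨p.1, p.2⟩ : ℂ) :=
    Complex.equivRealProdCLM.symm.continuous.measurable
  rw [h1, prodLaw, ← hmap, integral_map, ← integral_const_mul]
  · congr 1
    funext ω
    rw [norm_sstOfNoise_pow A ξ₀ t ξ η hα hk]
    congr 3
    · refine Complex.ext ?_ ?_
      · simp only; ring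
      · simp only; ring
    · refine Complex.ext ?_ ?_
      · simp [hδ]; ring
      · simp [hδ]; ring
  · have m1 := Complex.measurable_re.comp_aemeasurable mZ
    have m2 := Complex.measurable_im.comp_aemeasurable mZ
    have m3 := Complex.measurable_re.comp_aemeasurable mM
    have m4 := Complex.measurable_im.comp_aemeasurable mM
    exact (((m1.const_mul _).add (m4.const_mul _)).prodMk
      ((m2.const_mul _).add (m3.const_mul _))).prodMk
      (((m1.const_mul _).add (m4.const_mul _)).prodMk ((m2.const_mul _).add (m3.const_mul _)))
  · refine Measurable.aestronglyMeasurable ?_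
    have c1 : Measurable fun x : (ℝ × ℝ) × (ℝ × ℝ) =>
        (⟨x.1.1 + a * x.2.1, x.1.2 + b * x.2.2⟩ : ℂ) := by
      have : Measurable fun x : (ℝ × ℝ) × (ℝ × ℝ) =>
        ((x.1.1 + a * x.2.1, x.1.2 + b * x.2.2) : ℝ × ℝ) := by fun_prop
      exact hmk.comp this
    have c2 : Measurable fun x : (ℝ × ℝ) × (ℝ × ℝ) => (⟨x.2.2, x.2.1⟩ : ℂ) := by
      have : Measurable fun x : (ℝ × ℝ) × (ℝ × ℝ) => ((x.2.2, x.2.1) : ℝ × ℝ) := by fun_prop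
      exact hmk.comp this
    unfold dampedPow
    fun_prop

/-- The absolute moments stay of order `α^(1-k)` uniformly as `η → 0+`. -/
theorem IsWhiteNoise.exists_integral_norm_Y_pow_le_near_zero [IsProbabilityMeasure P]
    (hΦ : IsWhiteNoise P Φ) {A : ℝ} (hA : 0 ≤ A) (ξ₀ t : ℝ) {ξ : ℝ} (hξ : 0 < ξ) {k : ℕ}
    (hk : 1 ≤ k) : ∃ B, 0 ≤ B ∧ ∀ᶠ η in 𝓝[>] (0 : ℝ), ∀ α, 0 < α →
      ∫ ω, ‖Y Φ A ξ₀ t ξ α η ω‖ ^ k ∂P ≤ B * α ^ (1 - (k : ℤ)) := by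
  have hE := windowEnergy_pos
  have hp := Real.pi_pos
  have hpd := continuous_pseudoDecay
  let δ : ℝ → ℝ := fun η => 2 * Real.pi * (ξ - η)
  let w₁ : ℝ → ℝ := fun η => evenForm η (-δ η) 1 (-δ η) 1
  let w₂ : ℝ → ℝ := fun η => oddForm η (δ η) 1 (δ η) 1
  let a : ℝ → ℝ := fun η => evenForm η 1 0 (-δ η) 1 / w₁ η
  let b : ℝ → ℝ := fun η => oddForm η 1 0 (δ η) 1 / w₂ η
  let s₁ : ℝ → ℝ := fun η => evenForm η (1 + a η * δ η) (-a η) (1 + a η * δ η) (-a η)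
  let s₂ : ℝ → ℝ := fun η => oddForm η (1 - b η * δ η) (-b η) (1 - b η * δ η) (-b η)
  have hp0 : pseudoDecay 0 = 1 := by simp [pseudoDecay]
  -- At `η = 0` the imaginary part of the centred numerator is in effect `-2πξ re z`, which is
  -- nondegenerate because `ξ > 0`.
  have hw₁ : 0 < w₁ 0 := by
    have : w₁ 0 = (2 * Real.pi * ξ) ^ 2 * windowEnergy := by
      simp only [w₁, evenForm, hp0, δ]; ring
    rw [this]; positivity
  have hw₂ : 0 < w₂ 0 := by
    have : w₂ 0 = windowEnergy / 2 := by
      simp only [w₂, oddForm, hp0, δ]; ring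
    rw [this]; positivity
  have cδ : Continuous δ := by fun_prop
  have cw₁ : ContinuousAt w₁ 0 := by
    refine Continuous.continuousAt ?_
    simp only [w₁, evenForm]; fun_prop
  have cw₂ : ContinuousAt w₂ 0 := by
    refine Continuous.continuousAt ?_
    simp only [w₂, oddForm]; fun_prop
  have ca : ContinuousAt a 0 := by
    refine ContinuousAt.div (Continuous.continuousAt ?_) cw₁ hw₁.ne'
    simp only [evenForm]; fun_prop
  have cb : ContinuousAt b 0 := by
    refine ContinuousAt.div (Continuous.continuousAt ?_) cw₂ hw₂.ne'
    simp only [oddForm]; fun_prop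
  have cδ' := cδ.continuousAt (x := 0)
  have hpd' := hpd.continuousAt (x := 0)
  have cs₁ : ContinuousAt s₁ 0 := by
    simp only [s₁, evenForm]; fun_prop
  have cs₂ : ContinuousAt s₂ 0 := by
    simp only [s₂, oddForm]; fun_prop
  -- One continuous function dominating every quantity that must be bounded; near `0` the constant
  -- `L = g 0 + 1` works, and half the smaller of `w₁ 0`, `w₂ 0` serves as lower bound for the
  -- variances.
  let g : ℝ → ℝ := fun η => |w₁ η| + |w₂ η| + |a η| + |b η| + |s₁ η| + |s₂ η| + A +
    2 * Real.pi * |ξ₀ - ξ| * A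
  have cg : ContinuousAt g 0 := by
    have := cw₁.abs
    have := cw₂.abs
    have := ca.abs
    have := cb.abs
    have := cs₁.abs
    have := cs₂.abs
    simp only [g]; fun_prop
  have hg0 : 0 ≤ g 0 := by simp only [g]; positivity
  set l := min (w₁ 0) (w₂ 0) / 2 with hl
  have hl0 : 0 < l := by have := lt_min hw₁ hw₂; positivity
  obtain ⟨B, hB, H⟩ := exists_integral_dampedPow_le hk hl0 (show 0 < g 0 + 1 by linarith)
  refine ⟨(Real.pi ^ k)⁻¹ * B, by positivity, ?_⟩
  have e1 : ∀ᶠ η in 𝓝[>] (0 : ℝ), g η < g 0 + 1 :=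
    (cg.eventually_lt_const (lt_add_one _)).filter_mono nhdsWithin_le_nhds
  have e2 : ∀ᶠ η in 𝓝[>] (0 : ℝ), l < w₁ η :=
    (cw₁.eventually_const_lt (by have := min_le_left (w₁ 0) (w₂ 0); linarith)).filter_mono
      nhdsWithin_le_nhds
  have e3 : ∀ᶠ η in 𝓝[>] (0 : ℝ), l < w₂ η :=
    (cw₂.eventually_const_lt (by have := min_le_right (w₁ 0) (w₂ 0); linarith)).filter_mono
      nhdsWithin_le_nhds
  filter_upwards [e1, e2, e3] with η h1 h2 h3 α hα
  -- The coefficients `a`, `b` are covariance over variance, so the residuals are uncorrelated with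
  -- the numerator.
  have ha : evenForm η (1 + a η * δ η) (-a η) (-δ η) 1 = 0 := by
    have e : evenForm η (1 + a η * δ η) (-a η) (-δ η) 1 =
        evenForm η 1 0 (-δ η) 1 - a η * w₁ η := by
      simp only [w₁, evenForm]; ring
    rw [e, div_mul_cancel₀ _ (hl0.trans h2).ne', sub_self]
  have hb : oddForm η (1 - b η * δ η) (-b η) (δ η) 1 = 0 := by
    have e : oddForm η (1 - b η * δ η) (-b η) (δ η) 1 =
        oddForm η 1 0 (δ η) 1 - b η * w₂ η := by
      simp only [w₂, oddForm]; ring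
    rw [e, div_mul_cancel₀ _ (hl0.trans h3).ne', sub_self]
  rw [hΦ.integral_norm_Y_pow_eq_prodLaw A ξ₀ t ξ η hα hk rfl ha hb]
  have n1 := abs_nonneg (w₁ η)
  have n2 := abs_nonneg (w₂ η)
  have n3 := abs_nonneg (a η)
  have n4 := abs_nonneg (b η)
  have n5 := abs_nonneg (s₁ η)
  have n6 := abs_nonneg (s₂ η)
  have n7 : 0 ≤ 2 * Real.pi * |ξ₀ - ξ| * A := by positivity
  simp only [g] at h1
  have hv : ‖signalValue A ξ₀ t η‖ ≤ A := by
    rw [norm_signalValue hA]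
    refine mul_le_of_le_one_right hA (Real.exp_le_one_iff.2 ?_)
    rw [neg_nonpos]; positivity
  have hu : ‖2 * Real.pi * Complex.I * (ξ₀ - ξ) * signalValue A ξ₀ t η‖ ≤
      2 * Real.pi * |ξ₀ - ξ| * A := by
    rw [norm_mul, ← Complex.ofReal_sub, norm_mul]
    simp only [norm_mul, Complex.norm_I, Complex.norm_real, Complex.norm_ofNat, mul_one,
      Real.norm_eq_abs, abs_of_pos hp]
    gcongr
  -- Truncating the residual variances at zero spares a proof of their nonnegativity; `prodLaw`
  -- applies the same truncation.
  have key := H ((s₁ η).toNNReal) ((s₂ η).toNNReal) (w₁ η) (w₂ η) (NNReal.coe_nonneg _)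
    (by
      rw [Real.coe_toNNReal']
      exact max_le (by have := le_abs_self (s₁ η); linarith) (by linarith))
    (NNReal.coe_nonneg _)
    (by
      rw [Real.coe_toNNReal']
      exact max_le (by have := le_abs_self (s₂ η); linarith) (by linarith))
    h2.le (by have := le_abs_self (w₁ η); linarith) h3.le (by have := le_abs_self (w₂ η); linarith)
    (a η) (b η) (by linarith) (by linarith) (signalValue A ξ₀ t η)
    (2 * Real.pi * Complex.I * (ξ₀ - ξ) * signalValue A ξ₀ t η) (by linarith) (by linarith) α hα
  rw [show prodLaw (s₁ η).toNNReal (s₂ η).toNNReal (w₁ η) (w₂ η) =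
    prodLaw (s₁ η) (s₂ η) (w₁ η) (w₂ η) by simp only [prodLaw, Real.toNNReal_coe]] at key
  refine (mul_le_mul_of_nonneg_left key (by positivity)).trans (le_of_eq ?_)
  rw [zpow_sub₀ hα.ne', zpow_one, zpow_natCast, mul_pow]
  field_simp

end Law

/-! ### Constants as functions of `η`; moment and variance bounds. -/

/-- The optimal constant of a family of bounds that is uniform in the second variable inherits
every eventual estimate. -/
lemma exists_envelope {F : ℝ → ℝ → ℝ} (h0 : ∀ η α, 0 < α → 0 ≤ F η α)
    (hF : ∀ η, 0 < η → ∃ C, ∀ α, 0 < α → F η α ≤ C) :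
    ∃ K : ℝ → ℝ, (∀ η, 0 < η → ∀ α, 0 < α → F η α ≤ K η) ∧
      ∀ (l : Filter ℝ) (g : ℝ → ℝ), (∀ᶠ η in l, 0 ≤ g η) →
        (∀ᶠ η in l, ∀ α, 0 < α → F η α ≤ g η) → K =O[l] g := by
  -- The supremum over `α` is the smallest admissible constant, so a single function has the
  -- required behaviour at both ends. Where the family is unbounded the real supremum is `0`; this
  -- can occur only for `η ≤ 0`, where no bound is claimed.
  refine ⟨fun η => ⨆ α : Ioi (0 : ℝ), F η α, fun η hη α hα => ?_, fun l g hg hl => ?_⟩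
  · obtain ⟨C, hC⟩ := hF η hη
    exact le_ciSup (f := fun α : Ioi (0 : ℝ) => F η α)
      ⟨C, by rintro _ ⟨α, rfl⟩; exact hC α α.2⟩ ⟨α, hα⟩
  · refine IsBigO.of_bound 1 ?_
    filter_upwards [hg, hl] with η h1 h2
    rw [one_mul, Real.norm_of_nonneg h1,
      Real.norm_of_nonneg (Real.iSup_nonneg fun α : Ioi (0 : ℝ) => h0 η α α.2)]
    exact Real.iSup_le (fun α : Ioi (0 : ℝ) => h2 α α.2) h1

/-- The constants obtained near `η = 0` are bounded, which is stronger than the stated order. -/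
lemma const_isBigO_rpow_neg_half (B : ℝ) :
    (fun _ : ℝ => B) =O[𝓝[>] 0] (fun η : ℝ => η ^ (-(1 / 2) : ℝ)) := by
  refine IsBigO.of_bound |B| ?_
  filter_upwards [Ioo_mem_nhdsGT (zero_lt_one (α := ℝ))] with η hη
  have h1 : 1 ≤ η ^ (-(1 / 2) : ℝ) :=
    Real.one_le_rpow_of_pos_of_le_one_of_nonpos hη.1 hη.2.le (by norm_num)
  rw [Real.norm_eq_abs, Real.norm_of_nonneg (by linarith)]
  exact le_mul_of_one_le_right (abs_nonneg B) h1

lemma one_add_mul_exp_neg_le (x : ℝ) :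
    (1 + x) * Real.exp (-x) ≤ 2 * Real.exp (-(x / 2)) := by
  have h1 := Real.add_one_le_exp (x / 2)
  have h2 : Real.exp (-(x / 2)) = Real.exp (x / 2) * Real.exp (-x) := by
    rw [← Real.exp_add]; ring_nf
  rw [h2, ← mul_assoc]
  exact mul_le_mul_of_nonneg_right (by linarith) (Real.exp_pos _).le

/-- Half of the rate absorbs the polynomial factor, and `2π² ≥ 4π` since `π ≥ 2`. -/
lemma phase_mul_pseudoDecay_le_exp (η : ℝ) :
    (1 + 4 * Real.pi ^ 2 * η ^ 2) * pseudoDecay η ≤ 2 * Real.exp (-(4 * Real.pi * η ^ 2)) := by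
  refine (one_add_mul_exp_neg_le _).trans ?_
  have h := Real.two_le_pi
  gcongr
  nlinarith [mul_nonneg (sq_nonneg η) (mul_nonneg Real.pi_pos.le (sub_nonneg.2 h))]

/-- The factor `1 + 2π|η - ξ₀|` is absorbed by half of the exponent `2π²(η - ξ₀)²`. -/
lemma norm_signal_terms_le {A : ℝ} (hA : 0 ≤ A) (ξ₀ t η : ℝ) :
    ‖signalValue A ξ₀ t η‖ + ‖-(2 * Real.pi * Complex.I * (ξ₀ - η) * signalValue A ξ₀ t η)‖ ≤
      2 * A * Real.exp (-(η - ξ₀) ^ 2) := by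
  have hp := Real.pi_pos
  rw [norm_neg, norm_mul, ← Complex.ofReal_sub, norm_mul]
  simp only [norm_mul, Complex.norm_I, Complex.norm_real, Complex.norm_ofNat, mul_one,
    Real.norm_eq_abs, abs_of_pos hp]
  rw [norm_signalValue hA, abs_sub_comm]
  set y := η - ξ₀
  have h1 : 1 + 2 * Real.pi * |y| ≤ 2 * Real.exp (Real.pi ^ 2 * y ^ 2) := by
    have h2 := Real.add_one_le_exp (Real.pi ^ 2 * y ^ 2)
    have h3 : 0 ≤ (Real.pi * |y| - 1) ^ 2 := sq_nonneg _
    have h4 : (Real.pi * |y|) ^ 2 = Real.pi ^ 2 * y ^ 2 := by rw [mul_pow, sq_abs]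
    have h5 : 0 ≤ Real.pi ^ 2 * y ^ 2 := by positivity
    nlinarith
  have h6 : Real.exp (Real.pi ^ 2 * y ^ 2) * Real.exp (-(2 * Real.pi ^ 2 * y ^ 2)) ≤
      Real.exp (-y ^ 2) := by
    rw [← Real.exp_add]
    refine Real.exp_le_exp.2 ?_
    have h := Real.two_le_pi
    nlinarith [sq_nonneg y, mul_nonneg (sq_nonneg y) (show 0 ≤ Real.pi ^ 2 - 1 by nlinarith)]
  calc _ = A * ((1 + 2 * Real.pi * |y|) * Real.exp (-(2 * Real.pi ^ 2 * y ^ 2))) := by ring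
    _ ≤ A * ((2 * Real.exp (Real.pi ^ 2 * y ^ 2)) * Real.exp (-(2 * Real.pi ^ 2 * y ^ 2))) := by
        gcongr
    _ = 2 * A * (Real.exp (Real.pi ^ 2 * y ^ 2) * Real.exp (-(2 * Real.pi ^ 2 * y ^ 2))) := by ring
    _ ≤ _ := by gcongr

section Law

variable {Ω : Type*} [MeasurableSpace Ω] {P : Measure Ω}
  {Φ : 𝓢(ℝ, ℂ) → Ω → ℂ}

lemma IsWhiteNoise.exists_integral_norm_Y_pow_le [IsProbabilityMeasure P]
    (hΦ : IsWhiteNoise P Φ) (A ξ₀ t ξ : ℝ) {η : ℝ}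
    (hη : 0 < η) {k : ℕ} (hk : 1 ≤ k) : ∃ C, ∀ α, 0 < α →
      ∫ ω, ‖Y Φ A ξ₀ t ξ α η ω‖ ^ k ∂P ≤ C * α ^ (1 - (k : ℤ)) := by
  obtain ⟨C, hC⟩ := exists_integral_absMomentIntegrand_le A ξ₀ t ξ hη hk
  refine ⟨4 * Real.pi ^ 2 * (Real.pi ^ k)⁻¹ * C, fun α hα => ?_⟩
  have hp := Real.pi_pos
  rw [hΦ.integral_norm_Y_pow A ξ₀ t ξ hα hη k]
  refine (mul_le_mul_of_nonneg_left (hC α) (by positivity)).trans (le_of_eq (by ring))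

lemma IsWhiteNoise.exists_le_integral_norm_Y_pow [IsProbabilityMeasure P]
    (hΦ : IsWhiteNoise P Φ) (A ξ₀ t ξ : ℝ) {η : ℝ}
    (hη : 0 < η) {k : ℕ} (hk : 1 ≤ k) : ∃ c, 0 < c ∧ ∀ α, 0 < α → α < 1 →
      c * α ^ (1 - (k : ℤ)) ≤ ∫ ω, ‖Y Φ A ξ₀ t ξ α η ω‖ ^ k ∂P := by
  obtain ⟨c, hc, h⟩ := exists_le_integral_absMomentIntegrand A ξ₀ t ξ hη hk
  have hp := Real.pi_pos
  refine ⟨4 * Real.pi ^ 2 * (Real.pi ^ k)⁻¹ * c, by positivity, fun α hα hα1 => ?_⟩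
  rw [hΦ.integral_norm_Y_pow A ξ₀ t ξ hα hη k]
  exact (le_of_eq (by ring)).trans (mul_le_mul_of_nonneg_left (h α hα1) (by positivity))

/-- A bound for the absolute moments that is of order `η^(-1/2)` as `η → 0+`. -/
lemma IsWhiteNoise.exists_absMoment_bound [IsProbabilityMeasure P]
    (hΦ : IsWhiteNoise P Φ) {A : ℝ} (hA : 0 ≤ A) (ξ₀ t : ℝ)
    {ξ : ℝ} (hξ : 0 < ξ) {k : ℕ} (hk : 1 ≤ k) : ∃ C : ℝ → ℝ,
      C =O[𝓝[>] 0] (fun η : ℝ => η ^ (-(1 / 2) : ℝ)) ∧ ∀ η, 0 < η → ∀ α, 0 < α →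
        ∫ ω, ‖Y Φ A ξ₀ t ξ α η ω‖ ^ k ∂P ≤ C η * α ^ (1 - (k : ℤ)) := by
  obtain ⟨B, hB, h⟩ := hΦ.exists_integral_norm_Y_pow_le_near_zero hA ξ₀ t hξ hk
  obtain ⟨K, hK, hK'⟩ := exists_envelope
    (F := fun η α => (∫ ω, ‖Y Φ A ξ₀ t ξ α η ω‖ ^ k ∂P) / α ^ (1 - (k : ℤ)))
    (fun η α hα => div_nonneg (integral_nonneg fun ω => by positivity) (by positivity))
    (fun η hη => by
      obtain ⟨C, hC⟩ := hΦ.exists_integral_norm_Y_pow_le A ξ₀ t ξ hη hk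
      exact ⟨C, fun α hα => (div_le_iff₀ (by positivity)).2 (hC α hα)⟩)
  refine ⟨K, (hK' _ (fun _ => B) (Eventually.of_forall fun _ => hB) ?_).trans
    (const_isBigO_rpow_neg_half B), fun η hη α hα => (div_le_iff₀ (by positivity)).1 (hK η hη α hα)⟩
  filter_upwards [h] with η hη α hα
  exact (div_le_iff₀ (by positivity)).2 (hη α hα)

lemma norm_integral_pow_le (X : Ω → ℂ) (k : ℕ) :
    ‖∫ ω, X ω ^ k ∂P‖ ≤ ∫ ω, ‖X ω‖ ^ k ∂P := by
  refine (norm_integral_le_integral_norm _).trans (le_of_eq ?_)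
  simp only [norm_pow]

lemma IsWhiteNoise.norm_integral_Y_pow_le_of_one_le [IsProbabilityMeasure P]
    (hΦ : IsWhiteNoise P Φ) {A : ℝ} (hA : 0 ≤ A)
    (ξ₀ t ξ : ℝ) {k : ℕ} (hk : 1 ≤ k) : ∃ D, 0 ≤ D ∧ ∀ η, 1 ≤ η → ∀ α, 0 < α →
      ‖∫ ω, Y Φ A ξ₀ t ξ α η ω ^ k ∂P‖ ≤ D * (Real.exp (-(4 * Real.pi * η ^ 2)) +
        A * Real.exp (-(η - ξ₀) ^ 2)) * α ^ (1 - (k : ℤ)) := by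
  obtain ⟨C, hC, h⟩ := norm_integral_momentIntegrand_le hA ξ₀ t ξ hk
  have hp := Real.pi_pos
  have hE := windowEnergy_pos
  refine ⟨4 * Real.pi ^ 2 * (Real.pi ^ k)⁻¹ * (C * (2 * (windowEnergy + 2))), by positivity,
    fun η hη α hα => ?_⟩
  rw [hΦ.integral_Y_pow A ξ₀ t ξ hα (by linarith) k, norm_mul, Complex.norm_real,
    Real.norm_of_nonneg (by positivity)]
  have h1 := h η α hη
  have h2 := phase_mul_pseudoDecay_le_exp η
  have h3 := norm_signal_terms_le hA ξ₀ t η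
  have h4 : C * ((windowEnergy + 2) * ((1 + 4 * Real.pi ^ 2 * η ^ 2) * pseudoDecay η) +
      ‖signalValue A ξ₀ t η‖ + ‖-(2 * Real.pi * Complex.I * (ξ₀ - η) * signalValue A ξ₀ t η)‖) ≤
      C * (2 * (windowEnergy + 2)) * (Real.exp (-(4 * Real.pi * η ^ 2)) +
        A * Real.exp (-(η - ξ₀) ^ 2)) := by
    rw [mul_assoc C]
    refine mul_le_mul_of_nonneg_left ?_ hC
    have h5 := mul_le_mul_of_nonneg_left h2 (show 0 ≤ windowEnergy + 2 by linarith)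
    have h6 : 0 ≤ A * Real.exp (-(η - ξ₀) ^ 2) := by positivity
    nlinarith
  calc _ ≤ 4 * Real.pi ^ 2 * (Real.pi ^ k)⁻¹ * α ^ (1 - (k : ℤ)) *
        (C * (2 * (windowEnergy + 2)) * (Real.exp (-(4 * Real.pi * η ^ 2)) +
        A * Real.exp (-(η - ξ₀) ^ 2))) := by gcongr; exact h1.trans h4
    _ = _ := by ring

/-- A bound for the moments, with its behaviour as `η → 0+` and as `η → ∞`. -/
lemma IsWhiteNoise.exists_moment_bound [IsProbabilityMeasure P]
    (hΦ : IsWhiteNoise P Φ) {A ξ₀ : ℝ} (hA : 0 ≤ A)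
    (hξ₀ : 0 < ξ₀) (t : ℝ) {ξ : ℝ} (hξ : 0 < ξ) {k : ℕ} (hk : 1 ≤ k) : ∃ K : ℝ → ℝ,
      K =O[𝓝[>] 0] (fun η : ℝ => η ^ (-(1 / 2) : ℝ)) ∧
      (A = 0 → K =O[atTop] (fun η : ℝ => Real.exp (-(4 * Real.pi * η ^ 2)))) ∧
      (0 < A → K =O[atTop] (fun η : ℝ => Real.exp (-(η - ξ₀) ^ 2))) ∧
      ∀ η : ℝ, 0 < η → ∀ α : ℝ, 0 < α →
        ‖∫ ω, Y Φ A ξ₀ t ξ α η ω ^ k ∂P‖ ≤ K η * α ^ (1 - (k : ℤ)) := by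
  obtain ⟨B, hB, h⟩ := hΦ.exists_integral_norm_Y_pow_le_near_zero hA ξ₀ t hξ hk
  obtain ⟨D, hD, hD'⟩ := hΦ.norm_integral_Y_pow_le_of_one_le hA ξ₀ t ξ hk
  obtain ⟨K, hK, hK'⟩ := exists_envelope
    (F := fun η α => ‖∫ ω, Y Φ A ξ₀ t ξ α η ω ^ k ∂P‖ / α ^ (1 - (k : ℤ)))
    (fun η α hα => by positivity)
    (fun η hη => by
      obtain ⟨C, hC⟩ := hΦ.exists_integral_norm_Y_pow_le A ξ₀ t ξ hη hk
      exact ⟨C, fun α hα => (div_le_iff₀ (by positivity)).2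
        ((norm_integral_pow_le _ k).trans (hC α hα))⟩)
  have htop : K =O[atTop] fun η : ℝ => D * (Real.exp (-(4 * Real.pi * η ^ 2)) +
        A * Real.exp (-(η - ξ₀) ^ 2)) := by
    refine hK' _ _ (Eventually.of_forall fun η => by positivity) ?_
    filter_upwards [eventually_ge_atTop 1] with η hη α hα
    exact (div_le_iff₀ (by positivity)).2 (hD' η hη α hα)
  refine ⟨K, (hK' _ (fun _ => B) (Eventually.of_forall fun _ => hB) ?_).trans
    (const_isBigO_rpow_neg_half B), ?_, ?_, fun η hη α hα =>
      (div_le_iff₀ (by positivity)).1 (hK η hη α hα)⟩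
  · filter_upwards [h] with η hη α hα
    exact (div_le_iff₀ (by positivity)).2 ((norm_integral_pow_le _ k).trans (hη α hα))
  · rintro rfl
    refine htop.trans ?_
    simp only [zero_mul, add_zero]
    exact isBigO_const_mul_self D _ _
  · intro _
    refine htop.trans (IsBigO.const_mul_left (IsBigO.add ?_ (isBigO_const_mul_self A _ _)) D)
    refine IsBigO.of_bound 1 ?_
    -- For `η ≥ ξ₀ > 0` one has `(η - ξ₀)² ≤ η² ≤ 4πη²`, so the noise term is dominated by the
    -- signal term.
    filter_upwards [eventually_ge_atTop ξ₀] with η hη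
    rw [Real.norm_of_nonneg (Real.exp_pos _).le, Real.norm_of_nonneg (Real.exp_pos _).le, one_mul]
    refine Real.exp_le_exp.2 (neg_le_neg ?_)
    have h2 := Real.two_le_pi
    nlinarith [mul_nonneg (sq_nonneg η) (show 0 ≤ Real.pi - 2 by linarith)]

lemma complexVar_eq [IsProbabilityMeasure P] {X : Ω → ℂ} (hX : MemLp X 2 P) :
    complexVar P X = ∫ ω, ‖X ω‖ ^ 2 ∂P - ‖∫ ω, X ω ∂P‖ ^ 2 := by
  have h1 := hX.integrable one_le_two
  have h2 : Integrable (fun ω => ‖X ω‖ ^ 2) P := hX.integrable_norm_pow (by norm_num)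
  set m := ∫ ω, X ω ∂P with hm
  have e : ∀ ω, ‖X ω - m‖ ^ 2 = ‖X ω‖ ^ 2 - 2 * inner ℝ m (X ω) + ‖m‖ ^ 2 := fun ω => by
    rw [norm_sub_sq_real, real_inner_comm]
  have h3 : Integrable (fun ω => 2 * inner ℝ m (X ω)) P := (h1.const_inner m).const_mul 2
  simp only [complexVar]
  rw [← hm]
  simp_rw [e]
  have h4 : Integrable (fun ω => ‖X ω‖ ^ 2 - 2 * inner ℝ m (X ω)) P := h2.sub h3
  rw [integral_add h4 (integrable_const _), integral_sub h2 h3, integral_const_mul,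
    integral_inner h1, ← hm, real_inner_self_eq_norm_sq]
  simp
  ring

/-- The two conjugations cancel and leave `E[(X - E X)²]`. -/
lemma norm_complexCov_conj_le (X : Ω → ℂ) :
    ‖complexCov P X (fun ω => (starRingEnd ℂ) (X ω))‖ ≤ complexVar P X := by
  unfold complexCov complexVar
  refine (norm_integral_le_integral_norm _).trans (le_of_eq ?_)
  congr 1
  funext ω
  rw [integral_conj, ← map_sub, Complex.conj_conj, norm_mul, sq]

theorem IsWhiteNoise.variance_bounds [IsProbabilityMeasure P]
    (hΦ : IsWhiteNoise P Φ) {A : ℝ} (hA : 0 ≤ A) (ξ₀ t : ℝ)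
    {ξ : ℝ} (hξ : 0 < ξ) : ∃ c C : ℝ → ℝ,
      C =O[𝓝[>] 0] (fun η : ℝ => η ^ (-(1 / 2) : ℝ)) ∧ ∀ η : ℝ, 0 < η → 0 < c η ∧
        (∀ α, 0 < α → complexVar P (Y Φ A ξ₀ t ξ α η) ≤ C η * α⁻¹) ∧
        ∀ᶠ α in 𝓝[>] (0 : ℝ), c η * α⁻¹ ≤ complexVar P (Y Φ A ξ₀ t ξ α η) := by
  obtain ⟨C, hC, hC'⟩ := hΦ.exists_absMoment_bound hA ξ₀ t hξ (k := 2) (by norm_num)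
  have hz : ∀ α : ℝ, α ^ (1 - ((2 : ℕ) : ℤ)) = α⁻¹ := fun α => by norm_num
  have hvar : ∀ η α : ℝ, 0 < α → complexVar P (Y Φ A ξ₀ t ξ α η) =
      ∫ ω, ‖Y Φ A ξ₀ t ξ α η ω‖ ^ 2 ∂P - ‖∫ ω, Y Φ A ξ₀ t ξ α η ω ∂P‖ ^ 2 := fun η α hα =>
    complexVar_eq (hΦ.memLp_Y A ξ₀ t ξ hα η (by norm_num))
  have hlow : ∀ η, 0 < η → ∃ c, 0 < c ∧ ∀ᶠ α in 𝓝[>] (0 : ℝ),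
      c * α⁻¹ ≤ complexVar P (Y Φ A ξ₀ t ξ α η) := by
    intro η hη
    obtain ⟨c, hc, h1⟩ := hΦ.exists_le_integral_norm_Y_pow A ξ₀ t ξ hη (k := 2) (by norm_num)
    obtain ⟨B, hB⟩ := hΦ.exists_integral_norm_Y_pow_le A ξ₀ t ξ hη (k := 1) le_rfl
    refine ⟨c / 2, by positivity, ?_⟩
    -- The mean is bounded by `B`, while the second moment is at least `c α⁻¹`; this threshold gives
    -- `B² ≤ (c / 2) α⁻¹`, so half of the second moment bound remains.
    filter_upwards [Ioo_mem_nhdsGT (show 0 < min 1 (c / (2 * (B ^ 2 + 1))) by positivity)]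
      with α hα
    have hα1 := hα.2.trans_le (min_le_left _ _)
    have hα2 := hα.2.trans_le (min_le_right _ _)
    have b1 := h1 α hα.1 hα1
    have b2 := (norm_integral_pow_le (P := P) (Y Φ A ξ₀ t ξ α η) 1).trans (hB α hα.1)
    simp only [pow_one, Nat.cast_one, sub_self, zpow_zero, mul_one] at b2
    rw [hz] at b1
    rw [hvar η α hα.1]
    have b3 : ‖∫ ω, Y Φ A ξ₀ t ξ α η ω ∂P‖ ^ 2 ≤ B ^ 2 := by gcongr
    have b4 : B ^ 2 ≤ c / 2 * α⁻¹ := by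
      rw [lt_div_iff₀ (by positivity)] at hα2
      rw [← div_eq_mul_inv, le_div_iff₀ hα.1]
      nlinarith [hα.1]
    have b5 : c * α⁻¹ = c / 2 * α⁻¹ + c / 2 * α⁻¹ := by ring
    linarith
  choose! c hc using hlow
  refine ⟨c, C, hC, fun η hη => ⟨(hc η hη).1, fun α hα => ?_, (hc η hη).2⟩⟩
  have := hC' η hη α hα
  rw [hz] at this
  rw [hvar η α hα]
  linarith [sq_nonneg ‖∫ ω, Y Φ A ξ₀ t ξ α η ω ∂P‖]

end Law

/-! ### The mean on the ridge. -/

lemma norm_add_pow_three_le (z v : ℂ) : ‖z + v‖ ^ 3 ≤ 4 * (‖z‖ ^ 3 + ‖v‖ ^ 3) := by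
  have h := norm_add_le z v
  have h1 := norm_nonneg z
  have h2 := norm_nonneg v
  calc ‖z + v‖ ^ 3 ≤ (‖z‖ + ‖v‖) ^ 3 := by gcongr
    _ ≤ _ := by nlinarith [mul_nonneg (add_nonneg h1 h2) (sq_nonneg (‖z‖ - ‖v‖))]

/-- For an even weight, the integral of the cubic `‖z + v‖² (z + v)` is comparable to
`‖v‖ ∫ Q (‖z‖² + ‖v‖²)`. -/
lemma norm_integral_even_cubic {Q : ℂ → ℝ} (hc : Continuous Q) (h0 : ∀ z, 0 ≤ Q z)
    (heven : ∀ z, Q (-z) = Q z) (hi : ∀ n : ℕ, Integrable fun z => Q z * ‖z‖ ^ n) (v : ℂ) :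
    ‖v‖ * ∫ z, Q z * (‖z‖ ^ 2 + ‖v‖ ^ 2) ≤ ‖∫ z, (Q z * ‖z + v‖ ^ 2) • (z + v)‖ ∧
    ‖∫ z, (Q z * ‖z + v‖ ^ 2) • (z + v)‖ ≤ 3 * (‖v‖ * ∫ z, Q z * (‖z‖ ^ 2 + ‖v‖ ^ 2)) := by
  have iJ : Integrable fun z => Q z * (‖z‖ ^ 2 + ‖v‖ ^ 2) := by
    refine ((hi 2).add ((hi 0).mul_const (‖v‖ ^ 2))).congr (ae_of_all _ fun z => ?_)
    simp only [Pi.add_apply]; ring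
  have iF : Integrable fun z => (Q z * ‖z + v‖ ^ 2) • (z + v) := by
    refine (((hi 3).add ((hi 0).mul_const (‖v‖ ^ 3))).const_mul 4).mono'
      (Continuous.aestronglyMeasurable (by fun_prop)) (ae_of_all _ fun z => ?_)
    have := h0 z
    rw [norm_smul, Real.norm_of_nonneg (by positivity)]
    simp only [Pi.add_apply, pow_zero, mul_one]
    calc _ = Q z * ‖z + v‖ ^ 3 := by ring
      _ ≤ Q z * (4 * (‖z‖ ^ 3 + ‖v‖ ^ 3)) := by gcongr; exact norm_add_pow_three_le z v
      _ = _ := by ring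
  set I := ∫ z, (Q z * ‖z + v‖ ^ 2) • (z + v) with hI
  set J := ∫ z, Q z * (‖z‖ ^ 2 + ‖v‖ ^ 2) with hJ
  have iF' := iF.comp_neg
  -- Symmetrisation under `z ↦ -z`. Only the terms even in `z` survive: a positive multiple of `v`
  -- and `4 Q ⟨v, z⟩ z`.
  have e1 : I + I = ∫ z, ((Q z * ‖z + v‖ ^ 2) • (z + v) +
      (Q (-z) * ‖-z + v‖ ^ 2) • (-z + v)) := by
    rw [integral_add iF iF', integral_neg_eq_self (fun z => (Q z * ‖z + v‖ ^ 2) • (z + v))]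
  have e2 : ∀ z, (Q z * ‖z + v‖ ^ 2) • (z + v) + (Q (-z) * ‖-z + v‖ ^ 2) • (-z + v) =
      (2 * (Q z * (‖z‖ ^ 2 + ‖v‖ ^ 2))) • v + (4 * Q z * inner ℝ v z) • z := by
    intro z
    rw [heven, norm_add_sq_real, norm_add_sq_real, norm_neg, inner_neg_left, real_inner_comm]
    module
  have iG : Integrable fun z => (2 * (Q z * (‖z‖ ^ 2 + ‖v‖ ^ 2))) • v +
      (4 * Q z * inner ℝ v z) • z := by
    refine (iF.add iF').congr (ae_of_all _ fun z => ?_)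
    simp only [Pi.add_apply, e2]
  simp_rw [e2] at e1
  constructor
  · rcases eq_or_ne v 0 with hv | hv
    · rw [hv, norm_zero, zero_mul]; exact norm_nonneg _
    have hv' : 0 < ‖v‖ := norm_pos_iff.2 hv
    -- Pairing with `v` turns the second term into `4 Q ⟨v, z⟩² ≥ 0`, so it can only help.
    have h1 : ‖v‖ ^ 2 * (2 * J) ≤ inner ℝ v (I + I) := by
      rw [e1, ← integral_inner iG, hJ, ← integral_const_mul, ← integral_const_mul]
      refine integral_mono ((iJ.const_mul 2).const_mul _) (iG.const_inner v) fun z => ?_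
      simp only
      rw [inner_add_right, real_inner_smul_right, real_inner_smul_right,
        real_inner_self_eq_norm_sq]
      have := h0 z
      have : 0 ≤ Q z * (inner ℝ v z * inner ℝ v z) := by
        have := mul_self_nonneg (inner ℝ v z)
        positivity
      nlinarith
    have h2 := real_inner_le_norm v (I + I)
    have h3 : ‖I + I‖ = 2 * ‖I‖ := by rw [← two_smul ℝ I, norm_smul]; simp
    rw [h3] at h2
    have h4 : ‖v‖ * (‖v‖ * J) ≤ ‖v‖ * ‖I‖ := by nlinarith
    exact le_of_mul_le_mul_left h4 hv'
  · have h3 : ‖I + I‖ = 2 * ‖I‖ := by rw [← two_smul ℝ I, norm_smul]; simp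
    have h1 : ‖I + I‖ ≤ 6 * ‖v‖ * J := by
      rw [e1, hJ, ← integral_const_mul]
      refine norm_integral_le_of_norm_le (iJ.const_mul _) (ae_of_all _ fun z => ?_)
      have hq := h0 z
      refine (norm_add_le _ _).trans ?_
      rw [norm_smul, norm_smul, Real.norm_of_nonneg (by positivity), Real.norm_eq_abs, abs_mul,
        abs_of_nonneg (show 0 ≤ 4 * Q z by positivity)]
      have h5 := abs_real_inner_le_norm v z
      calc _ ≤ 2 * (Q z * (‖z‖ ^ 2 + ‖v‖ ^ 2)) * ‖v‖ + 4 * Q z * (‖v‖ * ‖z‖) * ‖z‖ := by gcongr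
        -- A nonnegative term is added to complete `‖z‖²` to `‖z‖² + ‖v‖²`; this gives `6 = 2 + 4`,
        -- and half of it is the factor `3`.
        _ ≤ 2 * (Q z * (‖z‖ ^ 2 + ‖v‖ ^ 2)) * ‖v‖ + 4 * Q z * (‖v‖ * ‖z‖) * ‖z‖ +
            4 * Q z * ‖v‖ * ‖v‖ ^ 2 := le_add_of_nonneg_right (by positivity)
        _ = _ := by ring
    linarith

lemma le_gaussDensity {l L v : ℝ} (hl : 0 < l) (h1 : l ≤ v) (h2 : v ≤ L) (x : ℝ) :
    peak L * Real.exp (-(x ^ 2 / (2 * l))) ≤ gaussDensity v x := by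
  have hv : 0 < v := hl.trans_le h1
  have := Real.pi_pos
  have := Real.sqrt_pos.2 (show 0 < 2 * Real.pi * v by positivity)
  unfold gaussDensity peak
  gcongr

/-- At `m = 0` the residuals are slope times a component of `z`, so they enlarge the exponent at
most by the factor `1 + L²`. -/
lemma le_noiseDensity_zero {θ : NoiseParam} {l L : ℝ} (h : θ.InBox l L) (z : ℂ) :
    peak L ^ 4 * Real.exp (-((1 + L ^ 2) / (2 * l) * ‖z‖ ^ 2)) ≤ noiseDensity θ z 0 := by
  have hL := h.upper_pos
  have hl := h.pos
  have hp := (peak_pos hL).le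
  have h1 := le_gaussDensity hl h.le_zre h.zre_le z.re
  have h2 := le_gaussDensity hl h.le_zim h.zim_le z.im
  have h3 := le_gaussDensity hl h.le_mim h.mim_le ((0 : ℂ).im - θ.slopeIm * z.re)
  have h4 := le_gaussDensity hl h.le_mre h.mre_le ((0 : ℂ).re - θ.slopeRe * z.im)
  have s1 : θ.slopeIm ^ 2 ≤ L ^ 2 := by
    rw [← sq_abs]; have := h.slopeIm_le; gcongr
  have s2 : θ.slopeRe ^ 2 ≤ L ^ 2 := by
    rw [← sq_abs]; have := h.slopeRe_le; gcongr
  have e : peak L ^ 4 * Real.exp (-((1 + L ^ 2) / (2 * l) * ‖z‖ ^ 2)) ≤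
      peak L * Real.exp (-(z.re ^ 2 / (2 * l))) * (peak L * Real.exp (-(z.im ^ 2 / (2 * l)))) *
      (peak L * Real.exp (-(((0 : ℂ).im - θ.slopeIm * z.re) ^ 2 / (2 * l))) *
        (peak L * Real.exp (-(((0 : ℂ).re - θ.slopeRe * z.im) ^ 2 / (2 * l))))) := by
    have e' : ∀ a b c d : ℝ, peak L * Real.exp a * (peak L * Real.exp b) *
        (peak L * Real.exp c * (peak L * Real.exp d)) =
        peak L ^ 4 * Real.exp (a + b + c + d) := by
      intro a b c d; rw [Real.exp_add, Real.exp_add, Real.exp_add]; ring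
    rw [e']
    gcongr
    rw [Complex.sq_norm, Complex.normSq_apply, Complex.zero_im, Complex.zero_re]
    have t1 := mul_le_mul_of_nonneg_right s1 (sq_nonneg z.re)
    have t2 := mul_le_mul_of_nonneg_right s2 (sq_nonneg z.im)
    have e3 : -((1 + L ^ 2) / (2 * l) * (z.re * z.re + z.im * z.im)) =
      (-((1 + L ^ 2) * (z.re * z.re + z.im * z.im))) / (2 * l) := by ring
    have e4 : -(z.re ^ 2 / (2 * l)) + -(z.im ^ 2 / (2 * l)) +
        -((0 - θ.slopeIm * z.re) ^ 2 / (2 * l)) + -((0 - θ.slopeRe * z.im) ^ 2 / (2 * l)) =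
        (-(z.re ^ 2 + z.im ^ 2 + θ.slopeIm ^ 2 * z.re ^ 2 + θ.slopeRe ^ 2 * z.im ^ 2)) /
          (2 * l) := by ring
    rw [e3, e4]
    gcongr ?_ / _
    nlinarith
  refine e.trans ?_
  unfold noiseDensity
  have g := gaussDensity_nonneg
  have g1 := g θ.zre z.re
  have g2 := g θ.zim z.im
  have g3 := g θ.mim ((0 : ℂ).im - θ.slopeIm * z.re)
  gcongr

/-- The moment integral on the ridge with vanishing reassignment numerator. -/
lemma ridge_integral_bounds {l L : ℝ} (hl : 0 < l) (hL : 0 < L) : ∃ c C, 0 < c ∧ 0 < C ∧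
    ∀ θ : NoiseParam, θ.InBox l L → ∀ v : ℂ,
      c * (‖v‖ * (1 + ‖v‖ ^ 2)) ≤ ‖∫ z, (noiseDensity θ z 0 * ‖z + v‖ ^ 2) • (z + v)‖ ∧
      ‖∫ z, (noiseDensity θ z 0 * ‖z + v‖ ^ 2) • (z + v)‖ ≤ C * (‖v‖ * (1 + ‖v‖ ^ 2)) := by
  set κ := (1 + L ^ 2) / (2 * l)
  have hκ : 0 < κ := by positivity
  have hb := boxRate_pos hL
  have hpL := peak_pos hL
  have hpl := peak_pos hl
  let M : ℝ → ℕ → ℝ := fun κ n => ∫ z : ℂ, ‖z‖ ^ n * Real.exp (-(κ * ‖z‖ ^ 2))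
  have hM : ∀ κ, 0 < κ → ∀ n, 0 < M κ n := by
    intro κ hκ n
    refine (integral_pos_iff_support_of_nonneg (fun z => by positivity)
      (integrable_norm_pow_mul_exp n hκ)).2 ?_
    refine lt_of_lt_of_le ?_ (measure_mono (s := {0}ᶜ) fun z hz => ?_)
    · exact isOpen_compl_singleton.measure_pos volume ⟨1, by simp⟩
    · have : 0 < ‖z‖ := norm_pos_iff.2 hz
      simp only [Function.mem_support]
      positivity
  refine ⟨peak L ^ 4 * min (M κ 0) (M κ 2),
    3 * (peak l ^ 4 * max (M (boxRate L) 0) (M (boxRate L) 2)), ?_, ?_, fun θ h v => ?_⟩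
  · have := lt_min (hM κ hκ 0) (hM κ hκ 2); positivity
  · have := lt_max_of_lt_left (c := M (boxRate L) 2) (hM _ hb 0); positivity
  have hc : Continuous fun z => noiseDensity θ z 0 := by fun_prop
  have hup : ∀ z, noiseDensity θ z 0 ≤ peak l ^ 4 * Real.exp (-(boxRate L * ‖z‖ ^ 2)) := fun z =>
    noiseDensity_le_left h z 0
  have hi : ∀ n : ℕ, Integrable fun z => noiseDensity θ z 0 * ‖z‖ ^ n := fun n => by
    refine ((integrable_norm_pow_mul_exp n hb).const_mul (peak l ^ 4)).mono'
      (Continuous.aestronglyMeasurable (by fun_prop)) (ae_of_all _ fun z => ?_)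
    rw [Real.norm_of_nonneg (mul_nonneg (noiseDensity_nonneg _ _ _) (by positivity))]
    calc _ ≤ peak l ^ 4 * Real.exp (-(boxRate L * ‖z‖ ^ 2)) * ‖z‖ ^ n := by gcongr; exact hup z
      _ = _ := by ring
  obtain ⟨b1, b2⟩ := norm_integral_even_cubic hc (fun z => noiseDensity_nonneg _ _ _)
    (fun z => by simpa using noiseDensity_neg θ z 0) hi v
  have hJ : ∫ z, noiseDensity θ z 0 * (‖z‖ ^ 2 + ‖v‖ ^ 2) =
      (∫ z, noiseDensity θ z 0 * ‖z‖ ^ 2) + ‖v‖ ^ 2 * ∫ z, noiseDensity θ z 0 * ‖z‖ ^ 0 := by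
    rw [← integral_const_mul, ← integral_add (hi 2) ((hi 0).const_mul _)]
    congr 1; funext z; ring
  have lo : ∀ n : ℕ, peak L ^ 4 * M κ n ≤ ∫ z, noiseDensity θ z 0 * ‖z‖ ^ n := fun n => by
    rw [← integral_const_mul]
    refine integral_mono ((integrable_norm_pow_mul_exp n hκ).const_mul _) (hi n) fun z => ?_
    simp only
    calc _ = peak L ^ 4 * Real.exp (-(κ * ‖z‖ ^ 2)) * ‖z‖ ^ n := by ring
      _ ≤ _ := by gcongr; exact le_noiseDensity_zero h z
  have up : ∀ n : ℕ, ∫ z, noiseDensity θ z 0 * ‖z‖ ^ n ≤ peak l ^ 4 * M (boxRate L) n := fun n => by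
    rw [← integral_const_mul]
    refine integral_mono (hi n) ((integrable_norm_pow_mul_exp n hb).const_mul _) fun z => ?_
    simp only
    calc _ ≤ peak l ^ 4 * Real.exp (-(boxRate L * ‖z‖ ^ 2)) * ‖z‖ ^ n := by gcongr; exact hup z
      _ = _ := by ring
  rw [hJ] at b1 b2
  have m1 := min_le_left (M κ 0) (M κ 2)
  have m2 := min_le_right (M κ 0) (M κ 2)
  have m3 := le_max_left (M (boxRate L) 0) (M (boxRate L) 2)
  have m4 := le_max_right (M (boxRate L) 0) (M (boxRate L) 2)
  constructor
  · refine le_trans ?_ b1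
    calc _ = ‖v‖ * (peak L ^ 4 * min (M κ 0) (M κ 2) +
          ‖v‖ ^ 2 * (peak L ^ 4 * min (M κ 0) (M κ 2))) := by ring
      _ ≤ _ := by
        gcongr
        · exact (mul_le_mul_of_nonneg_left m2 (by positivity)).trans (lo 2)
        · exact (mul_le_mul_of_nonneg_left m1 (by positivity)).trans (lo 0)
  · refine b2.trans ?_
    calc _ ≤ 3 * (‖v‖ * (peak l ^ 4 * max (M (boxRate L) 0) (M (boxRate L) 2) +
          ‖v‖ ^ 2 * (peak l ^ 4 * max (M (boxRate L) 0) (M (boxRate L) 2)))) := by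
          gcongr
          · exact (up 2).trans (mul_le_mul_of_nonneg_left m4 (by positivity))
          · exact (up 0).trans (mul_le_mul_of_nonneg_left m3 (by positivity))
      _ = _ := by ring

lemma momentIntegrand_ridge (A ξ₀ t α : ℝ) (y : ℂ × ℂ) :
    momentIntegrand A ξ₀ t ξ₀ α ξ₀ 1 y =
      (noiseDensity (noiseParam ξ₀) (y.1 - signalValue A ξ₀ t ξ₀)
        (((2 * Real.pi * Real.sqrt α * ‖y.1‖ : ℝ) : ℂ) * y.2) *
        (‖y.1‖ ^ 2 * Real.exp (-‖y.2‖ ^ 2))) • y.1 := by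
  rw [momentIntegrand, sstDensity, fibreDensity, Complex.real_smul, pow_one]
  simp

lemma integral_exp_neg_sq_norm_pos : 0 < ∫ w : ℂ, Real.exp (-‖w‖ ^ 2) := by
  have hi : Integrable fun w : ℂ => Real.exp (-‖w‖ ^ 2) := by
    simpa using integrable_exp_neg_mul_sq_norm (zero_lt_one (α := ℝ))
  exact integral_exp_pos hi

/-- No random variable corresponds to `α = 0`, but the integrand still makes sense there. On the
ridge `m` then vanishes identically, so `w` decouples and the integral factors. -/
lemma integral_momentIntegrand_ridge_zero (A ξ₀ t : ℝ) :
    ∫ y, momentIntegrand A ξ₀ t ξ₀ 0 ξ₀ 1 y = (∫ w : ℂ, Real.exp (-‖w‖ ^ 2)) •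
      ∫ z, (noiseDensity (noiseParam ξ₀) z 0 * ‖z + signalValue A ξ₀ t ξ₀‖ ^ 2) •
        (z + signalValue A ξ₀ t ξ₀) := by
  set v := signalValue A ξ₀ t ξ₀
  have e : ∀ y, momentIntegrand A ξ₀ t ξ₀ 0 ξ₀ 1 y =
      ((noiseDensity (noiseParam ξ₀) (y.1 - v) 0 * ‖y.1 - v + v‖ ^ 2) • (y.1 - v + v)) *
        ((Real.exp (-‖y.2‖ ^ 2) : ℝ) : ℂ) := by
    intro y
    rw [momentIntegrand_ridge, sub_add_cancel, Real.sqrt_zero]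
    simp only [mul_zero, zero_mul, Complex.ofReal_zero, Complex.real_smul]
    push_cast
    ring
  simp_rw [e]
  rw [Measure.volume_eq_prod, integral_prod_mul (fun V : ℂ =>
      (noiseDensity (noiseParam ξ₀) (V - v) 0 * ‖V - v + v‖ ^ 2) • (V - v + v))
      (fun w : ℂ => ((Real.exp (-‖w‖ ^ 2) : ℝ) : ℂ)),
    integral_sub_right_eq_self (fun z : ℂ =>
      (noiseDensity (noiseParam ξ₀) z 0 * ‖z + v‖ ^ 2) • (z + v)) v, integral_complex_ofReal,
    mul_comm, Complex.real_smul]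

lemma NoiseParam.Close.refl (θ : NoiseParam) : θ.Close θ 0 := by
  constructor <;> simp

lemma norm_add_pow_four_mul_le {A : ℝ} (hA : 0 ≤ A) {z v : ℂ} (hv : ‖v‖ ≤ A) :
    ‖z + v‖ ^ 4 * (1 + ‖z‖) ≤ 16 * (1 + A) ^ 4 * (‖z‖ ^ 0 + ‖z‖ ^ 5) := by
  have hz := norm_nonneg z
  have h1 : ‖z + v‖ ≤ (1 + A) * (1 + ‖z‖) := by
    refine (norm_add_le _ _).trans ?_
    nlinarith [mul_nonneg hA hz]
  have h2 := add_pow_le (zero_le_one (α := ℝ)) hz 5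
  calc _ ≤ ((1 + A) * (1 + ‖z‖)) ^ 4 * (1 + ‖z‖) := by gcongr
    _ = (1 + A) ^ 4 * (1 + ‖z‖) ^ 5 := by ring
    _ ≤ (1 + A) ^ 4 * (2 ^ (5 - 1) * (1 ^ 5 + ‖z‖ ^ 5)) := by gcongr
    _ = _ := by norm_num; ring

/-- The moment integral on the ridge converges to its value at `α = 0` at rate `√α`. -/
lemma exists_norm_integral_ridge_sub_le {l L : ℝ} (hl : 0 < l) (hL : 0 < L) {A : ℝ} (hA : 0 ≤ A) :
    ∃ G, 0 ≤ G ∧ ∀ ξ₀, 0 < ξ₀ → (noiseParam ξ₀).InBox l L → ∀ t α,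
      ‖(∫ y, momentIntegrand A ξ₀ t ξ₀ α ξ₀ 1 y) - ∫ y, momentIntegrand A ξ₀ t ξ₀ 0 ξ₀ 1 y‖ ≤
        G * Real.sqrt α := by
  obtain ⟨C, hC, H⟩ := noiseDensity_sub_le hl hL (le_refl (0 : ℝ))
  have hp := Real.pi_pos
  have hκ : 0 < (8 * L)⁻¹ := by positivity
  let b : ℂ → ℝ := fun z => 16 * (1 + A) ^ 4 *
    (‖z‖ ^ 0 * Real.exp (-((8 * L)⁻¹ * ‖z‖ ^ 2)) + ‖z‖ ^ 5 * Real.exp (-((8 * L)⁻¹ * ‖z‖ ^ 2)))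
  let g : ℂ → ℝ := fun w => ‖w‖ ^ 1 * Real.exp (-(1 * ‖w‖ ^ 2))
  have ib : Integrable b :=
    ((integrable_norm_pow_mul_exp 0 hκ).add (integrable_norm_pow_mul_exp 5 hκ)).const_mul _
  have ig : Integrable g := integrable_norm_pow_mul_exp 1 zero_lt_one
  refine ⟨C * (2 * Real.pi) * ((∫ z, b z) * ∫ w, g w), ?_, fun ξ₀ hξ₀ h t α => ?_⟩
  · have h1 : 0 ≤ ∫ z, b z := integral_nonneg fun z => by simp only [b]; positivity
    have h2 : 0 ≤ ∫ w, g w := integral_nonneg fun z => by simp only [g]; positivity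
    positivity
  set v := signalValue A ξ₀ t ξ₀ with hv
  have hvA : ‖v‖ ≤ A := by
    rw [hv, norm_signalValue hA]; simp
  have ibg : Integrable (fun y : ℂ × ℂ => b (y.1 - v) * g y.2) := by
    rw [Measure.volume_eq_prod]
    exact (ib.comp_sub_right v).mul_prod ig
  rw [← integral_sub (integrable_momentIntegrand A ξ₀ t ξ₀ α hξ₀ le_rfl)
    (integrable_momentIntegrand A ξ₀ t ξ₀ 0 hξ₀ le_rfl)]
  have e : (∫ z, b z) * ∫ w, g w = ∫ y : ℂ × ℂ, b (y.1 - v) * g y.2 := by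
    rw [Measure.volume_eq_prod, integral_prod_mul (fun z => b (z - v)) g,
      integral_sub_right_eq_self b v]
  rw [e, mul_right_comm, ← integral_const_mul]
  refine norm_integral_le_of_norm_le (ibg.const_mul _) (ae_of_all _ fun y => ?_)
  rw [momentIntegrand_ridge, momentIntegrand_ridge, ← sub_smul, ← sub_mul, norm_smul, norm_mul,
    Real.norm_of_nonneg (show 0 ≤ ‖y.1‖ ^ 2 * Real.exp (-‖y.2‖ ^ 2) by positivity),
    Real.norm_eq_abs]
  -- Same parameters (`ε = 0`) and `v = 0`: the only change is the shift `2π√α ‖V‖ w` of `m`, which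
  -- supplies the factor `√α`.
  have h1 := H _ _ h h 0 (NoiseParam.Close.refl _) (y.1 - v) 0 0
    (((2 * Real.pi * Real.sqrt α * ‖y.1‖ : ℝ) : ℂ) * y.2) (by simp)
  rw [sub_zero, zero_add, norm_zero, zero_add, zero_add, norm_mul, Complex.norm_real,
    Real.norm_of_nonneg (by positivity)] at h1
  have h2 := norm_add_pow_four_mul_le hA (z := y.1 - v) hvA
  rw [sub_add_cancel] at h2
  simp only [Real.sqrt_zero, mul_zero, zero_mul, Complex.ofReal_zero]
  calc _ ≤ C * (2 * Real.pi * Real.sqrt α * ‖y.1‖ * ‖y.2‖) *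
        ((1 + ‖y.1 - v‖) * Real.exp (-((8 * L)⁻¹ * ‖y.1 - v‖ ^ 2))) *
        (‖y.1‖ ^ 2 * Real.exp (-‖y.2‖ ^ 2)) * ‖y.1‖ := by gcongr
    _ = C * (2 * Real.pi) * Real.sqrt α * (((‖y.1‖ ^ 4 * (1 + ‖y.1 - v‖)) *
        Real.exp (-((8 * L)⁻¹ * ‖y.1 - v‖ ^ 2))) * (‖y.2‖ * Real.exp (-‖y.2‖ ^ 2))) := by ring
    _ ≤ C * (2 * Real.pi) * Real.sqrt α * ((16 * (1 + A) ^ 4 * (‖y.1 - v‖ ^ 0 + ‖y.1 - v‖ ^ 5) *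
        Real.exp (-((8 * L)⁻¹ * ‖y.1 - v‖ ^ 2))) * (‖y.2‖ * Real.exp (-‖y.2‖ ^ 2))) := by gcongr
    _ = _ := by simp only [b, g]; ring_nf

section Law

variable {Ω : Type*} [MeasurableSpace Ω] {P : Measure Ω} {Φ : 𝓢(ℝ, ℂ) → Ω → ℂ}

lemma IsWhiteNoise.norm_integral_Y [IsProbabilityMeasure P] (hΦ : IsWhiteNoise P Φ)
    (A ξ₀ t ξ : ℝ) {α η : ℝ} (hα : 0 < α) (hη : 0 < η) :
    ‖∫ ω, Y Φ A ξ₀ t ξ α η ω ∂P‖ = 4 * Real.pi * ‖∫ y, momentIntegrand A ξ₀ t ξ α η 1 y‖ := by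
  have h := hΦ.integral_Y_pow A ξ₀ t ξ hα hη 1
  simp only [pow_one, Nat.cast_one, sub_self, zpow_zero, mul_one] at h
  have hp := Real.pi_pos
  rw [h, norm_mul, Complex.norm_real, Real.norm_of_nonneg (by positivity)]
  congr 1
  field_simp

/-- The mean on the ridge `η = ξ = ξ₀` is of order `A (1 + A²)`. -/
theorem IsWhiteNoise.mean_ridge_bounds [IsProbabilityMeasure P] (hΦ : IsWhiteNoise P Φ) :
    ∃ m M : ℝ, 0 < m ∧ 0 < M ∧ ∀ A : ℝ, 0 < A → ∃ α₀ : ℝ, 0 < α₀ ∧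
      ∀ ξ₀ t α : ℝ, 1 ≤ ξ₀ → 0 < α → α < α₀ →
        m * (A * (1 + A ^ 2)) ≤ ‖∫ ω, Y Φ A ξ₀ t ξ₀ α ξ₀ ω ∂P‖ ∧
        ‖∫ ω, Y Φ A ξ₀ t ξ₀ α ξ₀ ω ∂P‖ ≤ M * (A * (1 + A ^ 2)) := by
  have hE := windowEnergy_pos
  have hp := Real.pi_pos
  have hl : 0 < windowEnergy / 8 := by positivity
  have hL : 0 < windowEnergy + 1 := by positivity
  obtain ⟨c, C, hc, hC, H⟩ := ridge_integral_bounds hl hL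
  have hW := integral_exp_neg_sq_norm_pos
  set W := ∫ w : ℂ, Real.exp (-‖w‖ ^ 2)
  refine ⟨4 * Real.pi * (W * c / 2), 4 * Real.pi * (W * C + W * c / 2), by positivity,
    by positivity, fun A hA => ?_⟩
  obtain ⟨G, hG, H'⟩ := exists_norm_integral_ridge_sub_le hl hL hA.le
  set φ := A * (1 + A ^ 2) with hφ
  have hφ0 : 0 < φ := by positivity
  -- The threshold makes the error `G √α` at most half of the lower bound `W c φ`. It depends on `A`
  -- alone, since the parameter box is common to all `ξ₀ ≥ 1`.
  refine ⟨(W * c * φ / (2 * (G + 1))) ^ 2, by positivity, fun ξ₀ t α hξ₀ hα hα' => ?_⟩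
  have h0 : 0 < ξ₀ := by linarith
  have hbox := (noiseParam_inBox hξ₀).1
  have hv : ‖signalValue A ξ₀ t ξ₀‖ = A := by rw [norm_signalValue hA.le]; simp
  obtain ⟨b1, b2⟩ := H _ hbox (signalValue A ξ₀ t ξ₀)
  have h1 := H' ξ₀ h0 hbox t α
  rw [integral_momentIntegrand_ridge_zero] at h1
  rw [hv, ← hφ] at b1 b2
  set I₀ := ∫ z, (noiseDensity (noiseParam ξ₀) z 0 * ‖z + signalValue A ξ₀ t ξ₀‖ ^ 2) •
        (z + signalValue A ξ₀ t ξ₀)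
  rw [hΦ.norm_integral_Y A ξ₀ t ξ₀ hα h0]
  set I := ∫ y, momentIntegrand A ξ₀ t ξ₀ α ξ₀ 1 y
  have hs : Real.sqrt α ≤ W * c * φ / (2 * (G + 1)) := by
    rw [Real.sqrt_le_left (by positivity)]; exact hα'.le
  have h2 : G * Real.sqrt α ≤ W * c / 2 * φ := by
    calc _ ≤ (G + 1) * (W * c * φ / (2 * (G + 1))) := by gcongr; linarith
      _ = _ := by field_simp
  have h3 : ‖W • I₀‖ = W * ‖I₀‖ := by rw [norm_smul, Real.norm_of_nonneg hW.le]
  have h4 := norm_sub_norm_le I (W • I₀)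
  have h5 := norm_sub_norm_le (W • I₀) I
  rw [norm_sub_rev] at h5
  rw [h3] at h4 h5
  have b3 := mul_le_mul_of_nonneg_left b1 hW.le
  have b4 := mul_le_mul_of_nonneg_left b2 hW.le
  constructor
  · rw [mul_assoc (4 * Real.pi)]
    refine mul_le_mul_of_nonneg_left ?_ (by positivity)
    linarith
  · rw [mul_assoc (4 * Real.pi)]
    refine mul_le_mul_of_nonneg_left ?_ (by positivity)
    linarith

end Law

/-! ### The mean off the ridge. -/

/-- The source of the exponent `5`: three powers from the cube and two from the real dimension of
`ℂ`. -/
lemma integral_norm_cube_mul_exp_scaled {κ D : ℝ} (hD : 0 < D) :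
    ∫ z : ℂ, ‖z‖ ^ 3 * Real.exp (-(κ * D ^ 2 * ‖z‖ ^ 2)) =
      (∫ z : ℂ, ‖z‖ ^ 3 * Real.exp (-(κ * ‖z‖ ^ 2))) / D ^ 5 := by
  have h := Measure.integral_comp_smul (volume : Measure ℂ)
    (fun z : ℂ => ‖z‖ ^ 3 * Real.exp (-(κ * ‖z‖ ^ 2))) D
  have e : ∀ z : ℂ, ‖D • z‖ ^ 3 * Real.exp (-(κ * ‖D • z‖ ^ 2)) =
      D ^ 3 * (‖z‖ ^ 3 * Real.exp (-(κ * D ^ 2 * ‖z‖ ^ 2))) := by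
    intro z
    rw [norm_smul, Real.norm_of_nonneg hD.le, mul_pow, mul_pow, mul_assoc κ]
    ring
  simp_rw [e] at h
  rw [integral_const_mul, Complex.finrank_real_complex, abs_of_pos (by positivity),
    smul_eq_mul] at h
  rw [eq_div_iff (by positivity)]
  calc _ = D ^ 2 * (D ^ 3 * ∫ z : ℂ, ‖z‖ ^ 3 * Real.exp (-(κ * D ^ 2 * ‖z‖ ^ 2))) := by ring
    _ = _ := by rw [h, mul_inv_cancel_left₀ (by positivity)]

/-- Away from the ridge, either the reassignment numerator is large compared to `‖V‖` or `‖w‖` is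
large. -/
lemma absMomentIntegrand_off_ridge_le {l L ξ₀ : ℝ} (h : (noiseParam ξ₀).InBox l L) (A t ξ : ℝ)
    {α : ℝ} (hα : 0 < α) (hα' : α < 1) (y : ℂ × ℂ) :
    absMomentIntegrand A ξ₀ t ξ α ξ₀ 1 y ≤ peak l ^ 4 *
      ((‖y.1‖ ^ 3 * Real.exp (-(boxRate L * Real.pi ^ 2 * |ξ - ξ₀| ^ 2 * ‖y.1‖ ^ 2))) *
          Real.exp (-(1 / 2 * ‖y.2‖ ^ 2)) +
        Real.exp (-(1 / 8 * |ξ - ξ₀| ^ 2)) *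
          ((‖y.1‖ ^ 3 * Real.exp (-(boxRate L * ‖y.1 - signalValue A ξ₀ t ξ₀‖ ^ 2))) *
            Real.exp (-(1 / 2 * ‖y.2‖ ^ 2)))) := by
  obtain ⟨V, w⟩ := y
  set v := signalValue A ξ₀ t ξ₀
  have hp := Real.pi_pos
  have hb := boxRate_pos h.upper_pos
  have hpk := peak_pos h.pos
  set x := |ξ - ξ₀| with hx
  have hx0 : 0 ≤ x := abs_nonneg _
  set s := Real.sqrt α
  have hs : 0 < s := Real.sqrt_pos.2 hα
  have hs1 : s ≤ 1 := by
    rw [Real.sqrt_le_one]; exact hα'.le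
  set m : ℂ := ((2 * Real.pi * s * ‖V‖ : ℝ) : ℂ) * w + -(2 * Real.pi * Complex.I * (ξ₀ - ξ)) * V
    with hm
  have e : absMomentIntegrand A ξ₀ t ξ α ξ₀ 1 (V, w) =
      noiseDensity (noiseParam ξ₀) (V - v) m * (‖V‖ ^ 3 * Real.exp (-‖w‖ ^ 2)) := by
    rw [absMomentIntegrand, sstDensity, fibreDensity, hm]
    simp [v, s]
  rw [e]
  have hn : 0 ≤ ‖w‖ := norm_nonneg w
  -- Here `m = 2π√α‖V‖w + aV` with `|a| = 2π|ξ - ξ₀|`. If `w` is small, the second term dominates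
  -- and `‖m‖ ≥ π|ξ - ξ₀|‖V‖`. Otherwise `‖w‖ ≥ |ξ - ξ₀|/2`, and half of `exp(-‖w‖²)` pays for the
  -- decay.
  by_cases hc : 2 * s * ‖w‖ ≤ x
  · have h1 : Real.pi * x * ‖V‖ ≤ ‖m‖ := by
      have h2 : ‖-(2 * Real.pi * Complex.I * (ξ₀ - ξ)) * V‖ = 2 * Real.pi * x * ‖V‖ := by
        rw [← Complex.ofReal_sub, norm_mul, norm_neg]
        simp only [norm_mul, Complex.norm_I, Complex.norm_real, Complex.norm_ofNat, mul_one,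
          Real.norm_eq_abs, abs_of_pos hp]
        rw [abs_sub_comm]
      have h3 : ‖((2 * Real.pi * s * ‖V‖ : ℝ) : ℂ) * w‖ ≤ Real.pi * x * ‖V‖ := by
        rw [norm_mul, Complex.norm_real, Real.norm_of_nonneg (by positivity)]
        calc _ = Real.pi * (2 * s * ‖w‖) * ‖V‖ := by ring
          _ ≤ _ := by gcongr
      have h4 := norm_sub_le m (((2 * Real.pi * s * ‖V‖ : ℝ) : ℂ) * w)
      rw [hm, add_sub_cancel_left, h2, ← hm] at h4
      linarith
    have h5 : noiseDensity (noiseParam ξ₀) (V - v) m ≤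
        peak l ^ 4 * Real.exp (-(boxRate L * Real.pi ^ 2 * x ^ 2 * ‖V‖ ^ 2)) := by
      refine (noiseDensity_le_right h _ _).trans ?_
      refine mul_le_mul_of_nonneg_left (Real.exp_le_exp.2 (neg_le_neg ?_)) (by positivity)
      calc _ = boxRate L * (Real.pi * x * ‖V‖) ^ 2 := by ring
        _ ≤ _ := by gcongr
    have h6 : Real.exp (-‖w‖ ^ 2) ≤ Real.exp (-(1 / 2 * ‖w‖ ^ 2)) :=
      Real.exp_le_exp.2 (by nlinarith [sq_nonneg ‖w‖])
    calc _ ≤ peak l ^ 4 * Real.exp (-(boxRate L * Real.pi ^ 2 * x ^ 2 * ‖V‖ ^ 2)) *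
          (‖V‖ ^ 3 * Real.exp (-(1 / 2 * ‖w‖ ^ 2))) := by gcongr
      _ = peak l ^ 4 * ((‖V‖ ^ 3 * Real.exp (-(boxRate L * Real.pi ^ 2 * x ^ 2 * ‖V‖ ^ 2))) *
          Real.exp (-(1 / 2 * ‖w‖ ^ 2))) := by ring
      _ ≤ _ := by
          refine mul_le_mul_of_nonneg_left ?_ (by positivity)
          exact le_add_of_nonneg_right (by positivity)
  · push Not at hc
    have h1 : x ≤ 2 * ‖w‖ := by nlinarith
    have h2 : Real.exp (-‖w‖ ^ 2) ≤
        Real.exp (-(1 / 8 * x ^ 2)) * Real.exp (-(1 / 2 * ‖w‖ ^ 2)) := by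
      rw [← Real.exp_add]
      refine Real.exp_le_exp.2 ?_
      nlinarith
    have h3 := noiseDensity_le_left h (V - v) m
    calc _ ≤ peak l ^ 4 * Real.exp (-(boxRate L * ‖V - v‖ ^ 2)) *
          (‖V‖ ^ 3 * (Real.exp (-(1 / 8 * x ^ 2)) * Real.exp (-(1 / 2 * ‖w‖ ^ 2)))) := by gcongr
      _ = peak l ^ 4 * (Real.exp (-(1 / 8 * x ^ 2)) * ((‖V‖ ^ 3 *
          Real.exp (-(boxRate L * ‖V - v‖ ^ 2))) * Real.exp (-(1 / 2 * ‖w‖ ^ 2)))) := by ring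
      _ ≤ _ := by
          refine mul_le_mul_of_nonneg_left ?_ (by positivity)
          exact le_add_of_nonneg_left (by positivity)

lemma exists_integral_norm_cube_shifted_le {κ : ℝ} (hκ : 0 < κ) : ∃ C, 0 ≤ C ∧ ∀ v : ℂ,
    Integrable (fun V : ℂ => ‖V‖ ^ 3 * Real.exp (-(κ * ‖V - v‖ ^ 2))) ∧
    ∫ V : ℂ, ‖V‖ ^ 3 * Real.exp (-(κ * ‖V - v‖ ^ 2)) ≤ C * (1 + ‖v‖ ^ 3) := by
  have i3 := integrable_norm_pow_mul_exp 3 hκ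
  have i0 := integrable_exp_neg_mul_sq_norm hκ
  have n3 : 0 ≤ ∫ z : ℂ, ‖z‖ ^ 3 * Real.exp (-(κ * ‖z‖ ^ 2)) :=
    integral_nonneg fun z => by positivity
  have n0 : 0 ≤ ∫ z : ℂ, Real.exp (-(κ * ‖z‖ ^ 2)) := integral_nonneg fun z => by positivity
  refine ⟨4 * ((∫ z : ℂ, ‖z‖ ^ 3 * Real.exp (-(κ * ‖z‖ ^ 2))) +
    ∫ z : ℂ, Real.exp (-(κ * ‖z‖ ^ 2))), by positivity, fun v => ?_⟩
  have hb : ∀ z : ℂ, ‖z + v‖ ^ 3 * Real.exp (-(κ * ‖z‖ ^ 2)) ≤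
      4 * (‖z‖ ^ 3 * Real.exp (-(κ * ‖z‖ ^ 2)) + ‖v‖ ^ 3 * Real.exp (-(κ * ‖z‖ ^ 2))) := by
    intro z
    calc _ ≤ 4 * (‖z‖ ^ 3 + ‖v‖ ^ 3) * Real.exp (-(κ * ‖z‖ ^ 2)) := by
          gcongr; exact norm_add_pow_three_le z v
      _ = _ := by ring
  have im := (i3.add (i0.const_mul (‖v‖ ^ 3))).const_mul 4
  have iz : Integrable fun z : ℂ => ‖z + v‖ ^ 3 * Real.exp (-(κ * ‖z‖ ^ 2)) := by
    refine im.mono' (Continuous.aestronglyMeasurable (by fun_prop)) (ae_of_all _ fun z => ?_)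
    rw [Real.norm_of_nonneg (by positivity)]
    exact hb z
  have e : (fun V : ℂ => ‖V‖ ^ 3 * Real.exp (-(κ * ‖V - v‖ ^ 2))) = fun V : ℂ =>
      ‖V - v + v‖ ^ 3 * Real.exp (-(κ * ‖V - v‖ ^ 2)) := by
    funext V; rw [sub_add_cancel]
  rw [e]
  refine ⟨iz.comp_sub_right v, ?_⟩
  rw [integral_sub_right_eq_self (fun z : ℂ => ‖z + v‖ ^ 3 * Real.exp (-(κ * ‖z‖ ^ 2))) v]
  refine (integral_mono iz im hb).trans ?_
  simp only [Pi.add_apply]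
  rw [integral_const_mul, integral_add i3 (i0.const_mul _), integral_const_mul, mul_assoc]
  refine mul_le_mul_of_nonneg_left ?_ (by norm_num)
  have : 0 ≤ ‖v‖ ^ 3 := by positivity
  nlinarith

/-- Off the ridge the first absolute moment is `O(|ξ - ξ₀|⁻⁵)`. -/
theorem exists_integral_absMomentIntegrand_off_ridge_le {l L : ℝ} (hl : 0 < l) (hL : 0 < L) :
    ∃ C, 0 < C ∧ ∀ A ξ₀ t ξ α : ℝ, 0 ≤ A → 0 < ξ₀ → (noiseParam ξ₀).InBox l L → 0 < |ξ - ξ₀| →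
      0 < α → α < 1 → ∫ y, absMomentIntegrand A ξ₀ t ξ α ξ₀ 1 y ≤
        C * (1 + A ^ 3) / |ξ - ξ₀| ^ 5 := by
  have hb := boxRate_pos hL
  have hp := Real.pi_pos
  have hpk := peak_pos hl
  obtain ⟨C1, hC1, H1⟩ := exists_integral_norm_cube_shifted_le hb
  obtain ⟨C2, hC2, H2⟩ := pow_mul_exp_le 5 (show (0 : ℝ) < 1 / 8 by norm_num)
  have iw := integrable_exp_neg_mul_sq_norm (show (0 : ℝ) < 1 / 2 by norm_num)
  set W := ∫ w : ℂ, Real.exp (-(1 / 2 * ‖w‖ ^ 2)) with hW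
  have hW0 : 0 ≤ W := integral_nonneg fun z => by positivity
  set N := ∫ z : ℂ, ‖z‖ ^ 3 * Real.exp (-(boxRate L * Real.pi ^ 2 * ‖z‖ ^ 2)) with hN
  have hN0 : 0 ≤ N := integral_nonneg fun z => by positivity
  refine ⟨peak l ^ 4 * (N * W + C2 * (C1 * W)) + 1, by positivity,
    fun A ξ₀ t ξ α hA hξ₀ h hx hα hα' => ?_⟩
  set v := signalValue A ξ₀ t ξ₀ with hv
  have hvA : ‖v‖ = A := by rw [hv, norm_signalValue hA]; simp
  set x := |ξ - ξ₀|
  obtain ⟨i1, j1⟩ := H1 v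
  rw [hvA] at j1
  have i2 : Integrable fun V : ℂ =>
      ‖V‖ ^ 3 * Real.exp (-(boxRate L * Real.pi ^ 2 * x ^ 2 * ‖V‖ ^ 2)) :=
    integrable_norm_pow_mul_exp 3 (by positivity)
  have p1 : Integrable fun y : ℂ × ℂ =>
      (‖y.1‖ ^ 3 * Real.exp (-(boxRate L * Real.pi ^ 2 * x ^ 2 * ‖y.1‖ ^ 2))) *
        Real.exp (-(1 / 2 * ‖y.2‖ ^ 2)) := by
    rw [Measure.volume_eq_prod]; exact i2.mul_prod iw
  have p2 : Integrable fun y : ℂ × ℂ => (‖y.1‖ ^ 3 * Real.exp (-(boxRate L * ‖y.1 - v‖ ^ 2))) *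
      Real.exp (-(1 / 2 * ‖y.2‖ ^ 2)) := by
    rw [Measure.volume_eq_prod]; exact i1.mul_prod iw
  refine (integral_mono (integrable_absMomentIntegrand A ξ₀ t ξ α hξ₀ le_rfl)
    ((p1.add (p2.const_mul (Real.exp (-(1 / 8 * x ^ 2))))).const_mul (peak l ^ 4))
    (absMomentIntegrand_off_ridge_le h A t ξ hα hα')).trans ?_
  simp only [Pi.add_apply]
  rw [integral_const_mul, integral_add p1 (p2.const_mul _), integral_const_mul,
    Measure.volume_eq_prod,
    integral_prod_mul (fun V : ℂ =>
      ‖V‖ ^ 3 * Real.exp (-(boxRate L * Real.pi ^ 2 * x ^ 2 * ‖V‖ ^ 2)))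
      (fun w : ℂ => Real.exp (-(1 / 2 * ‖w‖ ^ 2))),
    integral_prod_mul (fun V : ℂ => ‖V‖ ^ 3 * Real.exp (-(boxRate L * ‖V - v‖ ^ 2)))
      (fun w : ℂ => Real.exp (-(1 / 2 * ‖w‖ ^ 2))),
    integral_norm_cube_mul_exp_scaled hx, ← hW, ← hN]
  -- The Gaussian decay in `|ξ - ξ₀|` is weakened to the same fifth power.
  have h2 : Real.exp (-(1 / 8 * x ^ 2)) ≤ C2 / x ^ 5 := by
    rw [le_div_iff₀ (by positivity), mul_comm]; exact H2 x hx.le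
  have hA3 : 0 ≤ A ^ 3 := by positivity
  have n1 : 0 ≤ ∫ V : ℂ, ‖V‖ ^ 3 * Real.exp (-(boxRate L * ‖V - v‖ ^ 2)) :=
    integral_nonneg fun z => by positivity
  calc _ ≤ peak l ^ 4 * (N / x ^ 5 * W + C2 / x ^ 5 * (C1 * (1 + A ^ 3) * W)) := by gcongr
    _ = (peak l ^ 4 * (N * W * 1 + C2 * (C1 * W) * (1 + A ^ 3))) / x ^ 5 := by ring
    _ ≤ _ := by
      refine div_le_div_of_nonneg_right ?_ (by positivity)
      have t1 : 0 ≤ peak l ^ 4 * (N * W) * A ^ 3 := by positivity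
      nlinarith

section Law

variable {Ω : Type*} [MeasurableSpace Ω] {P : Measure Ω} {Φ : 𝓢(ℝ, ℂ) → Ω → ℂ}

/-- The mean off the ridge, uniformly over noise parameters in a box. -/
theorem IsWhiteNoise.exists_mean_off_ridge_le [IsProbabilityMeasure P] (hΦ : IsWhiteNoise P Φ)
    {l L : ℝ} (hl : 0 < l) (hL : 0 < L) :
    ∃ C, 0 < C ∧ ∀ A ξ₀ t ξ α : ℝ, 0 ≤ A → 0 < ξ₀ → (noiseParam ξ₀).InBox l L → 0 < |ξ - ξ₀| →
      0 < α → α < 1 → ‖∫ ω, Y Φ A ξ₀ t ξ α ξ₀ ω ∂P‖ ≤ C * (1 + A ^ 3) / |ξ - ξ₀| ^ 5 := by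
  obtain ⟨C, hC, H⟩ := exists_integral_absMomentIntegrand_off_ridge_le hl hL
  have hp := Real.pi_pos
  refine ⟨4 * Real.pi * C, by positivity, fun A ξ₀ t ξ α hA hξ₀ h hx hα hα' => ?_⟩
  rw [hΦ.norm_integral_Y A ξ₀ t ξ hα hξ₀, mul_assoc (4 * Real.pi), mul_div_assoc]
  refine mul_le_mul_of_nonneg_left ?_ (by positivity)
  refine (norm_integral_le_integral_norm _).trans ?_
  simp only [norm_momentIntegrand]
  exact H A ξ₀ t ξ α hA hξ₀ h hx hα hα'

end Law

end SST

/-! ### Assembly of the main theorem. -/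

theorem mainTheorem4 {Ω : Type*} [MeasurableSpace Ω] (P : Measure Ω) [IsProbabilityMeasure P]
    (Φ : 𝓢(ℝ, ℂ) → Ω → ℂ) (hΦ : SST.IsWhiteNoise P Φ) :
    -- absolute moments and moments, in the null case `A = 0` and the non-null case `0 < A`
    (∀ A ξ₀ t ξ : ℝ, 0 ≤ A → 0 < ξ₀ → 0 < ξ → ∀ k : ℕ, 1 ≤ k →
      -- all moments are finite
      (∀ η α : ℝ, 0 < η → 0 < α → MemLp (SST.Y Φ A ξ₀ t ξ α η) k P) ∧
      -- `E|Y|^k ≍ α^(1-k)`, with constants depending on `η`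
      (∃ α₀ : ℝ, 0 < α₀ ∧ ∃ c C : ℝ → ℝ,
        C =O[𝓝[>] 0] (fun η : ℝ => η ^ (-(1 / 2) : ℝ)) ∧
        ∀ η : ℝ, 0 < η → 0 < c η ∧ ∀ α : ℝ, 0 < α → α < α₀ →
          c η * α ^ (1 - (k : ℤ)) ≤ ∫ ω, ‖SST.Y Φ A ξ₀ t ξ α η ω‖ ^ k ∂P ∧
          ∫ ω, ‖SST.Y Φ A ξ₀ t ξ α η ω‖ ^ k ∂P ≤ C η * α ^ (1 - (k : ℤ))) ∧
      -- `|E Y^k| = O(α^(1-k))`, with the behaviour of the constant in `η`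
      (∃ α₀ : ℝ, 0 < α₀ ∧ ∃ K : ℝ → ℝ,
        K =O[𝓝[>] 0] (fun η : ℝ => η ^ (-(1 / 2) : ℝ)) ∧
        (A = 0 → K =O[atTop] (fun η : ℝ => Real.exp (-(4 * Real.pi * η ^ 2)))) ∧
        (0 < A → K =O[atTop] (fun η : ℝ => Real.exp (-(η - ξ₀) ^ 2))) ∧
        ∀ η : ℝ, 0 < η → ∀ α : ℝ, 0 < α → α < α₀ →
          ‖∫ ω, SST.Y Φ A ξ₀ t ξ α η ω ^ k ∂P‖ ≤ K η * α ^ (1 - (k : ℤ))) ∧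
      -- odd moments vanish in the null case
      (A = 0 → Odd k → ∀ η α : ℝ, 0 < η → 0 < α →
        ∫ ω, SST.Y Φ A ξ₀ t ξ α η ω ^ k ∂P = 0)) ∧
    -- variance, and covariance of `Y` with its complex conjugate
    (∀ A ξ₀ t ξ : ℝ, 0 ≤ A → 0 < ξ₀ → 0 < ξ →
      (∃ c C : ℝ → ℝ, C =O[𝓝[>] 0] (fun η : ℝ => η ^ (-(1 / 2) : ℝ)) ∧
        ∀ η : ℝ, 0 < η → 0 < c η ∧ ∀ᶠ α in 𝓝[>] (0 : ℝ),
          c η * α⁻¹ ≤ SST.complexVar P (SST.Y Φ A ξ₀ t ξ α η) ∧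
          SST.complexVar P (SST.Y Φ A ξ₀ t ξ α η) ≤ C η * α⁻¹) ∧
      (∃ α₀ : ℝ, 0 < α₀ ∧ ∃ K : ℝ → ℝ,
        ∀ η : ℝ, 0 < η → ∀ α : ℝ, 0 < α → α < α₀ →
          ‖SST.complexCov P (SST.Y Φ A ξ₀ t ξ α η)
            (fun ω => (starRingEnd ℂ) (SST.Y Φ A ξ₀ t ξ α η ω))‖ ≤ K η * α⁻¹)) ∧
    -- the mean at `η = ξ = ξ₀`, for large `ξ₀`: constants `m * φ A`, `M * φ A` increasing in `A`
    (∃ m M Ξ : ℝ, 0 < m ∧ 0 < M ∧ 0 < Ξ ∧ ∃ φ : ℝ → ℝ, StrictMonoOn φ (Ioi 0) ∧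
      ∀ A : ℝ, 0 < A → 0 < φ A ∧ ∃ α₀ : ℝ, 0 < α₀ ∧
        ∀ ξ₀ t α : ℝ, Ξ ≤ ξ₀ → 0 < α → α < α₀ →
          m * φ A ≤ ‖∫ ω, SST.Y Φ A ξ₀ t ξ₀ α ξ₀ ω ∂P‖ ∧
          ‖∫ ω, SST.Y Φ A ξ₀ t ξ₀ α ξ₀ ω ∂P‖ ≤ M * φ A) ∧
    -- the mean at `η = ξ₀`, for large `|ξ - ξ₀|`
    (∀ A ξ₀ : ℝ, 0 < A → 0 < ξ₀ → ∃ C R α₀ : ℝ, 0 < R ∧ 0 < α₀ ∧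
      ∀ t ξ α : ℝ, 0 < ξ → R ≤ |ξ - ξ₀| → 0 < α → α < α₀ →
        ‖∫ ω, SST.Y Φ A ξ₀ t ξ α ξ₀ ω ∂P‖ ≤ C / |ξ - ξ₀| ^ 5) ∧
    -- for large `ξ₀` the last constant is an increasing function of `A * ξ₀`
    (∃ Ξ R α₀ : ℝ, 0 < Ξ ∧ 0 < R ∧ 0 < α₀ ∧ ∃ C : ℝ → ℝ, StrictMonoOn C (Ioi 0) ∧
      ∀ A ξ₀ t ξ α : ℝ, 0 < A → Ξ ≤ ξ₀ → 0 < ξ → R ≤ |ξ - ξ₀| → 0 < α → α < α₀ →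
        ‖∫ ω, SST.Y Φ A ξ₀ t ξ α ξ₀ ω ∂P‖ ≤ C (A * ξ₀) / |ξ - ξ₀| ^ 5) := by
  have hE := SST.windowEnergy_pos
  refine ⟨?_, ?_, ?_, ?_, ?_⟩
  · intro A ξ₀ t ξ hA hξ₀ hξ k hk
    refine ⟨fun η α _ hα => hΦ.memLp_Y A ξ₀ t ξ hα η (ENNReal.natCast_ne_top k), ?_, ?_, ?_⟩
    · obtain ⟨C, hC, hC'⟩ := hΦ.exists_absMoment_bound hA ξ₀ t hξ hk
      have hlow := fun (η : ℝ) (hη : 0 < η) => hΦ.exists_le_integral_norm_Y_pow A ξ₀ t ξ hη hk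
      choose! c hc using hlow
      exact ⟨1, one_pos, c, C, hC, fun η hη => ⟨(hc η hη).1, fun α hα hα' =>
        ⟨(hc η hη).2 α hα hα', hC' η hη α hα⟩⟩⟩
    · obtain ⟨K, h1, h2, h3, h4⟩ := hΦ.exists_moment_bound hA hξ₀ t hξ hk
      exact ⟨1, one_pos, K, h1, h2, h3, fun η hη α hα _ => h4 η hη α hα⟩
    · rintro rfl hodd η α hη hα
      rw [hΦ.integral_Y_pow 0 ξ₀ t ξ hα hη k, SST.integral_momentIntegrand_odd ξ₀ t ξ α η hodd,
        mul_zero]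
  · intro A ξ₀ t ξ hA _ hξ
    obtain ⟨c, C, hC, h⟩ := hΦ.variance_bounds hA ξ₀ t hξ
    refine ⟨⟨c, C, hC, fun η hη => ⟨(h η hη).1, ?_⟩⟩, 1, one_pos, C, fun η hη α hα _ =>
      (SST.norm_complexCov_conj_le _).trans ((h η hη).2.1 α hα)⟩
    filter_upwards [(h η hη).2.2, self_mem_nhdsWithin] with α h1 hα
    exact ⟨h1, (h η hη).2.1 α hα⟩
  · obtain ⟨m, M, hm, hM, h⟩ := hΦ.mean_ridge_bounds
    -- The increasing function is `φ(A) = A (1 + A²)`, and `Ξ = 1` because the common parameter box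
    -- is available from `ξ₀ = 1` on.
    refine ⟨m, M, 1, hm, hM, one_pos, fun A => A * (1 + A ^ 2), ?_, fun A hA =>
      ⟨by positivity, h A hA⟩⟩
    intro a ha b _ hab
    have ha' : 0 < a := ha
    simp only
    gcongr
  · intro A ξ₀ hA hξ₀
    -- For a fixed `ξ₀` any box containing its parameters will do; the constant then depends on `ξ₀`
    -- through the box.
    obtain ⟨l, L, hbox⟩ := SST.exists_inBox hξ₀
    obtain ⟨C, _, h⟩ := hΦ.exists_mean_off_ridge_le hbox.pos hbox.upper_pos
    exact ⟨C * (1 + A ^ 3), 1, 1, one_pos, one_pos, fun t ξ α _ hR hα hα' =>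
      h A ξ₀ t ξ α hA.le hξ₀ hbox (one_pos.trans_le hR) hα hα'⟩
  · obtain ⟨C, hC, h⟩ := hΦ.exists_mean_off_ridge_le (l := SST.windowEnergy / 8)
      (L := SST.windowEnergy + 1) (by positivity) (by positivity)
    refine ⟨1, 1, 1, one_pos, one_pos, one_pos, fun x => C * (1 + x ^ 3), ?_,
      fun A ξ₀ t ξ α hA hξ₀ _ hR hα hα' => ?_⟩
    · intro a ha b _ hab
      have ha' : 0 < a := ha
      simp only
      gcongr
    · refine (h A ξ₀ t ξ α hA.le (by linarith) (SST.noiseParam_inBox hξ₀).1 (one_pos.trans_le hR)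
        hα hα').trans ?_
      -- With the common box the constant `C (1 + A³)` does not involve `ξ₀`; since `ξ₀ ≥ 1` it is
      -- bounded by its value at `A * ξ₀`.
      have hAx : A ≤ A * ξ₀ := le_mul_of_one_le_right hA.le hξ₀
      simp only
      gcongr
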